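/- **Conventions.** A *sheaf of abelian groups on the big Zariski site* of a scheme $X$ is a contravariant functor from $X$-schemes to abelian groups satisfying the sheaf condition for Zariski open coverings. For an ideal $I$ of an $A$-algebra $B$, the functor of points of $\mathrm{Spf}(B)$ ($B$ with the $I$-adic topology) sends an $A$-scheme $T$ to the set of $A$-algebra homomorphisms $B\to\Gamma(T,\mathcal O_T)$ which, locally on $T$, kill some power of $I$. A *commutative formal Lie group* over $X$ is a sheaf $E$ of abelian groups on the big Zariski site of $X$ such that every $x\in X$ has an affine open neighbourhood $U=\mathrm{Spec}(A)$, an integer $d\ge 0$ and an isomorphism of functors of points $E|_U\cong \mathrm{Spf}(A[[x_1,\dots,x_d]])$ over $\mathrm{Spec}(A)$ (for the ideal $(x_1,\dots,x_d)$) under which $0\in E(U)$ corresponds to the point $x_i\mapsto 0$ for all $i$. Let $f:X\to S$ be a morphism of schemes and $E$ a commutative formal Lie group over $X$. For a morphism $T\to S$ put $X_T=X\times_S T$, let $f_T:X_T\to T$ be the projection, let $\iota: X\times_S T_{\mathrm{red}}\to X_T$ be the base change of $T_{\mathrm{red}}\to T$, and let $$\tilde E_T=\ker\bigl(E|_{X_T}\to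 \iota_*(E|_{X\times_S T_{\mathrm{red}}})\bigr),$$ a sheaf on the small Zariski site of $X_T$. For an integer $q\ge 0$ the functor $\Phi^q(X/S,E)$ from $S$-schemes to abelian groups is $T\mapsto \Gamma(T,R^qf_{T*}\tilde E_T)$; an $S$-morphism $h:T'\to T$ acts through the base change map $h^{-1}R^qf_{T*}\tilde E_T\to R^qf_{T'*}(\mathrm{id}_X\times h)^{-1}\tilde E_T\to R^qf_{T'*}\tilde E_{T'}$. Let $S=\mathrm{Spec}(R)$. A *nilpotent $R$-algebra* is a commutative $R$-algebra $\mathcal N$ without unit element such that $\mathcal N^r=0$ for some $r\ge 1$; then $R\oplus\mathcal N$ is an $R$-algebra with an augmentation $R\oplus\mathcal N\to R$, $(r,n)\mapsto r$. Let $\tilde E_{\mathcal N}$ be the kernel of the map from $\tilde E_{\mathrm{Spec}(R\oplus\mathcal N)}$ to the direct image of $\tilde E_{\mathrm{Spec}(R)}$ given by the augmentation. Since the projection $X_{\mathrm{Spec}(R\oplus\mathcal N)}\to X$ is a homeomorphism, $\tilde E_{\mathcal N}$ is regarded as a sheaf on $X$. Put $\Psi^q(X/S,E)(\mathcal N)=H^q(X,\tilde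 E_{\mathcal N})$, a functor from nilpotent $R$-algebras to abelian groups. **Proposition 2.2.4.** Let $q\ge 0$ be an integer, let $f:X\to S=\mathrm{Spec}(R)$ be a flat morphism between noetherian schemes and let $E$ be a commutative formal Lie group over $X$. Let $\mathfrak X$ be a commutative formal Lie group over $S$ which pro-represents $\Psi^q(X/S,E)$, i.e. there is an isomorphism of functors from nilpotent $R$-algebras to abelian groups $$\Psi^q(X/S,E)\cong\bigl[\mathcal N\mapsto\ker\bigl(\mathfrak X(R\oplus\mathcal N)\to\mathfrak X(R)\bigr)\bigr].$$ Then $\mathfrak X$ pro-represents the restriction of $\Phi^q(X/S,E)$ to noetherian $S$-schemes, i.e. there is an isomorphism $\Phi^q(X/S,E)(T)\cong\mathfrak X(T)$ of abelian groups for all noetherian $S$-schemes $T$, functorial in $T$. -/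

import Mathlib

universe u

open CategoryTheory Limits Opposite AlgebraicGeometry TopologicalSpace

namespace DeformationCohomology

noncomputable section

section Homological
variable {C : Type*} [Category* C] [Abelian C] {D : Type*} [Category* D] [Abelian D]

/-- The augmentation `Z ⟶ J⁰` of an injective resolution. -/
def augmentation {Z : C} (J : InjectiveResolution Z) : Z ⟶ J.cocomplex.X 0 := J.ι.f 0

instance {Z : C} (J : InjectiveResolution Z) : Mono (augmentation J) :=
  mono_of_isLimit_fork J.isLimitKernelFork

theorem augmentation_d {Z : C} (J : InjectiveResolution Z) :
    augmentation J ≫ J.cocomplex.d 0 1 = 0 :=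
  J.ι_f_zero_comp_complex_d

/-- Any morphism `a : Z ⟶ ker (L⁰ ⟶ L¹)` to a complex of injectives extends to a morphism of
complexes from an injective resolution of `Z` to `L`. -/
def descTo {Z : C} (J : InjectiveResolution Z) (L : CochainComplex C ℕ)
    (hL : ∀ n, Injective (L.X n)) (a : Z ⟶ L.X 0) (ha : a ≫ L.d 0 1 = 0) : J.cocomplex ⟶ L :=
  CochainComplex.mkHom _ _ (Injective.factorThru a (augmentation J))
    (J.exact₀.descToInjective (Injective.factorThru a (augmentation J) ≫ L.d 0 1) (by
      change augmentation J ≫ _ = 0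
      rw [← Category.assoc, Injective.comp_factorThru, ha]))
    (J.exact₀.comp_descToInjective _ _).symm
    fun n p => ⟨(J.exact_succ n).descToInjective (p.2.1 ≫ L.d (n + 1) (n + 2)) (by
        change J.cocomplex.d n (n + 1) ≫ _ = 0
        rw [← Category.assoc, ← p.2.2, Category.assoc, L.d_comp_d, comp_zero]),
      ((J.exact_succ n).comp_descToInjective _ _).symm⟩

theorem augmentation_descTo {Z : C} (J : InjectiveResolution Z) (L : CochainComplex C ℕ)
    (hL : ∀ n, Injective (L.X n)) (a : Z ⟶ L.X 0) (ha : a ≫ L.d 0 1 = 0) :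
    augmentation J ≫ (descTo J L hL a ha).f 0 = a := by
  simp only [descTo, CochainComplex.mkHom_f_0]
  exact Injective.comp_factorThru a (augmentation J)

/-- A morphism from an injective resolution to a complex of injectives is null-homotopic if it
vanishes on the augmentation. -/
def homotopyZero {Z : C} (J : InjectiveResolution Z) (L : CochainComplex C ℕ)
    (hL : ∀ n, Injective (L.X n)) (φ : J.cocomplex ⟶ L) (h : augmentation J ≫ φ.f 0 = 0) :
    Homotopy φ 0 :=
  Homotopy.mkCoinductive _ (J.exact₀.descToInjective (φ.f 0) h)
    (J.exact₀.comp_descToInjective (φ.f 0) h).symm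
    ((J.exact_succ 0).descToInjective
      (φ.f 1 - J.exact₀.descToInjective (φ.f 0) h ≫ L.d 0 1) (by
        change J.cocomplex.d 0 1 ≫ _ = 0
        rw [Preadditive.comp_sub, ← Category.assoc]
        erw [J.exact₀.comp_descToInjective (φ.f 0) h]
        rw [φ.comm, sub_self]))
    (by
      erw [(J.exact_succ 0).comp_descToInjective]
      rw [add_sub_cancel])
    fun n ⟨g, g', w⟩ => ⟨(J.exact_succ (n + 1)).descToInjective (φ.f (n + 2) - g' ≫ L.d _ _) (by
        change J.cocomplex.d (n + 1) (n + 2) ≫ _ = 0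
        rw [Preadditive.comp_sub, ← HomologicalComplex.Hom.comm, w, Preadditive.add_comp,
          Category.assoc, Category.assoc, HomologicalComplex.d_comp_d, comp_zero,
          zero_add, sub_self]),
      by
        erw [(J.exact_succ (n + 1)).comp_descToInjective]
        rw [add_sub_cancel]⟩

theorem homologyMap_eq_of_augmentation {Z : C} (J : InjectiveResolution Z)
    (L : CochainComplex C ℕ) (hL : ∀ n, Injective (L.X n)) (φ ψ : J.cocomplex ⟶ L)
    (h : augmentation J ≫ φ.f 0 = augmentation J ≫ ψ.f 0) (G : C ⥤ D) [G.Additive] (q : ℕ) :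
    HomologicalComplex.homologyMap ((G.mapHomologicalComplex (.up ℕ)).map φ) q =
      HomologicalComplex.homologyMap ((G.mapHomologicalComplex (.up ℕ)).map ψ) q :=
  (G.mapHomotopy (Homotopy.equivSubZero.symm (homotopyZero J L hL (φ - ψ) (by
    rw [HomologicalComplex.sub_f_apply, Preadditive.comp_sub, h, sub_self])))).homologyMap_eq q

/-- A family `θₙ : Mⁿ ⟶ G(Kⁿ)` compatible with the differentials, for complexes `M` and `K` in
two categories and a functor `G` between these. -/
@[ext]
structure ComplexHom (G : C ⥤ D) (M : CochainComplex D ℕ) (K : CochainComplex C ℕ) where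
  /-- the components -/
  f (n : ℕ) : M.X n ⟶ G.obj (K.X n)
  comm (i j : ℕ) : f i ≫ G.map (K.d i j) = M.d i j ≫ f j

namespace ComplexHom

theorem iCycles_comp {G : C ⥤ D} {M : CochainComplex D ℕ} {K : CochainComplex C ℕ}
    (θ : ComplexHom G M K) (q : ℕ) : (M.iCycles q ≫ θ.f q) ≫
    G.map (K.d q ((ComplexShape.up ℕ).next q)) = 0 := by
  rw [Category.assoc, θ.comm, HomologicalComplex.iCycles_d_assoc, zero_comp]

variable {G : C ⥤ D} [G.Additive] [PreservesFiniteLimits G] {M : CochainComplex D ℕ}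
  {K : CochainComplex C ℕ} (θ : ComplexHom G M K) (q : ℕ)

/-- The induced morphism `Z^q(M) ⟶ G(Z^q(K))` on cycles, for `G` left exact. -/
def cyclesMap : M.cycles q ⟶ G.obj (K.cycles q) :=
  (KernelFork.mapIsLimit _ (K.cyclesIsKernel q _ rfl) G).lift
    (KernelFork.ofι (M.iCycles q ≫ θ.f q) (θ.iCycles_comp q))

theorem cyclesMap_i : θ.cyclesMap q ≫ G.map (K.iCycles q) = M.iCycles q ≫ θ.f q :=
  (KernelFork.mapIsLimit _ (K.cyclesIsKernel q _ rfl) G).fac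
    (KernelFork.ofι (M.iCycles q ≫ θ.f q) (θ.iCycles_comp q)) WalkingParallelPair.zero

theorem toCycles_cyclesMap (p : ℕ) :
    M.toCycles p q ≫ θ.cyclesMap q = θ.f p ≫ G.map (K.toCycles p q) := by
  rw [← cancel_mono (G.map (K.iCycles q)), Category.assoc, Category.assoc, cyclesMap_i,
    HomologicalComplex.toCycles_i_assoc, ← G.map_comp, HomologicalComplex.toCycles_i, θ.comm]

/-- The induced morphism `H^q(M) ⟶ G(H^q(K))` on cohomology, for `G` left exact. -/
def homologyMap : M.homology q ⟶ G.obj (K.homology q) :=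
  (M.homologyIsCokernel _ q rfl).desc
    (CokernelCofork.ofπ (θ.cyclesMap q ≫ G.map (K.homologyπ q)) (by
      rw [← Category.assoc, toCycles_cyclesMap, Category.assoc, ← G.map_comp,
        HomologicalComplex.toCycles_comp_homologyπ, G.map_zero, comp_zero]))

theorem homologyπ_homologyMap :
    M.homologyπ q ≫ θ.homologyMap q = θ.cyclesMap q ≫ G.map (K.homologyπ q) :=
  (M.homologyIsCokernel _ q rfl).fac _ WalkingParallelPair.one

/-- Precomposition with a morphism of complexes. -/
def precomp {M' : CochainComplex D ℕ} (m : M' ⟶ M) (θ : ComplexHom G M K) :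
    ComplexHom G M' K where
  f n := m.f n ≫ θ.f n
  comm i j := by rw [Category.assoc, θ.comm, m.comm_assoc]

theorem homologyMap_precomp {M' : CochainComplex D ℕ} (m : M' ⟶ M) :
    (precomp m θ).homologyMap q = HomologicalComplex.homologyMap m q ≫ θ.homologyMap q := by
  have hc : (precomp m θ).cyclesMap q = HomologicalComplex.cyclesMap m q ≫ θ.cyclesMap q := by
    rw [← cancel_mono (G.map (K.iCycles q)), Category.assoc, cyclesMap_i, cyclesMap_i,
      HomologicalComplex.cyclesMap_i_assoc]
    rfl
  rw [← cancel_epi (M'.homologyπ q), homologyπ_homologyMap, hc, Category.assoc,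
    ← homologyπ_homologyMap, HomologicalComplex.homologyπ_naturality_assoc]

/-- Composition. -/
def comp {B : Type*} [Category* B] [Abelian B] {G' : B ⥤ C} {N : CochainComplex B ℕ}
    (θ : ComplexHom G M K) (η : ComplexHom G' K N) : ComplexHom (G' ⋙ G) M N where
  f n := θ.f n ≫ G.map (η.f n)
  comm i j := by
    rw [Category.assoc, Functor.comp_map, ← G.map_comp, η.comm, G.map_comp, ← Category.assoc,
      θ.comm, Category.assoc]

theorem homologyMap_comp {B : Type*} [Category* B] [Abelian B] {G' : B ⥤ C} [G'.Additive]
    [PreservesFiniteLimits G'] {N : CochainComplex B ℕ} (η : ComplexHom G' K N) :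
    (θ.comp η).homologyMap q = θ.homologyMap q ≫ G.map (η.homologyMap q) := by
  have hc : (θ.comp η).cyclesMap q = θ.cyclesMap q ≫ G.map (η.cyclesMap q) := by
    rw [← cancel_mono ((G' ⋙ G).map (N.iCycles q)), cyclesMap_i, Category.assoc,
      Functor.comp_map, ← G.map_comp, cyclesMap_i, G.map_comp, ← Category.assoc, cyclesMap_i,
      Category.assoc]
    rfl
  rw [← cancel_epi (M.homologyπ q), homologyπ_homologyMap, hc, ← Category.assoc,
    homologyπ_homologyMap, Category.assoc, Category.assoc, ← G.map_comp, homologyπ_homologyMap,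
    G.map_comp]
  rfl

/-- The morphism given by the components of a natural transformation `𝟭 ⟶ G`. -/
def ofNatTrans {G : D ⥤ D} (ε : 𝟭 D ⟶ G) (M : CochainComplex D ℕ) : ComplexHom G M M where
  f n := ε.app (M.X n)
  comm _ _ := (ε.naturality _).symm

theorem homologyMap_ofNatTrans {G : D ⥤ D} [G.Additive] [PreservesFiniteLimits G] (ε : 𝟭 D ⟶ G)
    (M : CochainComplex D ℕ) (q : ℕ) :
    (ofNatTrans ε M).homologyMap q = ε.app (M.homology q) := by
  have hc : (ofNatTrans ε M).cyclesMap q = ε.app (M.cycles q) := by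
    rw [← cancel_mono (G.map (M.iCycles q)), cyclesMap_i]
    exact ε.naturality _
  rw [← cancel_epi (M.homologyπ q), homologyπ_homologyMap, hc]
  exact (ε.naturality _).symm

end ComplexHom

end Homological

/-- Sheaves of abelian groups on the big Zariski site of `X`. -/
abbrev BigZariskiSheaf (X : Scheme.{u}) : Type _ :=
  Sheaf (Scheme.zariskiTopology.over X) AddCommGrpCat.{u}

/-- Sheaves of abelian groups on the topological space `Y`. -/
abbrev AbSheaf (Y : TopCat.{u}) : Type _ := TopCat.Sheaf AddCommGrpCat.{u} Y

/-- The direct image `f_*`. -/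
abbrev push {Y Z : TopCat.{u}} (f : Y ⟶ Z) : AbSheaf Y ⥤ AbSheaf Z :=
  TopCat.Sheaf.pushforward AddCommGrpCat.{u} f

instance {Y Z : TopCat.{u}} (f : Y ⟶ Z) : (push f).Additive where
  map_add := rfl

instance {Y Z : TopCat.{u}} (f : Y ⟶ Z) :
    (TopCat.Sheaf.pullback AddCommGrpCat.{u} f).PreservesMonomorphisms := by
  have : PreservesFiniteLimits (TopCat.Sheaf.pullback AddCommGrpCat.{u} f) := by
    unfold TopCat.Sheaf.pullback
    have : RepresentablyFlat (Opens.map f) := inferInstance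
    apply +allowSynthFailures Functor.sheafPullbackConstruction.preservesFiniteLimits
  infer_instance

instance {Y Z : TopCat.{u}} (f : Y ⟶ Z) (I : AbSheaf Y) [Injective I] :
    Injective ((push f).obj I) :=
  Injective.injective_of_adjoint (TopCat.Sheaf.pullbackPushforwardAdjunction AddCommGrpCat.{u} f) I

/-- An open subset `U` of an `X`-scheme `p : Y ⟶ X`, viewed as an `X`-scheme. -/
def opensOver {X Y : Scheme.{u}} (p : Y ⟶ X) : Y.Opens ⥤ Over X where
  obj U := Over.mk (U.ι ≫ p)
  map i := Over.homMk (Y.homOfLE i.le) (by simp)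
  map_id U := by ext1; exact Scheme.homOfLE_rfl _ _
  map_comp i j := by ext1; exact (Y.homOfLE_homOfLE i.le j.le).symm

theorem isSheaf_opensOver {X Y : Scheme.{u}} (E : BigZariskiSheaf X) (p : Y ⟶ X) :
    TopCat.Presheaf.IsSheaf (X := Y) ((opensOver p).op ⋙ E.obj) := by
  rw [TopCat.Presheaf.isSheaf_iff_isSheaf_comp' (forget AddCommGrpCat)]
  apply TopCat.Presheaf.isSheaf_of_isSheafUniqueGluing_types
  intro ι (U : ι → Y.Opens) sf hsf
  have hE : Presieve.IsSheaf (Scheme.zariskiTopology.over X) (E.obj ⋙ forget _) :=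
    Presieve.isSheaf_iso _ (Functor.isoWhiskerLeft E.obj AddCommGrpCat.coyonedaObjIsoForget)
      (E.2 _)
  let π (i : ι) : (opensOver p).obj (U i) ⟶ (opensOver p).obj (iSup U) :=
    (opensOver p).map (Opens.leSupr U i)
  have hmem : Sieve.generate (Presieve.ofArrows _ π) ∈
      Scheme.zariskiTopology.over X ((opensOver p).obj (iSup U)) := by
    rw [GrothendieckTopology.mem_over_iff]
    rw [show Sieve.generate (Presieve.ofArrows _ π) = Sieve.ofArrows _ π from rfl,
      Sieve.overEquiv_ofArrows]
    exact (Scheme.Opens.iSupOpenCover (X := Y) U).mem_grothendieckTopology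
  have := (Presieve.isSheafFor_iff_generate _).mpr (hE _ hmem)
  rw [Presieve.isSheafFor_arrows_iff] at this
  refine this sf ?_
  intro i j Z gi gj hg
  let V : Y.Opens := U i ⊓ U j
  let a : Z.left ⟶ (U i).toScheme := gi.left
  let b : Z.left ⟶ (U j).toScheme := gj.left
  have hab : a ≫ (U i).ι = b ≫ (U j).ι := by
    have h : a ≫ Y.homOfLE (le_iSup U i) = b ≫ Y.homOfLE (le_iSup U j) :=
      congrArg (fun k => k.left) hg
    simpa using congrArg (fun k => k ≫ (iSup U : Y.Opens).ι) h
  have hap : (a ≫ (U i).ι) ≫ p = Z.hom := by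
    rw [Category.assoc]; exact Over.w gi
  have hr : Set.range (a ≫ (U i).ι) ⊆ Set.range V.ι := by
    rintro _ ⟨z, rfl⟩
    rw [Scheme.Opens.range_ι]
    refine ⟨?_, ?_⟩
    · rw [Scheme.Hom.comp_apply]; exact (a z).2
    · rw [hab, Scheme.Hom.comp_apply]; exact (b z).2
  let c : Z.left ⟶ V.toScheme := IsOpenImmersion.lift V.ι (a ≫ (U i).ι) hr
  have hc : c ≫ V.ι = a ≫ (U i).ι := IsOpenImmersion.lift_fac _ _ _
  let k : Z ⟶ (opensOver p).obj V := Over.homMk c (by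
    change c ≫ V.ι ≫ p = Z.hom
    rw [← Category.assoc, hc, hap])
  have hi : k ≫ (opensOver p).map (Opens.infLELeft (U i) (U j)) = gi := by
    ext1
    change c ≫ Y.homOfLE (inf_le_left : V ≤ U i) = a
    rw [← cancel_mono (U i).ι]
    simp [hc]
  have hj : k ≫ (opensOver p).map (Opens.infLERight (U i) (U j)) = gj := by
    ext1
    change c ≫ Y.homOfLE (inf_le_right : V ≤ U j) = b
    rw [← cancel_mono (U j).ι]
    simp [hc, hab]
  rw [← hi, ← hj]
  have := congrArg ((E.obj ⋙ forget _).map k.op) (hsf i j)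
  rw [op_comp, op_comp, Functor.map_comp, Functor.map_comp]
  exact this

/-- The restriction `E|_Y` of `E` to the small Zariski site of an `X`-scheme `p : Y ⟶ X`. -/
def smallRestrict {X Y : Scheme.{u}} (E : BigZariskiSheaf X) (p : Y ⟶ X) : AbSheaf Y :=
  ⟨(opensOver p).op ⋙ E.obj, isSheaf_opensOver E p⟩

/-- The morphism `V ⟶ U` over `X` induced by a morphism `h : Y' ⟶ Y` over `X` with
`V ⊆ h⁻¹(U)`. -/
def opensOverHom {X Y Y' : Scheme.{u}} {p : Y ⟶ X} {p' : Y' ⟶ X} (h : Y' ⟶ Y)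
    (w : h ≫ p = p') (U : Y.Opens) (V : Y'.Opens) (e : V ≤ h ⁻¹ᵁ U) :
    (opensOver p').obj V ⟶ (opensOver p).obj U :=
  Over.homMk (U := Over.mk (V.ι ≫ p')) (V := Over.mk (U.ι ≫ p)) (h.resLE U V e) (by
    change h.resLE U V e ≫ U.ι ≫ p = V.ι ≫ p'
    rw [Scheme.Hom.resLE_comp_ι_assoc, w])

theorem opensOver_hom_ext {X Y : Scheme.{u}} {p : Y ⟶ X} {Z : Over X} {U : Y.Opens}
    {a b : Z ⟶ (opensOver p).obj U}
    (h : (show Z.left ⟶ U.toScheme from a.left) ≫ U.ι =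
      (show Z.left ⟶ U.toScheme from b.left) ≫ U.ι) : a = b := by
  ext1
  exact (cancel_mono U.ι).mp h

theorem opensOverHom_comp {X Y Y' Y'' : Scheme.{u}} {p : Y ⟶ X} {p' : Y' ⟶ X} {p'' : Y'' ⟶ X}
    (h : Y' ⟶ Y) (w : h ≫ p = p') (h' : Y'' ⟶ Y') (w' : h' ≫ p' = p'')
    (k : Y'' ⟶ Y) (wk : k ≫ p = p'') (hk : h' ≫ h = k) (U : Y.Opens) (V : Y'.Opens)
    (W : Y''.Opens) (e : V ≤ h ⁻¹ᵁ U) (e' : W ≤ h' ⁻¹ᵁ V) (e'' : W ≤ k ⁻¹ᵁ U) :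
    opensOverHom h' w' V W e' ≫ opensOverHom h w U V e = opensOverHom k wk U W e'' := by
  subst hk
  ext1
  exact Scheme.Hom.resLE_comp_resLE ..

theorem opensOverHom_id {X Y : Scheme.{u}} {p : Y ⟶ X} {U V : Y.Opens} (i : V ⟶ U)
    (h : Y ⟶ Y) (hh : h = 𝟙 Y) (w : h ≫ p = p) (e : V ≤ h ⁻¹ᵁ U) :
    opensOverHom h w U V e = (opensOver p).map i := by
  subst hh
  ext1
  exact Scheme.Hom.resLE_id _

theorem opensOverHom_naturality {X Y Y' : Scheme.{u}} {p : Y ⟶ X} {p' : Y' ⟶ X} (h : Y' ⟶ Y)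
    (w : h ≫ p = p') {U V : Y.Opens} (i : U ⟶ V) :
    opensOverHom h w U (h ⁻¹ᵁ U) le_rfl ≫ (opensOver p).map i =
      (opensOver p').map ((Opens.map h.base).map i) ≫ opensOverHom h w V (h ⁻¹ᵁ V) le_rfl := by
  ext1
  change h.resLE U _ le_rfl ≫ Y.homOfLE i.le =
    Y'.homOfLE (h.preimage_mono i.le) ≫ h.resLE V _ le_rfl
  rw [Scheme.Hom.resLE_map, Scheme.Hom.map_resLE]

/-- Pull-back of sections along a morphism `h : Y' ⟶ Y` over `X`, as a morphism
`E|_Y ⟶ h_* (E|_Y')`. -/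
def restrictHom {X Y Y' : Scheme.{u}} (E : BigZariskiSheaf X) {p : Y ⟶ X} {p' : Y' ⟶ X}
    (h : Y' ⟶ Y) (w : h ≫ p = p') :
    smallRestrict E p ⟶ (push h.base).obj (smallRestrict E p') :=
  ⟨{ app U := E.obj.map (opensOverHom h w U.unop (h ⁻¹ᵁ U.unop) le_rfl).op
     naturality _ _ i := (E.obj.map_comp _ _).symm.trans
      ((congrArg (fun k => E.obj.map k.op) (opensOverHom_naturality h w i.unop)).trans
        (E.obj.map_comp _ _)) }⟩

theorem map_map_apply {X : Scheme.{u}} (E : BigZariskiSheaf X) {A B C D : Over X}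
    (a : A ⟶ B) (b : B ⟶ C) (c : A ⟶ D) (d : D ⟶ C) (h : a ≫ b = c ≫ d) (s : E.obj.obj (op C)) :
    E.obj.map a.op (E.obj.map b.op s) = E.obj.map c.op (E.obj.map d.op s) := by
  rw [← ConcreteCategory.comp_apply, ← ConcreteCategory.comp_apply, ← Functor.map_comp,
    ← Functor.map_comp, ← op_comp, ← op_comp, h]

theorem map_map_apply' {X : Scheme.{u}} (E : BigZariskiSheaf X) {A B C : Over X}
    (a : A ⟶ B) (b : B ⟶ C) (c : A ⟶ C) (h : a ≫ b = c) (s : E.obj.obj (op C)) :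
    E.obj.map a.op (E.obj.map b.op s) = E.obj.map c.op s := by
  rw [← ConcreteCategory.comp_apply, ← Functor.map_comp, ← op_comp, h]

theorem restrictHom_eq_zero_of_comm {X Y Y' Z Z' : Scheme.{u}} (E : BigZariskiSheaf X)
    {p : Y ⟶ X} {p' : Y' ⟶ X} {r : Z ⟶ X} {r' : Z' ⟶ X} (h : Y' ⟶ Y) (wh : h ≫ p = p')
    (i : Z ⟶ Y) (wi : i ≫ p = r) (i' : Z' ⟶ Y') (wi' : i' ≫ p' = r') (k : Z' ⟶ Z)
    (hc : i' ≫ h = k ≫ i) (U : Y.Opens) (s : (smallRestrict E p).obj.obj (op U))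
    (hs : (restrictHom E i wi).hom.app (op U) s = 0) :
    (restrictHom E i' wi').hom.app (op ((Opens.map h.base).obj U))
      ((restrictHom E h wh).hom.app (op U) s) = 0 := by
  have wk : k ≫ r = r' := by rw [← wi, ← wi', ← wh, reassoc_of% hc]
  have hle : i' ⁻¹ᵁ (h ⁻¹ᵁ U) ≤ k ⁻¹ᵁ (i ⁻¹ᵁ U) := by
    rw [← Scheme.Hom.comp_preimage, ← Scheme.Hom.comp_preimage, hc]
  have h1 := opensOverHom_comp h wh i' wi' (i' ≫ h) (by simp [wh, wi']) rfl
    U _ _ le_rfl le_rfl le_rfl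
  have h2 := opensOverHom_comp i wi k wk (i' ≫ h) (by simp [wh, wi']) hc.symm
    U _ _ le_rfl hle le_rfl
  refine (map_map_apply E _ _ _ _ (h1.trans h2.symm) s).trans ?_
  exact (congrArg (E.obj.map _) hs).trans (map_zero _)

/-- The kernel of a morphism of sheaves, computed on sections. -/
def kernelPresheaf {Y : TopCat.{u}} {F G : AbSheaf Y} (φ : F ⟶ G) :
    TopCat.Presheaf AddCommGrpCat.{u} Y where
  obj U := AddCommGrpCat.of (φ.hom.app U).hom.ker
  map {U V} i := AddCommGrpCat.ofHom
    (((F.obj.map i).hom.comp (φ.hom.app U).hom.ker.subtype).codRestrict _ fun s => by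
      have h := ConcreteCategory.congr_hom (φ.hom.naturality i) s.1
      have hs : φ.hom.app U s.1 = 0 := s.2
      rw [ConcreteCategory.comp_apply, ConcreteCategory.comp_apply, hs, map_zero] at h
      exact h)
  map_id U := by
    ext s
    exact ConcreteCategory.congr_hom (F.obj.map_id U) s.1
  map_comp i j := by
    ext s
    exact ConcreteCategory.congr_hom (F.obj.map_comp i j) s.1

theorem kernelPresheaf_isSheaf {Y : TopCat.{u}} {F G : AbSheaf Y} (φ : F ⟶ G) :
    (kernelPresheaf φ).IsSheaf := by
  rw [TopCat.Presheaf.isSheaf_iff_isSheafUniqueGluing]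
  intro ι U sf hsf
  obtain ⟨s, hs, hu⟩ := TopCat.Sheaf.existsUnique_gluing F U (fun i => (sf i).1)
    (fun i j => congrArg Subtype.val (hsf i j))
  have hs0 : φ.hom.app _ s = 0 := by
    apply TopCat.Sheaf.eq_of_locally_eq G U
    intro i
    rw [map_zero]
    have h := ConcreteCategory.congr_hom (φ.hom.naturality (Opens.leSupr U i).op) s
    rw [ConcreteCategory.comp_apply, ConcreteCategory.comp_apply] at h
    rw [← h, hs i]
    exact (sf i).2
  refine ⟨⟨s, hs0⟩, fun i => Subtype.ext (hs i), fun t ht => Subtype.ext ?_⟩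
  exact hu t.1 fun i => congrArg Subtype.val (ht i)

/-- The kernel of a morphism of sheaves. -/
def kernelSheaf {Y : TopCat.{u}} {F G : AbSheaf Y} (φ : F ⟶ G) : AbSheaf Y :=
  ⟨kernelPresheaf φ, kernelPresheaf_isSheaf φ⟩

/-- A morphism `a : F ⟶ h_* F'` which carries the kernel of `φ` into the kernel of `φ'` induces
a morphism `ker φ ⟶ h_* (ker φ')`. -/
def kernelHom {Y Y' : TopCat.{u}} (h : Y' ⟶ Y) {F G : AbSheaf Y} {F' G' : AbSheaf Y'}
    (φ : F ⟶ G) (φ' : F' ⟶ G') (a : F ⟶ (push h).obj F')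
    (w : ∀ (U : Opens Y) (s : F.obj.obj (op U)), φ.hom.app (op U) s = 0 →
      φ'.hom.app (op ((Opens.map h).obj U)) (a.hom.app (op U) s) = 0) :
    kernelSheaf φ ⟶ (push h).obj (kernelSheaf φ') :=
  ⟨{ app U := AddCommGrpCat.ofHom
      (((a.hom.app U).hom.comp (φ.hom.app U).hom.ker.subtype).codRestrict _ fun s =>
        w U.unop s.1 s.2)
     naturality U V i := by
      ext s
      apply Subtype.ext
      exact ConcreteCategory.congr_hom (a.hom.naturality i) s.1 }⟩

/-- The reduced closed subscheme `T_red` of `T`. -/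
def reduced (T : Scheme.{u}) : Scheme.{u} := T.nilradical.subscheme

/-- The closed immersion `T_red ⟶ T`. -/
def reducedι (T : Scheme.{u}) : reduced T ⟶ T := T.nilradical.subschemeι

theorem exists_reducedMap {T' T : Scheme.{u}} (h : T' ⟶ T) :
    ∃ k : reduced T' ⟶ reduced T, k ≫ reducedι T = reducedι T' ≫ h := by
  refine ⟨Scheme.IdealSheafData.subschemeMap _ _ h ?_,
    Scheme.IdealSheafData.subschemeMap_subschemeι _ _ _ _⟩
  rw [← Scheme.IdealSheafData.vanishingIdeal_top, ← Scheme.IdealSheafData.vanishingIdeal_top,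
    Scheme.IdealSheafData.map_vanishingIdeal]
  exact Scheme.IdealSheafData.vanishingIdeal_antimono le_top

/-- The morphism `X ×_S T' ⟶ X ×_S T` induced by an `S`-morphism `T' ⟶ T`. -/
def prodMap {X S T T' : Scheme.{u}} (f : X ⟶ S) {g : T ⟶ S} {g' : T' ⟶ S} (h : T' ⟶ T)
    (w : h ≫ g = g') : pullback f g' ⟶ pullback f g :=
  pullback.lift (pullback.fst f g') (pullback.snd f g' ≫ h)
    (by rw [pullback.condition, Category.assoc, w])

@[simp]
theorem prodMap_fst {X S T T' : Scheme.{u}} (f : X ⟶ S) {g : T ⟶ S} {g' : T' ⟶ S} (h : T' ⟶ T)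
    (w : h ≫ g = g') : prodMap f h w ≫ pullback.fst f g = pullback.fst f g' :=
  pullback.lift_fst ..

@[simp]
theorem prodMap_snd {X S T T' : Scheme.{u}} (f : X ⟶ S) {g : T ⟶ S} {g' : T' ⟶ S} (h : T' ⟶ T)
    (w : h ≫ g = g') : prodMap f h w ≫ pullback.snd f g = pullback.snd f g' ≫ h :=
  pullback.lift_snd ..

theorem prodMap_comp {X S T T' T'' : Scheme.{u}} (f : X ⟶ S) {g : T ⟶ S} {g' : T' ⟶ S}
    {g'' : T'' ⟶ S} (h : T' ⟶ T) (w : h ≫ g = g') (h' : T'' ⟶ T') (w' : h' ≫ g' = g'')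
    (k : T'' ⟶ T) (wk : k ≫ g = g'') (hk : h' ≫ h = k) :
    prodMap f h' w' ≫ prodMap f h w = prodMap f k wk := by
  subst hk
  apply pullback.hom_ext
  · simp
  · rw [Category.assoc, prodMap_snd, ← Category.assoc, prodMap_snd, prodMap_snd, Category.assoc]

theorem prodMap_id {X S T : Scheme.{u}} (f : X ⟶ S) {g : T ⟶ S} (h : T ⟶ T) (hh : h = 𝟙 T)
    (w : h ≫ g = g) : prodMap f h w = 𝟙 _ := by
  subst hh
  apply pullback.hom_ext <;> simp

theorem fst_preimage_le {X S T T' : Scheme.{u}} (f : X ⟶ S) {g : T ⟶ S} {g' : T' ⟶ S}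
    (h : T' ⟶ T) (w : h ≫ g = g') (U : X.Opens) :
    pullback.fst f g' ⁻¹ᵁ U ≤ prodMap f h w ⁻¹ᵁ (pullback.fst f g ⁻¹ᵁ U) := by
  rw [← Scheme.Hom.comp_preimage, prodMap_fst]

/-- The sheaf `Ẽ_T = ker (E|_{X_T} ⟶ ι_* (E|_{X ×_S T_red}))` on `X_T = X ×_S T`, where
`ι : X ×_S T_red ⟶ X_T` is the base change of `T_red ⟶ T`. -/
def tildeSheaf {X S T : Scheme.{u}} (f : X ⟶ S) (E : BigZariskiSheaf X) (g : T ⟶ S) :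
    AbSheaf ↑(pullback f g) :=
  kernelSheaf (restrictHom E (prodMap f (reducedι T) (rfl : reducedι T ≫ g = reducedι T ≫ g))
    (prodMap_fst ..))

/-- The natural map `Ẽ_T ⟶ (id × h)_* Ẽ_{T'}` for an `S`-morphism `h : T' ⟶ T`. -/
def tildeHom {X S T T' : Scheme.{u}} (f : X ⟶ S) (E : BigZariskiSheaf X) {g : T ⟶ S}
    {g' : T' ⟶ S} (h : T' ⟶ T) (w : h ≫ g = g') :
    tildeSheaf f E g ⟶ (push (prodMap f h w).base).obj (tildeSheaf f E g') :=
  kernelHom _ _ _ (restrictHom E (prodMap f h w) (prodMap_fst ..)) (by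
    intro U s hs
    obtain ⟨k, hk⟩ := exists_reducedMap h
    have hk' : k ≫ reducedι T ≫ g = reducedι T' ≫ g' := by
      rw [← Category.assoc, hk, Category.assoc, w]
    refine restrictHom_eq_zero_of_comm E _ _ _ (prodMap_fst ..) _ _ (prodMap f k hk') ?_ U s hs
    rw [prodMap_comp f h w _ rfl (reducedι T' ≫ h) (by rw [Category.assoc, w]) rfl,
      prodMap_comp f (reducedι T) rfl k hk' _ _ hk])

/-- The canonical isomorphism `a_* F ⟶ b_* F` for equal maps `a` and `b`. -/
def pushCongr {Y Z : TopCat.{u}} {a b : Y ⟶ Z} (e : a = b) (F : AbSheaf Y) :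
    (push a).obj F ⟶ (push b).obj F :=
  ⟨{ app U := F.obj.map (eqToHom (by rw [e]) :
        (Opens.map b).obj U.unop ⟶ (Opens.map a).obj U.unop).op
     naturality U V i := by
       change F.obj.map _ ≫ F.obj.map _ = F.obj.map _ ≫ F.obj.map _
       rw [← F.obj.map_comp, ← F.obj.map_comp]
       rfl }⟩


instance {Y Z : TopCat.{u}} (f : Y ⟶ Z) : PreservesFiniteLimits (push f) := by
  have : (push f).IsRightAdjoint :=
    (TopCat.Sheaf.pullbackPushforwardAdjunction AddCommGrpCat.{u} f).isRightAdjoint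
  infer_instance

section BaseChange

variable {Y Y' T T' : TopCat.{u}}

/-- The higher direct image `R^q a_*`. -/
abbrev higherDirectImage (a : Y ⟶ T) (q : ℕ) : AbSheaf Y ⥤ AbSheaf T := (push a).rightDerived q

/-- The canonical isomorphism `a_* h'_* F ⟶ h_* a'_* F` for a commutative square. -/
def pushSquare {h' : Y' ⟶ Y} {a : Y ⟶ T} {a' : Y' ⟶ T'} {h : T' ⟶ T} (w : h' ≫ a = a' ≫ h)
    (F : AbSheaf Y') : (push a).obj ((push h').obj F) ⟶ (push h).obj ((push a').obj F) :=
  pushCongr w F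

theorem pushSquare_naturality {h' : Y' ⟶ Y} {a : Y ⟶ T} {a' : Y' ⟶ T'} {h : T' ⟶ T}
    (w : h' ≫ a = a' ≫ h) {F F' : AbSheaf Y'} (m : F ⟶ F') :
    pushSquare w F ≫ (push h).map ((push a').map m) =
      (push a).map ((push h').map m) ≫ pushSquare w F' := by
  apply Sheaf.hom_ext
  ext U : 2
  exact m.hom.naturality _

/-- A morphism of complexes from the injective resolution `I` of `F` to `h'_* I'`, where `I'` is the
injective resolution of `F'`, which extends `φ : F ⟶ h'_* F'`. -/
def resolutionHom (h' : Y' ⟶ Y) {F : AbSheaf Y} {F' : AbSheaf Y'} (φ : F ⟶ (push h').obj F') :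
    (injectiveResolution F).cocomplex ⟶
      ((push h').mapHomologicalComplex (.up ℕ)).obj (injectiveResolution F').cocomplex :=
  descTo (injectiveResolution F) _
    (fun n => inferInstanceAs
      (Injective ((push h').obj ((injectiveResolution F').cocomplex.X n))))
    (φ ≫ (push h').map (augmentation (injectiveResolution F'))) (by
      change (φ ≫ (push h').map (augmentation (injectiveResolution F'))) ≫
        (push h').map ((injectiveResolution F').cocomplex.d 0 1) = 0
      rw [Category.assoc, ← Functor.map_comp, augmentation_d, Functor.map_zero, comp_zero])

theorem augmentation_resolutionHom (h' : Y' ⟶ Y) {F : AbSheaf Y} {F' : AbSheaf Y'}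
    (φ : F ⟶ (push h').obj F') :
    augmentation (injectiveResolution F) ≫ (resolutionHom h' φ).f 0 =
      φ ≫ (push h').map (augmentation (injectiveResolution F')) :=
  augmentation_descTo _ _ _ _ _

/-- The canonical isomorphisms `a_* h'_* Kⁿ ⟶ h_* a'_* Kⁿ` for a complex `K`. -/
def directImageComplexHom {h' : Y' ⟶ Y} {a : Y ⟶ T} {a' : Y' ⟶ T'} {h : T' ⟶ T}
    (w : h' ≫ a = a' ≫ h) (K : CochainComplex (AbSheaf Y') ℕ) :
    ComplexHom (push h)
      (((push a).mapHomologicalComplex (.up ℕ)).obj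
        (((push h').mapHomologicalComplex (.up ℕ)).obj K))
      (((push a').mapHomologicalComplex (.up ℕ)).obj K) where
  f n := pushSquare w (K.X n)
  comm i j := pushSquare_naturality w (K.d i j)

/-- The morphism `R^q a_* F ⟶ h_* R^q a'_* F'` attached to a commutative square `a h' = h a'` and a
morphism `φ : F ⟶ h'_* F'`. It is adjoint to the composition
`h⁻¹ R^q a_* F ⟶ R^q a'_* h'⁻¹ F ⟶ R^q a'_* F'` of the base change map and the map induced by `φ`.
With the injective resolutions `I` and `I'` of `F` and `F'` it is the composition
`H^q(a_* I) ⟶ H^q(a_* h'_* I') ⟶ H^q(h_* a'_* I') ⟶ h_* H^q(a'_* I')`. -/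
def baseChange {h' : Y' ⟶ Y} {a : Y ⟶ T} {a' : Y' ⟶ T'} {h : T' ⟶ T}
    (w : h' ≫ a = a' ≫ h) {F : AbSheaf Y} {F' : AbSheaf Y'} (φ : F ⟶ (push h').obj F') (q : ℕ) :
    (higherDirectImage a q).obj F ⟶ (push h).obj ((higherDirectImage a' q).obj F') :=
  ((injectiveResolution F).isoRightDerivedObj (push a) q).hom ≫
    (ComplexHom.precomp (((push a).mapHomologicalComplex (.up ℕ)).map (resolutionHom h' φ))
      (directImageComplexHom w (injectiveResolution F').cocomplex)).homologyMap q ≫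
    (push h).map ((injectiveResolution F').isoRightDerivedObj (push a') q).inv

theorem pushSquare_comp {Y'' T'' : TopCat.{u}} {h' : Y' ⟶ Y} {a : Y ⟶ T} {a' : Y' ⟶ T'}
    {h : T' ⟶ T} (w : h' ≫ a = a' ≫ h) {k' : Y'' ⟶ Y'} {a'' : Y'' ⟶ T''} {k : T'' ⟶ T'}
    (w' : k' ≫ a' = a'' ≫ k) (w'' : (k' ≫ h') ≫ a = a'' ≫ (k ≫ h)) (F : AbSheaf Y'') :
    pushSquare w ((push k').obj F) ≫ (push h).map (pushSquare w' F) =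
      pushSquare (h' := k' ≫ h') (h := k ≫ h) w'' F := by
  apply Sheaf.hom_ext
  ext U : 2
  exact (F.obj.map_comp _ _).symm

theorem pushSquare_comp' {Y'' T'' : TopCat.{u}} {h' : Y' ⟶ Y} {a : Y ⟶ T} {a' : Y' ⟶ T'}
    {h : T' ⟶ T} (w : h' ≫ a = a' ≫ h) {k' : Y'' ⟶ Y'} {a'' : Y'' ⟶ T''} {k : T'' ⟶ T'}
    (w' : k' ≫ a' = a'' ≫ k) (w'' : (k' ≫ h') ≫ a = a'' ≫ (k ≫ h)) {A : AbSheaf Y}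
    {B : AbSheaf Y'} {D : AbSheaf Y''} (r : A ⟶ (push h').obj B) (s : B ⟶ (push k').obj D) :
    ((push a).map r ≫ pushSquare w B) ≫ (push h).map ((push a').map s ≫ pushSquare w' D) =
      (push a).map (r ≫ (push h').map s) ≫ pushSquare (h' := k' ≫ h') (h := k ≫ h) w'' D := by
  rw [← pushSquare_comp w w' w'', Functor.map_comp, Functor.map_comp, Category.assoc,
    ← Category.assoc (pushSquare w B), pushSquare_naturality, Category.assoc]
  exact (Category.assoc _ _ _).symm

theorem comp_map_comp_aux {C D : Type*} [Category* C] [Category* D] (G : C ⥤ D) {A B : D}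
    {P Q U V : C} (i : A ⟶ B) (r : B ⟶ G.obj P) (j : Q ≅ P) (s : P ⟶ U) (m : U ⟶ V) :
    (i ≫ r ≫ G.map j.inv) ≫ G.map (j.hom ≫ s ≫ m) = i ≫ (r ≫ G.map s) ≫ G.map m := by
  simp only [Category.assoc, ← G.map_comp, Iso.inv_hom_id_assoc]

theorem baseChange_comp {Y'' T'' : TopCat.{u}} {h' : Y' ⟶ Y} {a : Y ⟶ T} {a' : Y' ⟶ T'}
    {h : T' ⟶ T} (w : h' ≫ a = a' ≫ h) {k' : Y'' ⟶ Y'} {a'' : Y'' ⟶ T''} {k : T'' ⟶ T'}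
    (w' : k' ≫ a' = a'' ≫ k) (w'' : (k' ≫ h') ≫ a = a'' ≫ (k ≫ h)) {F : AbSheaf Y}
    {F' : AbSheaf Y'} {F'' : AbSheaf Y''} (φ : F ⟶ (push h').obj F')
    (φ' : F' ⟶ (push k').obj F'') (q : ℕ) :
    baseChange w φ q ≫ (push h).map (baseChange w' φ' q) =
      baseChange (h' := k' ≫ h') (h := k ≫ h) w'' (F' := F'') (φ ≫ (push h').map φ') q := by
  let ψ : (injectiveResolution F).cocomplex ⟶
      ((push (k' ≫ h')).mapHomologicalComplex (.up ℕ)).obj (injectiveResolution F'').cocomplex :=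
    resolutionHom h' φ ≫ ((push h').mapHomologicalComplex (.up ℕ)).map (resolutionHom k' φ')
  have hψ := homologyMap_eq_of_augmentation (injectiveResolution F)
    (((push (k' ≫ h')).mapHomologicalComplex (.up ℕ)).obj (injectiveResolution F'').cocomplex)
    (fun n => inferInstanceAs
      (Injective ((push (k' ≫ h')).obj ((injectiveResolution F'').cocomplex.X n)))) ψ
    (resolutionHom (k' ≫ h') (F' := F'') (φ ≫ (push h').map φ')) (by
      refine Eq.trans ?_ (augmentation_resolutionHom (k' ≫ h') (F' := F'')
        (φ ≫ (push h').map φ')).symm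
      change augmentation (injectiveResolution F) ≫ (resolutionHom h' φ).f 0 ≫
        (push h').map ((resolutionHom k' φ').f 0) =
          (φ ≫ (push h').map φ') ≫
            (push h').map ((push k').map (augmentation (injectiveResolution F'')))
      have h1 := augmentation_resolutionHom h' φ
      have h2 := congrArg (push h').map (augmentation_resolutionHom k' φ')
      refine (Category.assoc _ _ _).symm.trans ((congrArg (· ≫ _) h1).trans ?_)
      refine (Category.assoc _ _ _).trans ?_
      refine Eq.trans ?_ (Category.assoc _ _ _).symm
      refine congrArg (φ ≫ ·) ?_
      exact ((push h').map_comp _ _).symm.trans (h2.trans ((push h').map_comp _ _))) (push a) q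
  let θ := ComplexHom.precomp (((push a).mapHomologicalComplex (.up ℕ)).map (resolutionHom h' φ))
      (directImageComplexHom w (injectiveResolution F').cocomplex)
  let η := ComplexHom.precomp
      (((push a').mapHomologicalComplex (.up ℕ)).map (resolutionHom k' φ'))
      (directImageComplexHom w' (injectiveResolution F'').cocomplex)
  have hθ : θ.comp η = ComplexHom.precomp (((push a).mapHomologicalComplex (.up ℕ)).map ψ)
      (directImageComplexHom (h' := k' ≫ h') (h := k ≫ h) w''
        (injectiveResolution F'').cocomplex) := by
    ext n : 2
    change ((push a).map ((resolutionHom h' φ).f n) ≫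
        pushSquare w ((injectiveResolution F').cocomplex.X n)) ≫
          (push h).map ((push a').map ((resolutionHom k' φ').f n) ≫
            pushSquare w' ((injectiveResolution F'').cocomplex.X n)) =
        (push a).map ((resolutionHom h' φ).f n ≫ (push h').map ((resolutionHom k' φ').f n)) ≫
          pushSquare (h' := k' ≫ h') (h := k ≫ h) w'' ((injectiveResolution F'').cocomplex.X n)
    exact pushSquare_comp' w w' w'' _ _
  have h1 := ComplexHom.homologyMap_comp θ q η
  rw [hθ] at h1
  have h2 := (ComplexHom.homologyMap_precomp
    (directImageComplexHom (h' := k' ≫ h') (h := k ≫ h) w'' (injectiveResolution F'').cocomplex) q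
    (((push a).mapHomologicalComplex (.up ℕ)).map
      (resolutionHom (k' ≫ h') (F' := F'') (φ ≫ (push h').map φ')))).trans
    ((congrArg (· ≫ _) hψ.symm).trans ((ComplexHom.homologyMap_precomp _ q _).symm.trans h1))
  refine (comp_map_comp_aux (push h) _ _ _ _ _).trans ?_
  exact congrArg (fun t => _ ≫ t ≫ _) h2.symm

/-- The canonical isomorphism `F ⟶ (𝟙 Y)_* F`. -/
def toPushId (Y : TopCat.{u}) : 𝟭 (AbSheaf Y) ⟶ push (𝟙 Y) where
  app F := ⟨{ app U := F.obj.map (𝟙 U), naturality _ _ i := by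
                change F.obj.map _ ≫ F.obj.map _ = F.obj.map _ ≫ F.obj.map _
                rw [← F.obj.map_comp, ← F.obj.map_comp]
                rfl }⟩
  naturality F G m := by
    apply Sheaf.hom_ext
    ext U : 2
    exact (m.hom.naturality _).symm

theorem baseChange_id {a : Y ⟶ T} (w : 𝟙 Y ≫ a = a ≫ 𝟙 T) (F : AbSheaf Y) (q : ℕ) :
    baseChange w ((toPushId Y).app F) q = (toPushId T).app ((higherDirectImage a q).obj F) := by
  let J := injectiveResolution F
  let c : J.cocomplex ⟶ ((push (𝟙 Y)).mapHomologicalComplex (.up ℕ)).obj J.cocomplex :=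
    { f n := (toPushId Y).app (J.cocomplex.X n)
      comm' _ _ _ := ((toPushId Y).naturality _).symm }
  have hc := homologyMap_eq_of_augmentation J
    (((push (𝟙 Y)).mapHomologicalComplex (.up ℕ)).obj J.cocomplex)
    (fun n => inferInstanceAs (Injective ((push (𝟙 Y)).obj (J.cocomplex.X n))))
    (resolutionHom (𝟙 Y) ((toPushId Y).app F)) c
    ((augmentation_resolutionHom (𝟙 Y) ((toPushId Y).app F)).trans
      ((toPushId Y).naturality (augmentation J)).symm) (push a) q
  have hθ : ComplexHom.precomp (((push a).mapHomologicalComplex (.up ℕ)).map c)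
      (directImageComplexHom w J.cocomplex) = ComplexHom.ofNatTrans (toPushId T)
        (((push a).mapHomologicalComplex (.up ℕ)).obj J.cocomplex) := by
    ext n : 2
    apply Sheaf.hom_ext
    ext U : 2
    exact ((J.cocomplex.X n).obj.map_comp _ _).symm
  have h1 := (ComplexHom.homologyMap_precomp (directImageComplexHom w J.cocomplex) q
    (((push a).mapHomologicalComplex (.up ℕ)).map
      (resolutionHom (𝟙 Y) ((toPushId Y).app F)))).trans
    ((congrArg (· ≫ _) hc).trans (ComplexHom.homologyMap_precomp _ q _).symm)
  rw [hθ, ComplexHom.homologyMap_ofNatTrans] at h1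
  change _ ≫ _ ≫ _ = _
  rw [h1]
  refine (congrArg (_ ≫ ·) ((toPushId T).naturality _).symm).trans ?_
  exact Iso.hom_inv_id_assoc _ _

theorem pushCongr_rfl {a : Y ⟶ T} (F : AbSheaf Y) : pushCongr (rfl : a = a) F = 𝟙 _ := by
  apply Sheaf.hom_ext
  ext U : 2
  exact F.obj.map_id _

theorem baseChange_congr {h' k' : Y' ⟶ Y} {a : Y ⟶ T} {a' : Y' ⟶ T'} {h k : T' ⟶ T}
    (w : h' ≫ a = a' ≫ h) (w' : k' ≫ a = a' ≫ k) (e' : h' = k') (e : h = k) {F : AbSheaf Y}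
    {F' : AbSheaf Y'} (φ : F ⟶ (push h').obj F') (ψ : F ⟶ (push k').obj F')
    (hφ : φ ≫ pushCongr e' F' = ψ) (q : ℕ) :
    baseChange w φ q ≫ pushCongr e _ = baseChange w' ψ q := by
  subst e e' hφ
  rw [pushCongr_rfl, pushCongr_rfl, Category.comp_id, Category.comp_id]

theorem baseChange_congr_top {h' k' : Y' ⟶ Y} {a : Y ⟶ T} {a' : Y' ⟶ T'} {h k : T' ⟶ T}
    (w : h' ≫ a = a' ≫ h) (w' : k' ≫ a = a' ≫ k) (e' : h' = k') (e : h = k) {F : AbSheaf Y}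
    {F' : AbSheaf Y'} (φ : F ⟶ (push h').obj F') (ψ : F ⟶ (push k').obj F')
    (hφ : φ ≫ pushCongr e' F' = ψ) (q : ℕ) :
    (baseChange w φ q).hom.app (op ⊤) = (baseChange w' ψ q).hom.app (op ⊤) := by
  rw [← baseChange_congr w w' e' e φ ψ hφ q]
  refine Eq.trans ?_ (congrArg (fun t => (baseChange w φ q).hom.app (op ⊤) ≫ t)
    (((higherDirectImage a' q).obj F').obj.map_id (op ⊤)).symm)
  exact (Category.comp_id _).symm

end BaseChange

section Phi

variable {X S : Scheme.{u}} (f : X ⟶ S) (E : BigZariskiSheaf X)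

theorem prodMap_base_snd {T T' : Scheme.{u}} {g : T ⟶ S} {g' : T' ⟶ S} (h : T' ⟶ T)
    (w : h ≫ g = g') : (prodMap f h w).base ≫ (pullback.snd f g).base =
      (pullback.snd f g').base ≫ h.base :=
  congrArg (fun k : _ ⟶ T => k.base) (prodMap_snd f h w)

theorem tildeHom_id {T : Scheme.{u}} (g : T ⟶ S) (w : 𝟙 T ≫ g = g)
    (e : (prodMap f (𝟙 T) w).base = 𝟙 _) :
    tildeHom f E (𝟙 T) w ≫ pushCongr e _ = (toPushId _).app (tildeSheaf f E g) := by
  apply Sheaf.hom_ext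
  ext U s
  apply Subtype.ext
  have hp : prodMap f (𝟙 T) w = 𝟙 _ := prodMap_id f _ rfl _
  refine map_map_apply' E _ _ ((opensOver (pullback.fst f g)).map (𝟙 U.unop)) ?_ s.1
  · refine (congrArg (· ≫ _) (opensOverHom_id _ (𝟙 _) rfl (Category.id_comp _) ?_).symm).trans ?_
    · exact (by rw [hp]; rfl : U.unop ≤ prodMap f (𝟙 T) w ⁻¹ᵁ U.unop)
    · refine (opensOverHom_comp _ _ _ _ (𝟙 _) (Category.id_comp _)
        (by rw [hp, Category.id_comp]) _ _ _ _ _ le_rfl).trans ?_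
      exact opensOverHom_id (𝟙 U.unop) (𝟙 _) rfl _ _

theorem tildeHom_comp {T T' T'' : Scheme.{u}} {g : T ⟶ S} {g' : T' ⟶ S} {g'' : T'' ⟶ S}
    (h : T' ⟶ T) (w : h ≫ g = g') (k : T'' ⟶ T') (w' : k ≫ g' = g'') (w'' : (k ≫ h) ≫ g = g'')
    (e : (prodMap f (k ≫ h) w'').base = (prodMap f k w').base ≫ (prodMap f h w).base) :
    tildeHom f E (k ≫ h) w'' ≫ pushCongr e _ =
      tildeHom f E h w ≫ (push (prodMap f h w).base).map (tildeHom f E k w') := by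
  apply Sheaf.hom_ext
  ext U s
  apply Subtype.ext
  have hp : prodMap f k w' ≫ prodMap f h w = prodMap f (k ≫ h) w'' :=
    prodMap_comp f _ _ _ _ _ _ rfl
  refine map_map_apply E _ _ _ _ ?_ s.1
  refine (congrArg (· ≫ _) (opensOverHom_id _ (𝟙 _) rfl (Category.id_comp _) ?_).symm).trans ?_
  · exact (by rw [← hp]; rfl : prodMap f k w' ⁻¹ᵁ (prodMap f h w ⁻¹ᵁ U.unop) ≤
      prodMap f (k ≫ h) w'' ⁻¹ᵁ U.unop)
  · refine (opensOverHom_comp _ _ _ _ _ (prodMap_fst ..) (Category.id_comp _) _ _ _ _ _ ?_).trans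
      (opensOverHom_comp _ _ _ _ _ _ hp _ _ _ _ _ _).symm
    exact (by rw [← hp]; rfl)

/-- The map `Γ(T, R^q f_{T*} Ẽ_T) ⟶ Γ(T', R^q f_{T'*} Ẽ_{T'})` induced by an `S`-morphism
`T' ⟶ T`. -/
def phiMap {T T' : Scheme.{u}} {g : T ⟶ S} {g' : T' ⟶ S} (h : T' ⟶ T) (w : h ≫ g = g') (q : ℕ) :
    ((higherDirectImage (pullback.snd f g).base q).obj (tildeSheaf f E g)).obj.obj (op ⊤) ⟶
      ((higherDirectImage (pullback.snd f g').base q).obj (tildeSheaf f E g')).obj.obj (op ⊤) :=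
  (baseChange (prodMap_base_snd f h w) (tildeHom f E h w) q).hom.app (op ⊤)

theorem phiMap_id {T : Scheme.{u}} (g : T ⟶ S) (w : 𝟙 T ≫ g = g) (q : ℕ) :
    phiMap f E (𝟙 T) w q = 𝟙 _ := by
  have e : (prodMap f (𝟙 T) w).base = 𝟙 _ :=
    congrArg (fun k : pullback f g ⟶ pullback f g => k.base) (prodMap_id f _ rfl _)
  refine (baseChange_congr_top (k := 𝟙 _) _ (by rw [Category.id_comp, Category.comp_id]) e rfl _ _
    (tildeHom_id f E g w e) q).trans ?_
  rw [baseChange_id]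
  exact CategoryTheory.Functor.map_id _ _

theorem phiMap_comp {T T' T'' : Scheme.{u}} {g : T ⟶ S} {g' : T' ⟶ S} {g'' : T'' ⟶ S}
    (h : T' ⟶ T) (w : h ≫ g = g') (k : T'' ⟶ T') (w' : k ≫ g' = g'') (w'' : (k ≫ h) ≫ g = g'')
    (q : ℕ) : phiMap f E (k ≫ h) w'' q = phiMap f E h w q ≫ phiMap f E k w' q := by
  have e : (prodMap f (k ≫ h) w'').base = (prodMap f k w').base ≫ (prodMap f h w).base :=
    congrArg (fun k : pullback f g'' ⟶ pullback f g => k.base)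
      (prodMap_comp f h w k w' (k ≫ h) w'' rfl).symm
  have e' : ((prodMap f k w').base ≫ (prodMap f h w).base) ≫ (pullback.snd f g).base =
      (pullback.snd f g'').base ≫ k.base ≫ h.base := by
    rw [Category.assoc, prodMap_base_snd, ← Category.assoc, prodMap_base_snd, Category.assoc]
  have h1 := baseChange_congr_top (prodMap_base_snd f (k ≫ h) w'') e' e rfl _ _
    (tildeHom_comp f E h w k w' w'' e) q
  exact h1.trans (congrArg (fun t => t.hom.app (op ⊤)) (baseChange_comp (prodMap_base_snd f h w)
    (prodMap_base_snd f k w') e' (tildeHom f E h w) (tildeHom f E k w') q)).symm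

/-- The deformation cohomology `Φ^q(X/S, E)`, sending `T ⟶ S` to
`Γ(T, R^q f_{T*} Ẽ_T)`. -/
def Phi (q : ℕ) : (Over S)ᵒᵖ ⥤ AddCommGrpCat.{u} where
  obj T := ((higherDirectImage (pullback.snd f T.unop.hom).base q).obj
    (tildeSheaf f E T.unop.hom)).obj.obj (op ⊤)
  map h := phiMap f E h.unop.left (Over.w h.unop) q
  map_id T := phiMap_id f E T.unop.hom _ q
  map_comp h k := phiMap_comp f E h.unop.left (Over.w h.unop) k.unop.left (Over.w k.unop) _ q

end Phi

/-- Nilpotent `R`-algebras: commutative `R`-algebras `N` without unit such that `N ^ r = 0` for some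
`r ≥ 1`, i.e. any product of `r` elements vanishes (the product is computed in `R ⊕ N`). -/
structure NilpotentAlgebra (R : Type u) [CommRing R] where
  /-- the underlying type -/
  carrier : Type u
  [nonUnitalCommRing : NonUnitalCommRing carrier]
  [module : Module R carrier]
  [isScalarTower : IsScalarTower R carrier carrier]
  [smulCommClass : SMulCommClass R carrier carrier]
  nilpotent : ∃ r : ℕ, 1 ≤ r ∧ ∀ x : Fin r → carrier,
    ∏ i, (Unitization.inr (x i) : Unitization R carrier) = 0

namespace NilpotentAlgebra

attribute [instance] nonUnitalCommRing module isScalarTower smulCommClass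

variable {R : Type u} [CommRing R]

/-- Morphisms are the `R`-linear multiplicative maps. -/
instance : Category (NilpotentAlgebra R) where
  Hom M N := M.carrier →ₙₐ[R] N.carrier
  id M := NonUnitalAlgHom.id R M.carrier
  comp a b := b.comp a

/-- The homomorphism `R ⊕ M ⟶ R ⊕ N` induced by `M ⟶ N`. -/
def unitizationMap {M N : NilpotentAlgebra R} (a : M ⟶ N) :
    Unitization R M.carrier →ₐ[R] Unitization R N.carrier :=
  Unitization.lift ((Unitization.inrNonUnitalAlgHom R N.carrier).comp
    (show M.carrier →ₙₐ[R] N.carrier from a))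

theorem unitizationMap_inr {M N : NilpotentAlgebra R} (a : M ⟶ N) (x : M.carrier) :
    unitizationMap a (Unitization.inr x) =
      Unitization.inr ((show M.carrier →ₙₐ[R] N.carrier from a) x) := by
  simp [unitizationMap]

/-- `Spec (R ⊕ N)` as a scheme over `Spec R`. -/
def specOver (N : NilpotentAlgebra R) : Over (Spec (.of R)) :=
  Over.mk (Spec.map (CommRingCat.ofHom (algebraMap R (Unitization R N.carrier))))

/-- The morphism `Spec (R ⊕ N) ⟶ Spec (R ⊕ M)` over `Spec R` induced by `M ⟶ N`. -/
def specOverMap {M N : NilpotentAlgebra R} (a : M ⟶ N) : specOver N ⟶ specOver M :=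
  Over.homMk (Spec.map (CommRingCat.ofHom (unitizationMap a).toRingHom)) (by
    simp only [specOver, Over.mk_hom]
    rw [← Spec.map_comp, ← CommRingCat.ofHom_comp]
    congr 2
    exact (unitizationMap a).comp_algebraMap)

theorem specOverMap_id (N : NilpotentAlgebra R) : specOverMap (𝟙 N) = 𝟙 (specOver N) := by
  ext1
  have h : unitizationMap (𝟙 N) = AlgHom.id R _ := by
    apply Unitization.algHom_ext''
    intro x
    rw [unitizationMap_inr]
    rfl
  simp only [specOverMap, h]
  exact Spec.map_id _

theorem specOverMap_comp {L M N : NilpotentAlgebra R} (a : L ⟶ M) (b : M ⟶ N) :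
    specOverMap (a ≫ b) = specOverMap b ≫ specOverMap a := by
  ext1
  have h : unitizationMap (a ≫ b) = (unitizationMap b).comp (unitizationMap a) := by
    apply Unitization.algHom_ext''
    intro x
    rw [AlgHom.comp_apply, unitizationMap_inr, unitizationMap_inr, unitizationMap_inr]
    rfl
  simp only [specOverMap, h]
  exact Spec.map_comp (CommRingCat.ofHom (unitizationMap a).toRingHom)
    (CommRingCat.ofHom (unitizationMap b).toRingHom)

/-- The closed immersion `Spec R ⟶ Spec (R ⊕ N)` given by `(r, n) ↦ r`. -/
def zeroSection (N : NilpotentAlgebra R) : Over.mk (𝟙 (Spec (.of R))) ⟶ specOver N :=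
  Over.homMk (Spec.map (CommRingCat.ofHom
    (Unitization.fstHom R N.carrier).toRingHom)) (by
    simp only [specOver, Over.mk_hom]
    rw [← Spec.map_comp, ← CommRingCat.ofHom_comp, ← Spec.map_id]
    congr 2)

theorem zeroSection_specOverMap {M N : NilpotentAlgebra R} (a : M ⟶ N) :
    zeroSection N ≫ specOverMap a = zeroSection M := by
  ext1
  have h : (Unitization.fstHom R N.carrier).comp (unitizationMap a) =
      Unitization.fstHom R M.carrier := by
    apply Unitization.algHom_ext''
    intro x
    rw [AlgHom.comp_apply, unitizationMap_inr]
    rfl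
  simp only [zeroSection, ← h]
  exact (Spec.map_comp (CommRingCat.ofHom (unitizationMap a).toRingHom)
    (CommRingCat.ofHom (Unitization.fstHom R N.carrier).toRingHom)).symm

end NilpotentAlgebra

open NilpotentAlgebra

section Psi

variable {R : Type u} [CommRing R] {X : Scheme.{u}} (f : X ⟶ Spec (.of R)) (E : BigZariskiSheaf X)

/-- The sheaf `Ẽ_N = ker (Ẽ_{Spec (R ⊕ N)} ⟶ ι_* Ẽ_{Spec R})` on `X_{Spec (R ⊕ N)}`. -/
def nilSheaf (N : NilpotentAlgebra R) : AbSheaf ↑(pullback f (specOver N).hom) :=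
  kernelSheaf (tildeHom f E (zeroSection N).left (Over.w (zeroSection N)))

/-- The natural map from `Ẽ_M` to the direct image of `Ẽ_N`, for `M ⟶ N`. -/
def nilHom {M N : NilpotentAlgebra R} (a : M ⟶ N) :
    nilSheaf f E M ⟶
      (push (prodMap f (specOverMap a).left (Over.w (specOverMap a))).base).obj
        (nilSheaf f E N) :=
  kernelHom _ _ _ (tildeHom f E (specOverMap a).left (Over.w (specOverMap a))) (by
    intro U s hs
    apply Subtype.ext
    refine restrictHom_eq_zero_of_comm E _ _
      (prodMap f (zeroSection M).left (Over.w (zeroSection M))) (prodMap_fst ..) _ _ (𝟙 _) ?_ U s.1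
      (congrArg Subtype.val hs)
    rw [Category.id_comp]
    exact prodMap_comp f _ _ _ _ _ _ (congrArg (fun k => k.left) (zeroSection_specOverMap a)))

theorem prodMap_base_fst {M N : NilpotentAlgebra R} (a : M ⟶ N) :
    (prodMap f (specOverMap a).left (Over.w (specOverMap a))).base ≫
      (pullback.fst f (specOver M).hom).base = (pullback.fst f (specOver N).hom).base :=
  congrArg (fun k : _ ⟶ X => k.base)
    (prodMap_fst f (specOverMap a).left (Over.w (specOverMap a)))

/-- The map `Ẽ_M ⟶ Ẽ_N` of sheaves on `X`, for `M ⟶ N`. -/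
def nilSheafMap {M N : NilpotentAlgebra R} (a : M ⟶ N) :
    (push (pullback.fst f (specOver M).hom).base).obj (nilSheaf f E M) ⟶
      (push (pullback.fst f (specOver N).hom).base).obj (nilSheaf f E N) :=
  (push (pullback.fst f (specOver M).hom).base).map (nilHom f E a) ≫
    pushCongr (prodMap_base_fst f a) (nilSheaf f E N)

theorem nilSheafMap_val {M N : NilpotentAlgebra R} (a : M ⟶ N) (U : X.Opens)
    (s : ((push (pullback.fst f (specOver M).hom).base).obj (nilSheaf f E M)).obj.obj (op U))
    (e : pullback.fst f (specOver N).hom ⁻¹ᵁ U ≤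
      prodMap f (specOverMap a).left (Over.w (specOverMap a)) ⁻¹ᵁ
        (pullback.fst f (specOver M).hom ⁻¹ᵁ U)) :
    ((nilSheafMap f E a).hom.app (op U) s).1.1 =
      E.obj.map (opensOverHom _ (prodMap_fst ..) _ _ e).op s.1.1 := by
  refine map_map_apply' E _ _ _ ?_ s.1.1
  refine (congrArg (· ≫ _) (opensOverHom_id _ (𝟙 _) rfl (Category.id_comp _) ?_).symm).trans ?_
  · exact e
  · exact opensOverHom_comp _ _ _ _ _ _ (Category.id_comp _) _ _ _ _ _ _

/-- The functor `N ↦ Ẽ_N`, where `Ẽ_N` is viewed as a sheaf on `X` by taking the direct image under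
the projection `X_{Spec (R ⊕ N)} ⟶ X`, which is a homeomorphism. -/
def nilSheafFunctor : NilpotentAlgebra R ⥤ AbSheaf X where
  obj N := (push (pullback.fst f (specOver N).hom).base).obj (nilSheaf f E N)
  map a := nilSheafMap f E a
  map_id N := by
    apply Sheaf.hom_ext
    ext U s
    apply Subtype.ext
    apply Subtype.ext
    have hp : prodMap f (specOverMap (𝟙 N)).left (Over.w (specOverMap (𝟙 N))) = 𝟙 _ :=
      prodMap_id f _ (congrArg (fun k => k.left) (specOverMap_id N)) _
    refine (nilSheafMap_val f E (𝟙 N) U.unop s (by rw [hp]; rfl)).trans ?_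
    rw [opensOverHom_id (𝟙 _) _ hp]
    exact ConcreteCategory.congr_hom (((opensOver _).op ⋙ E.obj).map_id _) s.1.1
  map_comp a b := by
    apply Sheaf.hom_ext
    ext U s
    apply Subtype.ext
    apply Subtype.ext
    refine (nilSheafMap_val f E (a ≫ b) U.unop s (fst_preimage_le f _ _ _)).trans ?_
    refine Eq.trans ?_ (nilSheafMap_val f E b U.unop _ (fst_preimage_le f _ _ _)).symm
    refine Eq.trans ?_ (congrArg (E.obj.map _)
      (nilSheafMap_val f E a U.unop s (fst_preimage_le f _ _ _))).symm
    refine (map_map_apply' E _ _ _ ?_ s.1.1).symm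
    exact opensOverHom_comp _ _ _ _ _ _ (prodMap_comp f _ _ _ _ _ _
      (congrArg (fun k => k.left) (specOverMap_comp a b)).symm) _ _ _ _ _ _

/-- The functor `Ψ^q(X/S, E) : N ↦ H^q(X, Ẽ_N)`. -/
def Psi (q : ℕ) : NilpotentAlgebra R ⥤ AddCommGrpCat.{u} :=
  nilSheafFunctor f E ⋙ Sheaf.functorH (Opens.grothendieckTopology X) q

/-- The functor `N ↦ ker (G(R ⊕ N) ⟶ G(R))`. -/
def nilPoints (G : BigZariskiSheaf (Spec (.of R))) : NilpotentAlgebra R ⥤ AddCommGrpCat.{u} where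
  obj N := AddCommGrpCat.of (G.obj.map (zeroSection N).op).hom.ker
  map {M N} a := AddCommGrpCat.ofHom
    (((G.obj.map (specOverMap a).op).hom.comp
      (G.obj.map (zeroSection M).op).hom.ker.subtype).codRestrict _ fun s => by
        have h : (zeroSection N) ≫ specOverMap a = 𝟙 _ ≫ zeroSection M := by
          rw [zeroSection_specOverMap, Category.id_comp]
        have hs : G.obj.map (zeroSection M).op s.1 = 0 := s.2
        refine (map_map_apply G _ _ _ _ h s.1).trans ?_
        rw [hs, map_zero])
  map_id N := by
    ext s
    have := ConcreteCategory.congr_hom (congrArg (fun k => G.obj.map k.op) (specOverMap_id N)) s.1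
    refine this.trans ?_
    exact ConcreteCategory.congr_hom (G.obj.map_id _) s.1
  map_comp a b := by
    ext s
    have := ConcreteCategory.congr_hom
      (congrArg (fun k => G.obj.map k.op) (specOverMap_comp a b)) s.1
    refine this.trans ?_
    exact ConcreteCategory.congr_hom (G.obj.map_comp _ _) s.1

end Psi

section FormalLieGroup

/-- The functor of points of the formal scheme `Spf B` over `Spec A`, for an `A`-algebra `B` with
its `I`-adic topology: a morphism `T ⟶ Spf B` over `Spec A` is a homomorphism of `A`-algebras
`φ : B ⟶ Γ(T, 𝒪_T)` which is continuous locally on `T`, i.e. every point of `T` has an open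
neighbourhood on which `φ` kills some power of `I`. -/
def spfPoints (A : CommRingCat.{u}) (B : Type u) [CommRing B] [Algebra A B] (I : Ideal B) :
    (Over (Spec A))ᵒᵖ ⥤ Type u where
  obj T := { φ : B →+* Γ(T.unop.left, ⊤) //
    φ.comp (algebraMap A B) = ((Scheme.ΓSpecIso A).inv ≫ T.unop.hom.appTop).hom ∧
    ∀ t : T.unop.left, ∃ U : T.unop.left.Opens, t ∈ U ∧
      ∃ n : ℕ, ∀ b ∈ I ^ n, T.unop.left.presheaf.map (homOfLE (le_top : U ≤ ⊤)).op (φ b) = 0 }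
  map {T T'} h := ↾fun φ => ⟨h.unop.left.appTop.hom.comp φ.1, by
    rw [RingHom.comp_assoc, φ.2.1, ← CommRingCat.hom_comp, Category.assoc,
      ← Scheme.Hom.comp_appTop, Over.w], fun t => by
    obtain ⟨U, hU, n, hn⟩ := φ.2.2 (h.unop.left t)
    refine ⟨h.unop.left ⁻¹ᵁ U, hU, n, fun b hb => ?_⟩
    have h1 := ConcreteCategory.congr_hom
      (h.unop.left.naturality (homOfLE (le_top : U ≤ ⊤)).op) (φ.1 b)
    rw [ConcreteCategory.comp_apply, ConcreteCategory.comp_apply, hn b hb, map_zero] at h1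
    exact h1.symm⟩
  map_id T := by
    ext φ b
    simp
  map_comp h k := by
    ext φ b
    simp
    rfl

/-- A sheaf of abelian groups `E` on the big Zariski site of `X` is a commutative formal Lie group
if every point of `X` has an affine open neighbourhood `Spec A` over which the underlying sheaf
of sets is isomorphic to `Spf A[[x₁, …, x_d]]`, the zero of `E(Spec A)` being the point `xᵢ ↦ 0`. -/
def IsFormalLieGroup {X : Scheme.{u}} (E : BigZariskiSheaf X) : Prop :=
  ∀ x : X, ∃ (A : CommRingCat.{u}) (j : Spec A ⟶ X), IsOpenImmersion j ∧ x ∈ Set.range j ∧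
    ∃ (d : ℕ) (e : (Over.map j).op ⋙ E.obj ⋙ forget AddCommGrpCat.{u} ≅
        spfPoints A (MvPowerSeries (Fin d) A) (Ideal.span (Set.range MvPowerSeries.X))),
      ∀ i : Fin d, (e.hom.app (op (Over.mk (𝟙 (Spec A))))
        (0 : E.obj.obj (op (Over.mk (𝟙 (Spec A) ≫ j))))).1 (MvPowerSeries.X i) = 0

/-- The property of being noetherian for a scheme over `S`. -/
def noetherianOver (S : Scheme.{u}) : ObjectProperty (Over S) :=
  fun T => AlgebraicGeometry.IsNoetherian T.left

/-- The restriction of a functor on `S`-schemes to the category of noetherian `S`-schemes. -/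
def restrictNoetherian {S : Scheme.{u}} (F : (Over S)ᵒᵖ ⥤ AddCommGrpCat.{u}) :
    (noetherianOver S).FullSubcategoryᵒᵖ ⥤ AddCommGrpCat.{u} :=
  (noetherianOver S).ι.op ⋙ F

end FormalLieGroup

end

end DeformationCohomology

open DeformationCohomology

/-! Let `T` be an affine noetherian `S`-scheme and `N` the nilradical of its ring of functions.
Since that ring is noetherian, `N` is a nilpotent `R`-algebra, and there is a canonical morphism `T
⟶ Spec (R ⊕ N)` (`toNilSpec`) carrying `T_red` into the zero section. The homomorphisms from `R ⊕ N`
to `R` and from the functions on `T` to those on `T_red` have the same kernel `N`. The proof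
transports this agreement of kernels to `E`, to cohomology and to `𝔛`.

Over an affine open set of `X` on which `E` has coordinates, a section of `Ẽ_T` is a tuple of
functions on `X_T` vanishing on `X ×_S T_red`, and a section of `Ẽ_N` is a tuple of functions on
`X_{Spec (R ⊕ N)}` vanishing on `X`. As `f` is flat, both kernels are base changes of `N`, so the
direct image of `Ẽ_T` on `X` is `Ẽ_N` (`isIso_nilComparison`).

The projection `X_T ⟶ X` is affine, and `Ẽ_T` behaves like a quasi-coherent sheaf: it is not a
module, but modulo the square of an ideal the group law is the addition of coordinates. Hence a
section over `D(f) ∩ D(1 - f)` can be split into sections over `D(f)` and `D(1 - f)` by successive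
approximation along a nilpotent ideal (`splits_kernelSheaf`). This kills the higher cohomology of
`Ẽ_T` over small affine open sets, so that `Ψ^q(N) = H^q(X, Ẽ_N)` is `H^q(X_T, Ẽ_T)`
(`isIso_cohMap_nilComparison`).

The same comparison of kernels for the identity of `S` and the group `𝔛` identifies `ker (𝔛(R ⊕ N) ⟶
𝔛(R))` with `𝔛(T)`, because `𝔛` has no nonzero points on reduced schemes (`bijective_nilPointsMap`).
With the given isomorphism this yields `H^q(X_T, Ẽ_T) ≅ 𝔛(T)`, naturally in affine noetherian `T`.

Finally the edge map from `H^q(X_T, Ẽ_T)` to `Γ(T, R^q f_{T*} Ẽ_T) = Φ^q(T)` is bijective locally on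
`T`, and `Φ^q` and `𝔛` are both Zariski sheaves. Two sheaves receiving locally bijective maps from
one functor on affine noetherian schemes agree on all noetherian schemes (`AffineHom.nonempty_iso`).
-/

namespace DeformationCohomology

noncomputable section

/-! ### Injective resolutions and their images under exact functors. -/

section Resolutions

variable {C : Type*} [Category* C] [Abelian C] {D : Type*} [Category* D] [Abelian D]

/-- An exact complex of injectives augmented by `Z`, as an injective resolution of `Z`. -/
def resolutionOfExact {Z : C} (L : CochainComplex C ℕ) (hL : ∀ n, Injective (L.X n))
    (a : Z ⟶ L.X 0) (hm : Mono a) (ha : a ≫ L.d 0 1 = 0)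
    (h₀ : (ShortComplex.mk a (L.d 0 1) ha).Exact)
    (hn : ∀ n, L.ExactAt (n + 1)) : InjectiveResolution Z where
  cocomplex := L
  injective := hL
  ι := (CochainComplex.fromSingle₀Equiv _ _).symm ⟨a, ha⟩
  quasiIso := ⟨fun n => by
    cases n with
    | zero =>
      rw [CochainComplex.quasiIsoAt₀_iff, ShortComplex.quasiIso_iff_of_zeros]
      · refine (ShortComplex.exact_and_mono_f_iff_of_iso ?_).2 ⟨h₀, hm⟩
        refine ShortComplex.isoMk (Iso.refl _) (Iso.refl _) (Iso.refl _) ?_ ?_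
        · refine (Category.id_comp a).trans (Eq.trans ?_ (Category.comp_id _).symm)
          exact (CochainComplex.fromSingle₀Equiv_symm_apply_f_zero a ha).symm
        · exact (Category.id_comp (L.d 0 1)).trans (Category.comp_id _).symm
      · rfl
      · rfl
      · exact L.shape 0 0 (by simp)
    | succ n =>
      rw [quasiIsoAt_iff_exactAt]
      · exact hn n
      · exact CochainComplex.exactAt_succ_single_obj _ n⟩

theorem augmentation_resolutionOfExact {Z : C} (L : CochainComplex C ℕ)
    (hL : ∀ n, Injective (L.X n)) (a : Z ⟶ L.X 0) (hm : Mono a) (ha : a ≫ L.d 0 1 = 0)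
    (h₀ : (ShortComplex.mk a (L.d 0 1) ha).Exact) (hn : ∀ n, L.ExactAt (n + 1)) :
    augmentation (resolutionOfExact L hL a hm ha h₀ hn) = a := by
  exact CochainComplex.fromSingle₀Equiv_symm_apply_f_zero a ha

/-- A morphism of injective resolutions which extends an isomorphism induces isomorphisms on
cohomology after applying an additive functor. -/
theorem isIso_homologyMap_of_augmentation {Z Z' : C} (J : InjectiveResolution Z)
    (J' : InjectiveResolution Z') (φ : Z ⟶ Z') [IsIso φ] (u : J.cocomplex ⟶ J'.cocomplex)
    (hu : augmentation J ≫ u.f 0 = φ ≫ augmentation J') (G : C ⥤ D) [G.Additive] (q : ℕ) :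
    IsIso (HomologicalComplex.homologyMap ((G.mapHomologicalComplex (.up ℕ)).map u) q) := by
  -- `v` extends `φ⁻¹`. Both composites of `u` and `v` agree with the identity on the augmentation,
  -- hence induce the identity on cohomology after any additive functor.
  let v : J'.cocomplex ⟶ J.cocomplex := descTo J' J.cocomplex J.injective
    (inv φ ≫ augmentation J) (by rw [Category.assoc, augmentation_d, comp_zero])
  have hv : augmentation J' ≫ v.f 0 = inv φ ≫ augmentation J := augmentation_descTo ..
  refine ⟨HomologicalComplex.homologyMap ((G.mapHomologicalComplex (.up ℕ)).map v) q, ?_, ?_⟩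
  · rw [← HomologicalComplex.homologyMap_comp, ← Functor.map_comp]
    rw [homologyMap_eq_of_augmentation J J.cocomplex J.injective (u ≫ v) (𝟙 _) (by
      rw [HomologicalComplex.comp_f, ← Category.assoc, hu, Category.assoc, hv]; simp) G q]
    simp
  · rw [← HomologicalComplex.homologyMap_comp, ← Functor.map_comp]
    rw [homologyMap_eq_of_augmentation J' J'.cocomplex J'.injective (v ≫ u) (𝟙 _) (by
      rw [HomologicalComplex.comp_f, ← Category.assoc, hv, Category.assoc, hu]; simp) G q]
    simp

/-- The cohomology of `G(L)` for a complex of injectives `L` with exact augmentation `Z ⟶ L⁰`. -/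
theorem isIso_homologyMap_of_exact {Z Z' : C} (J : InjectiveResolution Z)
    (L : CochainComplex C ℕ) (hL : ∀ n, Injective (L.X n))
    (a : Z' ⟶ L.X 0) (hm : Mono a) (ha : a ≫ L.d 0 1 = 0)
    (h₀ : (ShortComplex.mk a (L.d 0 1) ha).Exact)
    (hn : ∀ n, L.ExactAt (n + 1)) (φ : Z ⟶ Z') [IsIso φ] (u : J.cocomplex ⟶ L)
    (hu : augmentation J ≫ u.f 0 = φ ≫ a) (G : C ⥤ D) [G.Additive] (q : ℕ) :
    IsIso (HomologicalComplex.homologyMap ((G.mapHomologicalComplex (.up ℕ)).map u) q) :=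
  isIso_homologyMap_of_augmentation J (resolutionOfExact L hL a hm ha h₀ hn) φ u
    (by rw [augmentation_resolutionOfExact]; exact hu) G q

/-- The tautological morphism from `ρ(M)` to `M` along `ρ`. -/
def ComplexHom.self (ρ : D ⥤ C) [ρ.Additive] (M : CochainComplex D ℕ) :
    ComplexHom ρ ((ρ.mapHomologicalComplex (.up ℕ)).obj M) M where
  f n := 𝟙 (ρ.obj (M.X n))
  comm i j := (Category.id_comp _).trans (Category.comp_id (ρ.map (M.d i j))).symm

section

variable {ρ : D ⥤ C} [ρ.Additive] [PreservesFiniteLimits ρ] {K : CochainComplex C ℕ}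
  {M : CochainComplex D ℕ} (θ : ComplexHom ρ K M)

theorem ComplexHom.isIso_cyclesMap (hθ : ∀ n, IsIso (θ.f n)) (q : ℕ) :
    IsIso (θ.cyclesMap q) := by
  have h : (ρ.map (M.iCycles q) ≫ inv (θ.f q)) ≫ K.d q ((ComplexShape.up ℕ).next q) = 0 := by
    rw [← cancel_mono (θ.f _), Category.assoc, Category.assoc, ← θ.comm, IsIso.inv_hom_id_assoc,
      ← ρ.map_comp, HomologicalComplex.iCycles_d, ρ.map_zero, zero_comp]
  refine ⟨K.liftCycles _ _ rfl h, ?_, ?_⟩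
  · rw [← cancel_mono (K.iCycles q), Category.assoc, HomologicalComplex.liftCycles_i,
      ← Category.assoc, θ.cyclesMap_i, Category.assoc, IsIso.hom_inv_id, Category.comp_id,
      Category.id_comp]
  · rw [← cancel_mono (ρ.map (M.iCycles q)), Category.assoc, θ.cyclesMap_i,
      HomologicalComplex.liftCycles_i_assoc, Category.assoc, IsIso.inv_hom_id, Category.comp_id,
      Category.id_comp]

/-- Left exactness of `ρ` already settles the cycles. Right exactness makes `ρ(H^q(M))` the cokernel
of the same boundary map as `H^q(K)`, which gives the inverse. -/
theorem ComplexHom.isIso_homologyMap [PreservesFiniteColimits ρ] (hθ : ∀ n, IsIso (θ.f n)) (q : ℕ) :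
    IsIso (θ.homologyMap q) := by
  have := θ.isIso_cyclesMap hθ q
  have hπ := θ.homologyπ_homologyMap q
  have hc := CokernelCofork.mapIsColimit _ (M.homologyIsCokernel _ q rfl) ρ
  have hz : ρ.map (M.toCycles ((ComplexShape.up ℕ).prev q) q) ≫
      inv (θ.cyclesMap q) ≫ K.homologyπ q = 0 := by
    rw [← cancel_epi (θ.f _), ← Category.assoc, ← θ.toCycles_cyclesMap, Category.assoc,
      IsIso.hom_inv_id_assoc, HomologicalComplex.toCycles_comp_homologyπ, comp_zero]
  let c : ρ.obj (M.homology q) ⟶ K.homology q := hc.desc (CokernelCofork.ofπ _ hz)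
  have hcπ : ρ.map (M.homologyπ q) ≫ c = inv (θ.cyclesMap q) ≫ K.homologyπ q :=
    hc.fac (CokernelCofork.ofπ _ hz) WalkingParallelPair.one
  have : Epi (ρ.map (M.homologyπ q)) := inferInstance
  refine ⟨c, ?_, ?_⟩
  · rw [← cancel_epi (K.homologyπ q), ← Category.assoc, hπ, Category.assoc, hcπ,
      IsIso.hom_inv_id_assoc, Category.comp_id]
  · rw [← cancel_epi (ρ.map (M.homologyπ q)), ← Category.assoc, hcπ, Category.assoc, hπ,
      IsIso.inv_hom_id_assoc, Category.comp_id]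

end

/-- If `G ⋙ ρ ≅ 𝟭` for an exact functor `ρ` and `θ : M ⟶ G(K)` corresponds to a
quasi-isomorphism `ρ(M) ⟶ K`, then `ρ` inverts the map induced by `θ` on cohomology. -/
theorem ComplexHom.isIso_map_homologyMap {G : C ⥤ D} [G.Additive] [PreservesFiniteLimits G]
    {ρ : D ⥤ C} [ρ.Additive] [PreservesFiniteLimits ρ] [PreservesFiniteColimits ρ]
    (ε : 𝟭 C ⟶ G ⋙ ρ) [IsIso ε] {M : CochainComplex D ℕ} {K : CochainComplex C ℕ}
    (θ : ComplexHom G M K) (u : (ρ.mapHomologicalComplex (.up ℕ)).obj M ⟶ K)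
    (hu : ∀ n, u.f n ≫ ε.app (K.X n) = ρ.map (θ.f n)) (q : ℕ)
    [IsIso (HomologicalComplex.homologyMap u q)] : IsIso (ρ.map (θ.homologyMap q)) := by
  have := (ComplexHom.self ρ M).isIso_homologyMap (fun n => inferInstanceAs (IsIso (𝟙 _))) q
  have h1 := (ComplexHom.self ρ M).homologyMap_comp q θ
  -- One morphism of complexes factored in two ways; on cohomology this expresses `ρ` of the map
  -- induced by `θ` as a composite of isomorphisms.
  have h2 : (ComplexHom.self ρ M).comp θ = precomp u (ofNatTrans ε K) := by
    ext n
    exact (Category.id_comp (ρ.map (θ.f n))).trans (hu n).symm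
  rw [h2, homologyMap_precomp, homologyMap_ofNatTrans] at h1
  have h3 : ρ.map (θ.homologyMap q) = inv ((ComplexHom.self ρ M).homologyMap q) ≫
      HomologicalComplex.homologyMap u q ≫ ε.app (K.homology q) := by
    rw [h1, IsIso.inv_hom_id_assoc]
  rw [h3]
  infer_instance

end Resolutions

/-! ### Restriction to an open subset is exact and preserves injectives. -/

section OpenRestriction

variable {Y Z : TopCat.{u}} {j : Y ⟶ Z}

/-- The restriction of sheaves along an open embedding. -/
abbrev openRestrict (hj : Topology.IsOpenEmbedding j) : AbSheaf Z ⥤ AbSheaf Y :=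
  hj.sheafPullback AddCommGrpCat.{u}

variable (hj : Topology.IsOpenEmbedding j)

instance : (openRestrict hj).Additive where
  map_add := rfl

instance : PreservesFiniteLimits (openRestrict hj) := by
  have : PreservesFiniteLimits (TopCat.Sheaf.pullback AddCommGrpCat.{u} j) := by
    unfold TopCat.Sheaf.pullback
    have : RepresentablyFlat (Opens.map j) := inferInstance
    apply +allowSynthFailures Functor.sheafPullbackConstruction.preservesFiniteLimits
  exact preservesFiniteLimits_of_natIso (hj.sheafPullbackIso AddCommGrpCat.{u})

instance : PreservesFiniteColimits (openRestrict hj) :=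
  preservesFiniteColimits_of_natIso (hj.sheafPullbackIso AddCommGrpCat.{u})

/-- The left Kan extension along `j` is extension by zero of presheaves: on an open set `W`
contained in the image of `j` it has the value on `j⁻¹(W)`, and on every other `W` it is a colimit
over an empty category. -/
theorem mono_lan_map (F : Y.Presheaf AddCommGrpCat.{u}) (G : Y.Presheaf AddCommGrpCat.{u})
    (m : F ⟶ G) [Mono m] : Mono (hj.functor.op.lan.map m) := by
  have : Mono j := (TopCat.mono_iff_injective j).mpr hj.injective
  rw [NatTrans.mono_iff_mono_app]
  intro W
  by_cases hW : ∃ U : Opens Y, hj.functor.obj U = W.unop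
  · obtain ⟨U, hU⟩ := hW
    obtain rfl : op (hj.functor.obj U) = W := congrArg op hU
    have h := congr_app (hj.functor.op.lanUnit.naturality m) (op U)
    have h' : (hj.functor.op.lan.map m).app (op (hj.functor.obj U)) =
        inv ((hj.functor.op.lanUnit.app F).app (op U)) ≫ m.app (op U) ≫
          (hj.functor.op.lanUnit.app G).app (op U) := by
      rw [IsIso.eq_inv_comp]
      exact h.symm
    have : Mono (m.app (op U)) := inferInstance
    rw [h']
    infer_instance
  · have hempty : IsEmpty (CostructuredArrow hj.functor.op W) := ⟨fun f => hW
      ⟨(Opens.map j).obj W.unop, by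
        have hle : W.unop ≤ hj.functor.obj f.left.unop := f.hom.unop.le
        ext x
        constructor
        · rintro ⟨y, hy, rfl⟩
          exact hy
        · intro hx
          obtain ⟨y, hy, rfl⟩ := hle hx
          exact ⟨y, hx, rfl⟩⟩⟩
    have h0 : IsZero ((hj.functor.op.lan.obj F).obj W) := by
      refine IsZero.of_iso ?_ (hj.functor.op.leftKanExtensionObjIsoColimit F W)
      rw [IsZero.iff_id_eq_zero]
      exact colimit.hom_ext fun f => (hempty.false f).elim
    exact ⟨fun a b _ => h0.eq_of_tgt _ _⟩

/-- Restriction has the left adjoint extension by zero, which preserves monomorphisms by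
`mono_lan_map` and exactness of sheafification. -/
instance (I : AbSheaf Z) [Injective I] : Injective ((openRestrict hj).obj I) := by
  have := Topology.IsOpenEmbedding.functor_isContinuous hj
  let adj := Functor.sheafPullbackConstruction.sheafAdjunctionContinuous hj.functor
    AddCommGrpCat.{u} (Opens.grothendieckTopology Y) (Opens.grothendieckTopology Z)
  have : (Functor.sheafPullbackConstruction.sheafPullback hj.functor
    AddCommGrpCat.{u} (Opens.grothendieckTopology Y)
      (Opens.grothendieckTopology Z)).PreservesMonomorphisms := ⟨fun m hm => by
    have : Mono ((sheafToPresheaf _ _).map m) := inferInstance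
    have := mono_lan_map hj _ _ ((sheafToPresheaf _ _).map m)
    change Mono ((presheafToSheaf _ _).map (hj.functor.op.lan.map ((sheafToPresheaf _ _).map m)))
    infer_instance⟩
  have hI : Injective (C := Sheaf (Opens.grothendieckTopology Z) AddCommGrpCat.{u}) I := ‹_›
  exact @Injective.injective_of_adjoint _ _ _ _ _ _ this adj I hI

end OpenRestriction

/-! ### Injective sheaves are flasque. -/

section Flasque

variable {Y : TopCat.{u}}

/-- The sections of `I` over `U` are the morphisms to `I` from the free abelian sheaf `A.obj U` on
`U`. As `A.obj V ⟶ A.obj U` is a monomorphism, every section over `V` extends to `U`. -/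
theorem surjective_restriction_of_injective (I : AbSheaf Y) [Injective I] {U V : Opens Y}
    (i : V ⟶ U) : Function.Surjective (I.obj.map i.op) := by
  let A : Opens Y ⥤ AbSheaf Y := yoneda ⋙ (Functor.whiskeringRight _ _ _).obj
      AddCommGrpCat.free ⋙ presheafToSheaf _ _
  have : Mono (A.map i) := by
    have : Mono (yoneda.map i) := inferInstance
    have : Mono (((Functor.whiskeringRight (Opens Y)ᵒᵖ _ _).obj AddCommGrpCat.free).map
        (yoneda.map i)) := by
      rw [NatTrans.mono_iff_mono_app]
      intro W
      have : Mono ((yoneda.map i).app W) := inferInstance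
      exact inferInstanceAs (Mono (AddCommGrpCat.free.map ((yoneda.map i).app W)))
    exact inferInstanceAs (Mono ((presheafToSheaf (Opens.grothendieckTopology Y) _).map
      (((Functor.whiskeringRight (Opens Y)ᵒᵖ _ _).obj AddCommGrpCat.free).map (yoneda.map i))))
  let adj := (AddCommGrpCat.adj.whiskerRight (Opens Y)ᵒᵖ).comp
    (sheafificationAdjunction (Opens.grothendieckTopology Y) AddCommGrpCat.{u})
  let e (W : Opens Y) : (A.obj W ⟶ I) ≃ I.obj.obj (op W) :=
    (adj.homEquiv (yoneda.obj W) I).trans yonedaEquiv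
  have he (W W' : Opens Y) (k : W' ⟶ W) (a : A.obj W ⟶ I) :
      e W' (A.map k ≫ a) = I.obj.map k.op (e W a) := by
    refine (congrArg yonedaEquiv (adj.homEquiv_naturality_left (yoneda.map k) a)).trans ?_
    exact (yonedaEquiv_naturality (F := I.obj ⋙ forget _) (adj.homEquiv _ I a) k).symm
  intro s
  refine ⟨e U (Injective.factorThru ((e V).symm s) (A.map i)), ?_⟩
  rw [← he, Injective.comp_factorThru, Equiv.apply_symm_apply]

end Flasque

/-! ### Sections of sheaves: gluing, local lifting, exactness. -/

section Sections

variable {Y : TopCat.{u}}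

/-- The restriction of sections of a sheaf. -/
def resHom (F : AbSheaf Y) {U V : Opens Y} (h : V ≤ U) :
    F.obj.obj (op U) →+ F.obj.obj (op V) :=
  (F.obj.map (homOfLE h).op).hom

/-- The map induced by a morphism of sheaves on sections. -/
def secHom {F G : AbSheaf Y} (φ : F ⟶ G) (U : Opens Y) :
    F.obj.obj (op U) →+ G.obj.obj (op U) :=
  (φ.hom.app (op U)).hom

theorem resHom_self (F : AbSheaf Y) {U : Opens Y} (h : U ≤ U) (s : F.obj.obj (op U)) :
    resHom F h s = s :=
  ConcreteCategory.congr_hom (F.obj.map_id (op U)) s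

theorem resHom_resHom (F : AbSheaf Y) {U V W : Opens Y} (h : V ≤ U) (h' : W ≤ V)
    (s : F.obj.obj (op U)) : resHom F h' (resHom F h s) = resHom F (h'.trans h) s :=
  (ConcreteCategory.congr_hom (F.obj.map_comp (homOfLE h).op (homOfLE h').op) s).symm

theorem secHom_resHom {F G : AbSheaf Y} (φ : F ⟶ G) {U V : Opens Y} (h : V ≤ U)
    (s : F.obj.obj (op U)) : secHom φ V (resHom F h s) = resHom G h (secHom φ U s) :=
  ConcreteCategory.congr_hom (φ.hom.naturality (homOfLE h).op) s

theorem secHom_comp {F G H : AbSheaf Y} (φ : F ⟶ G) (ψ : G ⟶ H) (U : Opens Y)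
    (s : F.obj.obj (op U)) : secHom (φ ≫ ψ) U s = secHom ψ U (secHom φ U s) := rfl

theorem secHom_zero {F G : AbSheaf Y} (U : Opens Y)
    (s : F.obj.obj (op U)) : secHom (0 : F ⟶ G) U s = 0 := rfl

theorem eq_of_locally_eq (F : AbSheaf Y) {U : Opens Y} (s t : F.obj.obj (op U))
    (h : ∀ x ∈ U, ∃ (V : Opens Y) (hV : V ≤ U), x ∈ V ∧ resHom F hV s = resHom F hV t) : s = t := by
  choose! V hV hx he using h
  refine TopCat.Sheaf.eq_of_locally_eq' F (fun x : U => V x) U (fun x => homOfLE (hV x x.2)) ?_ s t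
    fun x => he x x.2
  intro x hxU
  exact Opens.mem_iSup.mpr ⟨⟨x, hxU⟩, hx x hxU⟩

/-- Two sections which agree on the intersection can be glued. -/
theorem exists_glue_pair (F : AbSheaf Y) {U U₁ U₂ : Opens Y} (h₁ : U₁ ≤ U) (h₂ : U₂ ≤ U)
    (h : U ≤ U₁ ⊔ U₂) (s₁ : F.obj.obj (op U₁)) (s₂ : F.obj.obj (op U₂))
    (hs : resHom F (inf_le_left : U₁ ⊓ U₂ ≤ U₁) s₁ = resHom F inf_le_right s₂) :
    ∃ s : F.obj.obj (op U), resHom F h₁ s = s₁ ∧ resHom F h₂ s = s₂ := by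
  let V : Bool → Opens Y := fun b => if b then U₁ else U₂
  let sf : ∀ b, F.obj.obj (op (V b)) := fun b => match b with
    | true => s₁
    | false => s₂
  obtain ⟨s, hs, -⟩ := TopCat.Sheaf.existsUnique_gluing' F V U
    (fun b => match b with
      | true => homOfLE h₁
      | false => homOfLE h₂) (by
        intro x hx
        rcases h hx with h | h
        · exact Opens.mem_iSup.mpr ⟨true, h⟩
        · exact Opens.mem_iSup.mpr ⟨false, h⟩) sf (by
      intro a b
      match a, b with
      | true, true => rfl
      | false, false => rfl
      | true, false => exact hs
      | false, true =>
        have h3 := congrArg (resHom F (inf_comm U₂ U₁).le) hs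
        rw [resHom_resHom, resHom_resHom] at h3
        exact h3.symm)
  exact ⟨s, hs true, hs false⟩

theorem secHom_injective {F G : AbSheaf Y} (φ : F ⟶ G) [Mono φ] (U : Opens Y) :
    Function.Injective (secHom φ U) := by
  have : Mono φ.hom := (Sheaf.Hom.mono_iff_presheaf_mono (Opens.grothendieckTopology Y)
    AddCommGrpCat.{u} φ).mp ‹_›
  have : Mono (φ.hom.app (op U)) := inferInstance
  exact (AddCommGrpCat.mono_iff_injective _).mp this

theorem exists_local_lift_of_epi {F G : AbSheaf Y} (φ : F ⟶ G) [Epi φ] {U : Opens Y}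
    (s : G.obj.obj (op U)) (x : Y) (hx : x ∈ U) :
    ∃ (V : Opens Y) (hV : V ≤ U), x ∈ V ∧ ∃ t : F.obj.obj (op V), secHom φ V t = resHom G hV s := by
  have := (Sheaf.isLocallySurjective_iff_epi' AddCommGrpCat.{u} φ).mpr ‹_›
  obtain ⟨W, Wle, ⟨t, ht⟩, hW⟩ := (TopCat.Presheaf.isLocallySurjective_iff φ.hom).mp this U s x hx
  exact ⟨W, Wle, hW, t, ht⟩

theorem exists_lift_of_exact_of_mono {S : ShortComplex (AbSheaf Y)} (hS : S.Exact) [Mono S.f]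
    {U : Opens Y} (s : S.X₂.obj.obj (op U)) (hs : secHom S.g U s = 0) :
    ∃ t, secHom S.f U t = s :=
  TopCat.Sheaf.sections_exact_of_left_exact hS ‹_› s hs

theorem exists_local_lift_of_exact {S : ShortComplex (AbSheaf Y)} (hS : S.Exact) {U : Opens Y}
    (s : S.X₂.obj.obj (op U)) (hs : secHom S.g U s = 0) (x : Y) (hx : x ∈ U) :
    ∃ (V : Opens Y) (hV : V ≤ U), x ∈ V ∧
      ∃ t : S.X₁.obj.obj (op V), secHom S.f V t = resHom S.X₂ hV s := by
  have hK : (ShortComplex.mk (kernel.ι S.g) S.g (kernel.condition S.g)).Exact :=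
    ShortComplex.exact_of_f_is_kernel _ (kernelIsKernel S.g)
  have : Mono (ShortComplex.mk (kernel.ι S.g) S.g (kernel.condition S.g)).f :=
    inferInstanceAs (Mono (kernel.ι S.g))
  obtain ⟨s', hs'⟩ := exists_lift_of_exact_of_mono hK s hs
  have : Epi (kernel.lift S.g S.f S.zero) := S.exact_iff_epi_kernel_lift.mp hS
  obtain ⟨V, hV, hxV, t, ht⟩ := exists_local_lift_of_epi (kernel.lift S.g S.f S.zero) s' x hx
  refine ⟨V, hV, hxV, t, ?_⟩
  rw [← kernel.lift_ι S.g S.f S.zero, secHom_comp, ht, secHom_resHom]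
  exact congrArg _ hs'

end Sections

/-! ### Vanishing of cohomology from splittings over two-element coverings. -/

section Splitting

variable {Y : TopCat.{u}}

/-- A class of open sets together with distinguished two-element coverings which suffice to pass
from local to global statements. -/
structure SplittingBasis (Y : TopCat.{u}) where
  /-- the open sets -/
  opens : Set (Opens Y)
  /-- the distinguished coverings of the first open set by the two others -/
  split : Opens Y → Opens Y → Opens Y → Prop
  left_le {U U₁ U₂ : Opens Y} : split U U₁ U₂ → U₁ ≤ U
  right_le {U U₁ U₂ : Opens Y} : split U U₁ U₂ → U₂ ≤ U
  le_sup {U U₁ U₂ : Opens Y} : split U U₁ U₂ → U ≤ U₁ ⊔ U₂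
  inf_mem {U U₁ U₂ : Opens Y} : split U U₁ U₂ → U₁ ⊓ U₂ ∈ opens
  of_locally (p : Opens Y → Prop) (h₀ : p ⊥) (hp : ∀ U V, V ≤ U → p U → p V)
    (hs : ∀ U U₁ U₂, split U U₁ U₂ → p U₁ → p U₂ → p U) (U : Opens Y) (hU : U ∈ opens)
    (h : ∀ x ∈ U, ∃ V, x ∈ V ∧ V ≤ U ∧ p V) : p U

namespace SplittingBasis

variable (B : SplittingBasis Y)

/-- Sections over `U₁ ∩ U₂` are sums of sections over `U₁` and `U₂` for all distinguished
coverings. -/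
def Splits (F : AbSheaf Y) : Prop :=
  ∀ U U₁ U₂ : Opens Y, B.split U U₁ U₂ → ∀ z : F.obj.obj (op (U₁ ⊓ U₂)),
    ∃ (z₁ : F.obj.obj (op U₁)) (z₂ : F.obj.obj (op U₂)),
      resHom F inf_le_left z₁ + resHom F inf_le_right z₂ = z

variable {B}

/-- If the kernel of a morphism splits, then a section which lifts locally lifts. -/
theorem exists_lift {F G : AbSheaf Y} (φ : F ⟶ G)
    (hφ : ∀ U U₁ U₂ : Opens Y, B.split U U₁ U₂ → ∀ z : F.obj.obj (op (U₁ ⊓ U₂)),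
      secHom φ _ z = 0 → ∃ (z₁ : F.obj.obj (op U₁)) (z₂ : F.obj.obj (op U₂)),
        secHom φ _ z₁ = 0 ∧ secHom φ _ z₂ = 0 ∧
          resHom F inf_le_left z₁ + resHom F inf_le_right z₂ = z)
    {U : Opens Y} (hU : U ∈ B.opens) (s : G.obj.obj (op U))
    (hs : ∀ x ∈ U, ∃ (V : Opens Y) (hV : V ≤ U), x ∈ V ∧ ∃ t, secHom φ V t = resHom G hV s) :
    ∃ t, secHom φ U t = s := by
  have key : ∃ (h : U ≤ U) (t : _), secHom φ U t = resHom G h s := by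
    refine B.of_locally (fun V => ∃ (h : V ≤ U) (t : _), secHom φ V t = resHom G h s)
      ?_ ?_ ?_ U hU ?_
    · exact ⟨bot_le, 0, eq_of_locally_eq G _ _ fun x hx => False.elim hx⟩
    · rintro V W hWV ⟨h, t, ht⟩
      refine ⟨hWV.trans h, resHom F hWV t, ?_⟩
      rw [secHom_resHom, ht, resHom_resHom]
    · rintro V V₁ V₂ hV ⟨h₁, t₁, ht₁⟩ ⟨h₂, t₂, ht₂⟩
      have hVU : V ≤ U := (B.le_sup hV).trans (sup_le h₁ h₂)
      -- The lifts `t₁` and `t₂` differ on the intersection by a section of the kernel. Once this is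
      -- written as `z₁ + z₂`, the corrected lifts `t₁ - z₁` and `t₂ + z₂` agree there and glue.
      obtain ⟨z₁, z₂, hz₁, hz₂, hz⟩ := hφ V V₁ V₂ hV
        (resHom F inf_le_left t₁ - resHom F inf_le_right t₂) (by
          rw [map_sub, secHom_resHom, secHom_resHom, ht₁, ht₂, resHom_resHom, resHom_resHom,
            sub_self])
      obtain ⟨t, h1, h2⟩ := exists_glue_pair F (B.left_le hV) (B.right_le hV) (B.le_sup hV)
        (t₁ - z₁) (t₂ + z₂) (by
          rw [map_sub, map_add, sub_eq_iff_eq_add, add_right_comm, add_assoc, hz,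
            add_sub_cancel])
      refine ⟨hVU, t, ?_⟩
      apply eq_of_locally_eq
      intro x hx
      rcases B.le_sup hV hx with hx | hx
      · refine ⟨V₁, B.left_le hV, hx, ?_⟩
        rw [← secHom_resHom, h1, map_sub, hz₁, sub_zero, ht₁, resHom_resHom]
      · refine ⟨V₂, B.right_le hV, hx, ?_⟩
        rw [← secHom_resHom, h2, map_add, hz₂, add_zero, ht₂, resHom_resHom]
    · intro x hx
      obtain ⟨V, hV, hxV, t, ht⟩ := hs x hx
      exact ⟨V, hxV, hV, hV, t, ht⟩
  obtain ⟨h, t, ht⟩ := key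
  exact ⟨t, by rw [ht, resHom_self]⟩

variable {F : AbSheaf Y} (J : InjectiveResolution F)

theorem exists_d_zero_lift {U : Opens Y} (z : (J.cocomplex.X 0).obj.obj (op U))
    (hz : secHom (J.cocomplex.d 0 1) U z = 0) : ∃ t, secHom (augmentation J) U t = z := by
  have : Mono (ShortComplex.mk (augmentation J) (J.cocomplex.d 0 1) (augmentation_d J)).f :=
    inferInstanceAs (Mono (augmentation J))
  exact exists_lift_of_exact_of_mono
    (S := ShortComplex.mk (augmentation J) (J.cocomplex.d 0 1) (augmentation_d J)) J.exact₀ z hz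

/-- The terms of an injective resolution of a sheaf which splits have no cohomology over the
open sets of the basis, and the sheaves of cocycles split. -/
theorem exists_primitive_aux (hF : B.Splits F) (n : ℕ) :
    (∀ U ∈ B.opens, ∀ z : (J.cocomplex.X (n + 1)).obj.obj (op U),
      secHom (J.cocomplex.d (n + 1) (n + 2)) U z = 0 →
        ∃ y, secHom (J.cocomplex.d n (n + 1)) U y = z) ∧
    (∀ U U₁ U₂ : Opens Y, B.split U U₁ U₂ → ∀ z : (J.cocomplex.X n).obj.obj (op (U₁ ⊓ U₂)),
      secHom (J.cocomplex.d n (n + 1)) _ z = 0 → ∃ (z₁ : (J.cocomplex.X n).obj.obj (op U₁))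
        (z₂ : (J.cocomplex.X n).obj.obj (op U₂)), secHom (J.cocomplex.d n (n + 1)) _ z₁ = 0 ∧
          secHom (J.cocomplex.d n (n + 1)) _ z₂ = 0 ∧
          resHom _ inf_le_left z₁ + resHom _ inf_le_right z₂ = z) := by
  -- Cocycles of positive degree are coboundaries locally, so by `exists_lift` they are coboundaries
  -- over the basis as soon as the cocycles of one degree less split. Only the splitting needs an
  -- induction.
  suffices h : ∀ U U₁ U₂ : Opens Y, B.split U U₁ U₂ →
      ∀ z : (J.cocomplex.X n).obj.obj (op (U₁ ⊓ U₂)),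
      secHom (J.cocomplex.d n (n + 1)) _ z = 0 → ∃ (z₁ : (J.cocomplex.X n).obj.obj (op U₁))
        (z₂ : (J.cocomplex.X n).obj.obj (op U₂)), secHom (J.cocomplex.d n (n + 1)) _ z₁ = 0 ∧
          secHom (J.cocomplex.d n (n + 1)) _ z₂ = 0 ∧
          resHom _ inf_le_left z₁ + resHom _ inf_le_right z₂ = z from
    ⟨fun U hU z hz => exists_lift _ h hU z fun x hx =>
      exists_local_lift_of_exact (J.exact_succ n) z hz x hx, h⟩
  induction n with
  | zero =>
    intro U U₁ U₂ hU z hz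
    obtain ⟨t, rfl⟩ := exists_d_zero_lift J z hz
    obtain ⟨t₁, t₂, rfl⟩ := hF U U₁ U₂ hU t
    refine ⟨secHom (augmentation J) _ t₁, secHom (augmentation J) _ t₂, ?_, ?_, ?_⟩
    · rw [← secHom_comp, augmentation_d, secHom_zero]
    · rw [← secHom_comp, augmentation_d, secHom_zero]
    · rw [map_add, secHom_resHom, secHom_resHom]
  | succ n ih =>
    intro U U₁ U₂ hU z hz
    -- The intersection belongs to the basis, so `z` has a primitive `y` there. Extending `y` to
    -- `U₁` by flasqueness and applying the differential extends `z` itself, and the second summand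
    -- can be taken to be zero.
    obtain ⟨y, rfl⟩ := exists_lift _ ih (B.inf_mem hU) z fun x hx =>
      exists_local_lift_of_exact (J.exact_succ n) z hz x hx
    obtain ⟨y₁, rfl⟩ := surjective_restriction_of_injective (J.cocomplex.X n)
      (homOfLE (inf_le_left : U₁ ⊓ U₂ ≤ U₁)) y
    refine ⟨secHom (J.cocomplex.d n (n + 1)) _ y₁, 0, ?_, map_zero _, ?_⟩
    · rw [← secHom_comp, J.cocomplex.d_comp_d, secHom_zero]
    · rw [map_zero, add_zero, ← secHom_resHom]
      rfl

theorem exists_primitive (hF : B.Splits F) (n : ℕ) {U : Opens Y} (hU : U ∈ B.opens)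
    (z : (J.cocomplex.X (n + 1)).obj.obj (op U))
    (hz : secHom (J.cocomplex.d (n + 1) (n + 2)) U z = 0) :
    ∃ y, secHom (J.cocomplex.d n (n + 1)) U y = z :=
  (exists_primitive_aux J hF n).1 U hU z hz

end SplittingBasis

end Splitting

/-! ### Higher direct images over an open subset of the base. -/

section Comparison

/-- Exactness means that the map to the kernel is an epimorphism of sheaves, i.e. locally surjective
on sections. -/
theorem exact_of_exists_local_lift {Y : TopCat.{u}} {S : ShortComplex (AbSheaf Y)}
    (h : ∀ (U : Opens Y) (s : S.X₂.obj.obj (op U)), secHom S.g U s = 0 → ∀ x ∈ U,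
      ∃ (V : Opens Y) (hV : V ≤ U), x ∈ V ∧
        ∃ t : S.X₁.obj.obj (op V), secHom S.f V t = resHom S.X₂ hV s) : S.Exact := by
  rw [S.exact_iff_epi_kernel_lift]
  refine (Sheaf.isLocallySurjective_iff_epi' AddCommGrpCat.{u} (kernel.lift S.g S.f S.zero)).mp ?_
  refine (TopCat.Presheaf.isLocallySurjective_iff _).mpr ?_
  intro U s' x hx
  obtain ⟨V, hV, hxV, t, ht⟩ := h U (secHom (kernel.ι S.g) U s') (by
    rw [← secHom_comp, kernel.condition, secHom_zero]) x hx
  refine ⟨V, hV, ⟨t, ?_⟩, hxV⟩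
  apply secHom_injective (kernel.ι S.g)
  refine ((secHom_comp (kernel.lift S.g S.f S.zero) (kernel.ι S.g) V t).symm.trans ?_).trans
    (secHom_resHom (kernel.ι S.g) hV s').symm
  rw [kernel.lift_ι, ht]

/-- The image of an injective resolution under an exact functor which preserves injectives. -/
def mapResolution {C D : Type*} [Category* C] [Abelian C] [Category* D] [Abelian D] (ρ : C ⥤ D)
    [ρ.Additive] [PreservesFiniteLimits ρ] [PreservesFiniteColimits ρ]
    (hρ : ∀ I, Injective I → Injective (ρ.obj I)) {Z : C} (J : InjectiveResolution Z) :
    InjectiveResolution (ρ.obj Z) :=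
  resolutionOfExact ((ρ.mapHomologicalComplex (.up ℕ)).obj J.cocomplex)
    (fun n => hρ _ (J.injective n)) (ρ.map (augmentation J))
    (inferInstanceAs (Mono (ρ.map (augmentation J))))
    ((ρ.map_comp _ _).symm.trans ((congrArg ρ.map (augmentation_d J)).trans (ρ.map_zero _ _)))
    (J.exact₀.map ρ) (fun n => by
      rw [HomologicalComplex.exactAt_iff' _ n (n + 1) (n + 2) (by simp)
        (by simp only [CochainComplex.next]; rfl)]
      exact (J.exact_succ n).map ρ)

theorem augmentation_mapResolution {C D : Type*} [Category* C] [Abelian C] [Category* D]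
    [Abelian D] (ρ : C ⥤ D) [ρ.Additive] [PreservesFiniteLimits ρ] [PreservesFiniteColimits ρ]
    (hρ : ∀ I, Injective I → Injective (ρ.obj I)) {Z : C} (J : InjectiveResolution Z) :
    augmentation (mapResolution ρ hρ J) = ρ.map (augmentation J) :=
  augmentation_resolutionOfExact ..

theorem isIso_map_comp {B C D : Type*} [Category* B] [Category* C] [Category* D] (G : C ⥤ D)
    (H : B ⥤ C) {P Q : C} {U V : B} (i : P ≅ Q) (r : Q ⟶ H.obj U) (j : V ≅ U)
    (hr : IsIso (G.map r)) : IsIso (G.map (i.hom ≫ r ≫ H.map j.inv)) := by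
  rw [G.map_comp, G.map_comp]
  infer_instance

section OpenBaseChange

variable {Y Y' T T' : TopCat.{u}}

theorem map_functor_obj {h : T' ⟶ T} (hh : Topology.IsOpenEmbedding h) (W : Opens T') :
    (Opens.map h).obj (hh.functor.obj W) = W := by
  ext x
  constructor
  · rintro ⟨y, hy, e⟩
    exact hh.injective e ▸ hy
  · intro hx
    exact ⟨x, hx, rfl⟩

/-- The isomorphism `F ⟶ h⁻¹ h_* F` for an open embedding `h`. -/
def openUnit {h : T' ⟶ T} (hh : Topology.IsOpenEmbedding h) :
    𝟭 (AbSheaf T') ⟶ push h ⋙ openRestrict hh where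
  app F := ⟨{ app U := F.obj.map (eqToHom (map_functor_obj hh U.unop)).op
              naturality U V i := by
                change F.obj.map _ ≫ F.obj.map _ = F.obj.map _ ≫ F.obj.map _
                rw [← F.obj.map_comp, ← F.obj.map_comp]
                rfl }⟩
  naturality F G m := by
    apply Sheaf.hom_ext
    ext U : 2
    exact (m.hom.naturality _).symm

theorem isIso_of_app {Y : TopCat.{u}} {F G : AbSheaf Y} (φ : F ⟶ G)
    (h : ∀ U : Opens Y, IsIso (φ.hom.app (op U))) : IsIso φ := by
  have : IsIso φ.hom := NatIso.isIso_of_isIso_app φ.hom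
  exact ⟨⟨inv φ.hom⟩, Sheaf.hom_ext (IsIso.hom_inv_id φ.hom),
    Sheaf.hom_ext (IsIso.inv_hom_id φ.hom)⟩

/-- The isomorphism `h⁻¹ h_* F ⟶ F` for an open embedding `h`. -/
def openCounit {h : T' ⟶ T} (hh : Topology.IsOpenEmbedding h) (F : AbSheaf T') :
    (openRestrict hh).obj ((push h).obj F) ⟶ F :=
  ⟨{ app U := F.obj.map (eqToHom (map_functor_obj hh U.unop).symm).op
     naturality U V i := by
      change F.obj.map _ ≫ F.obj.map _ = F.obj.map _ ≫ F.obj.map _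
      rw [← F.obj.map_comp, ← F.obj.map_comp]
      rfl }⟩

theorem openCounit_naturality {h : T' ⟶ T} (hh : Topology.IsOpenEmbedding h) {F G : AbSheaf T'}
    (m : F ⟶ G) :
    (openRestrict hh).map ((push h).map m) ≫ openCounit hh G = openCounit hh F ≫ m := by
  apply Sheaf.hom_ext
  ext U : 2
  exact (m.hom.naturality _).symm

instance {h : T' ⟶ T} (hh : Topology.IsOpenEmbedding h) (F : AbSheaf T') :
    IsIso (openCounit hh F) := by
  apply isIso_of_app
  intro U
  exact inferInstanceAs (IsIso (F.obj.map (eqToHom (map_functor_obj hh U).symm).op))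

instance {h : T' ⟶ T} (hh : Topology.IsOpenEmbedding h) : IsIso (openUnit hh) := by
  have (F : AbSheaf T') : IsIso ((openUnit hh).app F) := by
    apply isIso_of_app
    intro U
    exact inferInstanceAs (IsIso (F.obj.map (eqToHom (map_functor_obj hh U)).op))
  exact NatIso.isIso_of_isIso_app _

variable {h' : Y' ⟶ Y} {a : Y ⟶ T} {a' : Y' ⟶ T'} {h : T' ⟶ T} (w : h' ≫ a = a' ≫ h)
  (hh : Topology.IsOpenEmbedding h) (hh' : Topology.IsOpenEmbedding h')
  (hr : ∀ y, a y ∈ Set.range h → y ∈ Set.range h')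
include w hr

/-- The hypothesis `hr` says that every point of `Y` lying over `T'` comes from `Y'`; so the square
is cartesian on open sets, and restriction commutes with direct images on the nose. -/
theorem functor_obj_map (W : Opens T') :
    hh'.functor.obj ((Opens.map a').obj W) = (Opens.map a).obj (hh.functor.obj W) := by
  ext y
  constructor
  · rintro ⟨y', hy', rfl⟩
    exact ⟨a' y', hy', (ConcreteCategory.congr_hom w y').symm⟩
  · rintro ⟨t, ht, e⟩
    obtain ⟨y', rfl⟩ := hr y ⟨t, e⟩
    refine ⟨y', ?_, rfl⟩
    have : h (a' y') = h t := by
      rw [e]; exact (ConcreteCategory.congr_hom w y').symm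
    have := hh.injective this
    change a' y' ∈ W
    rwa [this]

/-- The isomorphism `h⁻¹ a_* F ⟶ a'_* h'⁻¹ F`. -/
def restrictPush (F : AbSheaf Y) :
    (openRestrict hh).obj ((push a).obj F) ⟶ (push a').obj ((openRestrict hh').obj F) :=
  ⟨{ app U := F.obj.map (eqToHom (functor_obj_map w hh hh' hr U.unop)).op
     naturality U V i := by
      change F.obj.map _ ≫ F.obj.map _ = F.obj.map _ ≫ F.obj.map _
      rw [← F.obj.map_comp, ← F.obj.map_comp]
      rfl }⟩

theorem restrictPush_naturality {F G : AbSheaf Y} (m : F ⟶ G) :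
    (openRestrict hh).map ((push a).map m) ≫ restrictPush w hh hh' hr G =
      restrictPush w hh hh' hr F ≫ (push a').map ((openRestrict hh').map m) := by
  apply Sheaf.hom_ext
  ext U : 2
  exact (m.hom.naturality _).symm

theorem isIso_restrictPush (F : AbSheaf Y) : IsIso (restrictPush w hh hh' hr F) := by
  apply isIso_of_app
  intro U
  exact inferInstanceAs (IsIso (F.obj.map (eqToHom (functor_obj_map w hh hh' hr U)).op))

/-- All maps involved are restrictions along equal open sets combined with `r`. The identity is the
compatibility that `ComplexHom.isIso_map_homologyMap` requires in each degree. -/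
theorem restrictPush_comp {F : AbSheaf Y} {F' : AbSheaf Y'} (r : F ⟶ (push h').obj F') :
    (restrictPush w hh hh' hr F ≫ (push a').map ((openRestrict hh').map r ≫ openCounit hh' F')) ≫
      (openUnit hh).app ((push a').obj F') =
    (openRestrict hh).map ((push a).map r ≫ pushSquare w F') := by
  apply Sheaf.hom_ext
  ext U : 2
  have h1 := r.hom.naturality (eqToHom (functor_obj_map w hh hh' hr U.unop)).op
  refine (Category.assoc _ _ _).trans ?_
  refine (congrArg (F.obj.map (eqToHom (functor_obj_map w hh hh' hr U.unop)).op ≫ ·)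
    (Category.assoc (r.hom.app _) (F'.obj.map _) (F'.obj.map _))).trans ?_
  refine (Category.assoc _ _ _).symm.trans ?_
  refine (congrArg (· ≫ F'.obj.map _ ≫ F'.obj.map _) h1).trans ?_
  refine (Category.assoc _ _ _).trans ?_
  refine congrArg (r.hom.app _ ≫ ·) ?_
  refine (congrArg (F'.obj.map _ ≫ ·) (F'.obj.map_comp _ _).symm).trans ?_
  exact (F'.obj.map_comp _ _).symm

/-- The morphism `h'⁻¹ K ⟶ K'` adjoint to a morphism `K ⟶ h'_* K'`. -/
def openAdjunct {K : CochainComplex (AbSheaf Y) ℕ} {K' : CochainComplex (AbSheaf Y') ℕ}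
    (r : K ⟶ ((push h').mapHomologicalComplex (.up ℕ)).obj K') :
    ((openRestrict hh').mapHomologicalComplex (.up ℕ)).obj K ⟶ K' where
  f n := (openRestrict hh').map (r.f n) ≫ openCounit hh' (K'.X n)
  comm' i j _ := by
    have h1 := ((openRestrict hh').map_comp _ _).symm.trans
      ((congrArg (openRestrict hh').map (r.comm i j)).trans ((openRestrict hh').map_comp _ _))
    have h2 := openCounit_naturality hh' (K'.d i j)
    refine (Category.assoc _ _ _).trans ?_
    refine (congrArg (_ ≫ ·) h2.symm).trans ?_
    refine (Category.assoc _ _ _).symm.trans ?_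
    exact (congrArg (· ≫ _) h1).trans (Category.assoc _ _ _)

/-- The isomorphism of complexes `h⁻¹ a_* K ⟶ a'_* h'⁻¹ K`. -/
def restrictPushComplex (K : CochainComplex (AbSheaf Y) ℕ) :
    ((openRestrict hh).mapHomologicalComplex (.up ℕ)).obj
      (((push a).mapHomologicalComplex (.up ℕ)).obj K) ⟶
        ((push a').mapHomologicalComplex (.up ℕ)).obj
          (((openRestrict hh').mapHomologicalComplex (.up ℕ)).obj K) where
  f n := restrictPush w hh hh' hr (K.X n)
  comm' i j _ := (restrictPush_naturality w hh hh' hr (K.d i j)).symm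

theorem isIso_restrictPushComplex (K : CochainComplex (AbSheaf Y) ℕ) :
    IsIso (restrictPushComplex w hh hh' hr K) := by
  have (n : ℕ) : IsIso ((restrictPushComplex w hh hh' hr K).f n) :=
    isIso_restrictPush w hh hh' hr (K.X n)
  exact HomologicalComplex.Hom.isIso_of_components _

-- The restriction of an injective resolution of `F` to `Y'` is an injective resolution of `h'⁻¹ F`,
-- and the adjoint of `resolutionHom` extends the isomorphism `h'⁻¹ F ⟶ F'` adjoint to `φ`.
omit w hr in
theorem isIso_homologyMap_openAdjunct {F : AbSheaf Y} {F' : AbSheaf Y'}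
    (φ : F ⟶ (push h').obj F') [IsIso ((openRestrict hh').map φ)] (q : ℕ) :
    IsIso (HomologicalComplex.homologyMap (((push a').mapHomologicalComplex (.up ℕ)).map
      (openAdjunct hh' (resolutionHom h' φ))) q) := by
  refine isIso_homologyMap_of_augmentation
    (mapResolution (openRestrict hh') (fun I _ => inferInstance) (injectiveResolution F))
    (injectiveResolution F')
    ((openRestrict hh').map φ ≫ openCounit hh' F') (openAdjunct hh' (resolutionHom h' φ)) ?_
    (push a') q
  rw [augmentation_mapResolution]
  have h1 := ((openRestrict hh').map_comp _ _).symm.trans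
    ((congrArg (openRestrict hh').map (augmentation_resolutionHom h' φ)).trans
      ((openRestrict hh').map_comp _ _))
  refine (Category.assoc _ _ _).symm.trans ((congrArg (· ≫ _) h1).trans ?_)
  refine (Category.assoc _ _ _).trans ((congrArg (_ ≫ ·) (openCounit_naturality hh' _)).trans ?_)
  exact (Category.assoc _ _ _).symm

/-- After restriction to `T'` the map of complexes becomes `h⁻¹ a_* K ≅ a'_* h'⁻¹ K ⟶ a'_* K'`, and
the second arrow induces an isomorphism in degree `q` by `hv`. Exactness of `h⁻¹` moves it past
cohomology. -/
theorem isIso_openRestrict_homologyMap {K : CochainComplex (AbSheaf Y) ℕ}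
    {K' : CochainComplex (AbSheaf Y') ℕ}
    (r : K ⟶ ((push h').mapHomologicalComplex (.up ℕ)).obj K') (q : ℕ)
    (hv : IsIso (HomologicalComplex.homologyMap
      (((push a').mapHomologicalComplex (.up ℕ)).map (openAdjunct hh' r)) q)) :
    IsIso ((openRestrict hh).map ((ComplexHom.precomp
      (((push a).mapHomologicalComplex (.up ℕ)).map r) (directImageComplexHom w K')).homologyMap
        q)) := by
  have := isIso_restrictPushComplex w hh hh' hr K
  have hu : IsIso (HomologicalComplex.homologyMap (restrictPushComplex w hh hh' hr K ≫
      ((push a').mapHomologicalComplex (.up ℕ)).map (openAdjunct hh' r)) q) := by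
    rw [HomologicalComplex.homologyMap_comp]
    infer_instance
  have hc (n : ℕ) := restrictPush_comp w hh hh' hr (r.f n)
  exact ComplexHom.isIso_map_homologyMap (openUnit hh)
    (ComplexHom.precomp (((push a).mapHomologicalComplex (.up ℕ)).map r)
      (directImageComplexHom w K')) (restrictPushComplex w hh hh' hr K ≫
      ((push a').mapHomologicalComplex (.up ℕ)).map (openAdjunct hh' r)) hc q

/-- The base change map for an open subset of the base. -/
theorem isIso_openRestrict_baseChange {F : AbSheaf Y} {F' : AbSheaf Y'}
    (φ : F ⟶ (push h').obj F') [IsIso ((openRestrict hh').map φ)] (q : ℕ) :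
    IsIso ((openRestrict hh).map (baseChange w φ q)) := by
  have := isIso_openRestrict_homologyMap w hh hh' hr (resolutionHom h' φ) q
    (isIso_homologyMap_openAdjunct hh' φ q)
  exact isIso_map_comp (openRestrict hh) (push h) _ _ _ this

end OpenBaseChange

end Comparison

/-! ### Cohomology by injective resolutions and the edge morphism to the higher direct images. -/

section Cohomology

/-- Global sections of sheaves of abelian groups. -/
def gammaTop (Y : TopCat.{u}) : AbSheaf Y ⥤ AddCommGrpCat.{u} :=
  sheafToPresheaf _ _ ⋙ (evaluation _ _).obj (op ⊤)

instance (Y : TopCat.{u}) : (gammaTop Y).Additive where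
  map_add := rfl

instance (Y : TopCat.{u}) : PreservesFiniteLimits (gammaTop Y) :=
  comp_preservesFiniteLimits (sheafToPresheaf (Opens.grothendieckTopology Y) AddCommGrpCat.{u})
    ((evaluation (Opens Y)ᵒᵖ AddCommGrpCat.{u}).obj (op ⊤))

/-- The complex of global sections. -/
abbrev gammaComplex {Y : TopCat.{u}} (K : CochainComplex (AbSheaf Y) ℕ) :
    CochainComplex AddCommGrpCat.{u} ℕ :=
  ((gammaTop Y).mapHomologicalComplex (.up ℕ)).obj K

/-- The map induced on global sections by a morphism `K ⟶ π_* K'`. -/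
def gammaMap {X Y : TopCat.{u}} (π : Y ⟶ X) {K : CochainComplex (AbSheaf X) ℕ}
    {K' : CochainComplex (AbSheaf Y) ℕ}
    (u : K ⟶ ((push π).mapHomologicalComplex (.up ℕ)).obj K') :
    gammaComplex K ⟶ gammaComplex K' where
  f n := (u.f n).hom.app (op ⊤)
  comm' i j _ := congrArg (fun m => m.hom.app (op ⊤)) (u.comm i j)

/-- The cohomology `H^q(Y, F)`. -/
def coh {Y : TopCat.{u}} (F : AbSheaf Y) (q : ℕ) : AddCommGrpCat.{u} :=
  (gammaComplex (injectiveResolution F).cocomplex).homology q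

/-- The map `H^q(X, F) ⟶ H^q(Y, F')` induced by `F ⟶ π_* F'`. -/
def cohMap {X Y : TopCat.{u}} (π : Y ⟶ X) {F : AbSheaf X} {F' : AbSheaf Y}
    (φ : F ⟶ (push π).obj F') (q : ℕ) : coh F q ⟶ coh F' q :=
  HomologicalComplex.homologyMap (gammaMap π (resolutionHom π φ)) q

/-- Since `Γ(X, π_* K') = Γ(Y, K')`, the map `gammaMap π u` is `Γ(X, u)`; two extensions of `φ` to
the resolutions are homotopic. Thus `cohMap` may be computed with any extension of `φ`, which gives
its functoriality. -/
theorem homologyMap_gammaMap {X Y : TopCat.{u}} (π : Y ⟶ X) {F : AbSheaf X} {F' : AbSheaf Y}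
    (φ : F ⟶ (push π).obj F') (u : (injectiveResolution F).cocomplex ⟶
      ((push π).mapHomologicalComplex (.up ℕ)).obj (injectiveResolution F').cocomplex)
    (hu : augmentation (injectiveResolution F) ≫ u.f 0 =
      φ ≫ (push π).map (augmentation (injectiveResolution F'))) (q : ℕ) :
    HomologicalComplex.homologyMap (gammaMap π u) q = cohMap π φ q :=
  homologyMap_eq_of_augmentation (injectiveResolution F)
    (((push π).mapHomologicalComplex (.up ℕ)).obj (injectiveResolution F').cocomplex)
    (fun n => inferInstanceAs
      (Injective ((push π).obj ((injectiveResolution F').cocomplex.X n)))) u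
    (resolutionHom π φ) (hu.trans (augmentation_resolutionHom π φ).symm) (gammaTop X) q

theorem cohMap_comp {X Y Z : TopCat.{u}} (π : Y ⟶ X) (ρ : Z ⟶ Y) {F : AbSheaf X} {F' : AbSheaf Y}
    {F'' : AbSheaf Z} (φ : F ⟶ (push π).obj F') (φ' : F' ⟶ (push ρ).obj F'') (q : ℕ) :
    cohMap π φ q ≫ cohMap ρ φ' q =
      cohMap (ρ ≫ π) (F' := F'') (φ ≫ (push π).map φ') q := by
  refine (HomologicalComplex.homologyMap_comp _ _ _).symm.trans ?_
  refine homologyMap_gammaMap (ρ ≫ π) (F' := F'') (φ ≫ (push π).map φ')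
    (resolutionHom π φ ≫ ((push π).mapHomologicalComplex (.up ℕ)).map (resolutionHom ρ φ')) ?_ q
  have h1 := augmentation_resolutionHom π φ
  have h2 := congrArg (push π).map (augmentation_resolutionHom ρ φ')
  refine (Category.assoc _ _ _).symm.trans ((congrArg (· ≫ _) h1).trans ?_)
  refine (Category.assoc _ _ _).trans ?_
  refine Eq.trans ?_ (Category.assoc _ _ _).symm
  refine congrArg (φ ≫ ·) ?_
  exact ((push π).map_comp _ _).symm.trans (h2.trans ((push π).map_comp _ _))

theorem cohMap_congr {X Y : TopCat.{u}} {π ρ : Y ⟶ X} (e : π = ρ) {F : AbSheaf X} {F' : AbSheaf Y}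
    (φ : F ⟶ (push π).obj F') (ψ : F ⟶ (push ρ).obj F') (h : φ ≫ pushCongr e F' = ψ) (q : ℕ) :
    cohMap π φ q = cohMap ρ ψ q := by
  subst e h
  rw [pushCongr_rfl, Category.comp_id]

theorem cohMap_id {X : TopCat.{u}} (F : AbSheaf X) (q : ℕ) :
    cohMap (𝟙 X) ((toPushId X).app F) q = 𝟙 _ := by
  let J := injectiveResolution F
  let c : J.cocomplex ⟶ ((push (𝟙 X)).mapHomologicalComplex (.up ℕ)).obj J.cocomplex :=
    { f n := (toPushId X).app (J.cocomplex.X n)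
      comm' _ _ _ := ((toPushId X).naturality _).symm }
  refine (homologyMap_gammaMap (𝟙 X) ((toPushId X).app F) c
    ((toPushId X).naturality (augmentation J)) q).symm.trans ?_
  have : gammaMap (𝟙 X) c = 𝟙 _ := by
    ext n : 1
    exact (J.cocomplex.X n).obj.map_id _
  rw [this]
  exact HomologicalComplex.homologyMap_id _ _

/-- The tautological map `Γ(Y, K) ⟶ Γ(T, a_* K)`. -/
def edgeComplexHom {Y T : TopCat.{u}} (a : Y ⟶ T) (K : CochainComplex (AbSheaf Y) ℕ) :
    ComplexHom (gammaTop T) (gammaComplex K) (((push a).mapHomologicalComplex (.up ℕ)).obj K) where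
  f n := 𝟙 ((gammaTop Y).obj (K.X n))
  comm i j := (Category.id_comp ((gammaTop Y).map (K.d i j))).trans (Category.comp_id _).symm

/-- The edge morphism `H^q(Y, F) ⟶ Γ(T, R^q a_* F)`. -/
def edge {Y T : TopCat.{u}} (a : Y ⟶ T) (F : AbSheaf Y) (q : ℕ) :
    coh F q ⟶ (gammaTop T).obj ((higherDirectImage a q).obj F) :=
  (edgeComplexHom a (injectiveResolution F).cocomplex).homologyMap q ≫
    (gammaTop T).map ((injectiveResolution F).isoRightDerivedObj (push a) q).inv

/-- The edge morphisms are compatible with base change. -/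
theorem cohMap_edge {Y Y' T T' : TopCat.{u}} {h' : Y' ⟶ Y} {a : Y ⟶ T} {a' : Y' ⟶ T'} {h : T' ⟶ T}
    (w : h' ≫ a = a' ≫ h) {F : AbSheaf Y} {F' : AbSheaf Y'} (φ : F ⟶ (push h').obj F') (q : ℕ) :
    cohMap h' φ q ≫ edge a' F' q = edge a F q ≫ (baseChange w φ q).hom.app (op ⊤) := by
  let θ := ComplexHom.precomp (((push a).mapHomologicalComplex (.up ℕ)).map (resolutionHom h' φ))
      (directImageComplexHom w (injectiveResolution F').cocomplex)
  have h1 := (edgeComplexHom a (injectiveResolution F).cocomplex).homologyMap_comp q θ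
  have h2 : (edgeComplexHom a (injectiveResolution F).cocomplex).comp θ =
      ComplexHom.precomp (gammaMap h' (resolutionHom h' φ))
        (edgeComplexHom a' (injectiveResolution F').cocomplex) := by
    ext n : 2
    refine (Category.id_comp _).trans ?_
    refine (congrArg (((resolutionHom h' φ).f n).hom.app (op ⊤) ≫ ·)
      (((injectiveResolution F').cocomplex.X n).obj.map_id (op ⊤)))
  have h3 := ((edgeComplexHom a' (injectiveResolution F').cocomplex).homologyMap_precomp q
    (gammaMap h' (resolutionHom h' φ))).symm.trans
      ((congrArg (fun η => ComplexHom.homologyMap η q) h2.symm).trans h1)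
  refine Eq.trans ?_ (comp_map_comp_aux (gammaTop T)
    ((edgeComplexHom a (injectiveResolution F).cocomplex).homologyMap q) (𝟙 _)
    ((injectiveResolution F).isoRightDerivedObj (push a) q) (θ.homologyMap q)
    ((push h).map ((injectiveResolution F').isoRightDerivedObj (push a') q).inv)).symm
  refine (Category.assoc _ _ _).symm.trans ((congrArg (· ≫ _) h3).trans ?_)
  exact Category.assoc _ _ _

end Cohomology

/-! ### Acyclicity of direct images. -/

section Pushforward

variable {X Y : TopCat.{u}} (π : Y ⟶ X) {F' : AbSheaf Y}

theorem push_augmentation_d (J : InjectiveResolution F') :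
    (push π).map (augmentation J) ≫ (push π).map (J.cocomplex.d 0 1) = 0 := by
  rw [← (push π).map_comp, augmentation_d, (push π).map_zero]

theorem push_exact_zero (J : InjectiveResolution F') :
    (ShortComplex.mk ((push π).map (augmentation J)) ((push π).map (J.cocomplex.d 0 1))
      (push_augmentation_d π J)).Exact := by
  refine exact_of_exists_local_lift ?_
  intro U s hs x hx
  obtain ⟨t, ht⟩ := SplittingBasis.exists_d_zero_lift J (U := (Opens.map π).obj U) s hs
  exact ⟨U, le_rfl, hx, t, ht.trans (resHom_self _ _ _).symm⟩

/-- The cohomology sheaves of `π_* J` are the higher direct images. They vanish because every point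
of `X` has arbitrarily small neighbourhoods whose inverse images lie in the basis, where cocycles of
positive degree are coboundaries. -/
theorem push_exactAt (J : InjectiveResolution F') {B : SplittingBasis Y} (hB : B.Splits F')
    (hπ : ∀ (U : Opens X), ∀ x ∈ U, ∃ W ≤ U, x ∈ W ∧ (Opens.map π).obj W ∈ B.opens) (n : ℕ) :
    (((push π).mapHomologicalComplex (.up ℕ)).obj J.cocomplex).ExactAt (n + 1) := by
  rw [HomologicalComplex.exactAt_iff' _ n (n + 1) (n + 2) (by simp)
      (by simp only [CochainComplex.next]; rfl)]
  refine exact_of_exists_local_lift ?_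
  intro U s hs x hx
  obtain ⟨W, hW, hxW, hWB⟩ := hπ U x hx
  have hW' : (Opens.map π).obj W ≤ (Opens.map π).obj U := (Opens.map π).monotone hW
  obtain ⟨y, hy⟩ := SplittingBasis.exists_primitive J hB n hWB
    (resHom (J.cocomplex.X (n + 1)) hW' s)
    ((secHom_resHom (J.cocomplex.d (n + 1) (n + 2)) hW' s).trans
      ((congrArg (resHom (J.cocomplex.X (n + 2)) hW') hs).trans (map_zero _)))
  exact ⟨W, hW, hxW, y, hy⟩

/-- A direct image is acyclic for a sheaf which splits over the inverse images of small open
sets. -/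
theorem isIso_cohMap {F : AbSheaf X} {B : SplittingBasis Y} (hB : B.Splits F')
    (hπ : ∀ (U : Opens X), ∀ x ∈ U, ∃ W ≤ U, x ∈ W ∧ (Opens.map π).obj W ∈ B.opens)
    (φ : F ⟶ (push π).obj F') (hφ : IsIso φ) (q : ℕ) : IsIso (cohMap π φ q) := by
  -- The direct image of the resolution of `F'` is an injective resolution of `π_* F' ≅ F`, and its
  -- global sections on `X` are those of the original complex on `Y`.
  have h := isIso_homologyMap_of_exact (injectiveResolution F)
    (((push π).mapHomologicalComplex (.up ℕ)).obj (injectiveResolution F').cocomplex)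
    (fun n => inferInstanceAs
      (Injective ((push π).obj ((injectiveResolution F').cocomplex.X n))))
    ((push π).map (augmentation (injectiveResolution F')))
    (inferInstanceAs (Mono ((push π).map (augmentation (injectiveResolution F')))))
    (push_augmentation_d π _) (push_exact_zero π _) (push_exactAt π _ hB hπ) φ
    (resolutionHom π φ) (augmentation_resolutionHom π φ) (gammaTop X) q
  exact h

end Pushforward

/-! ### Representing cocycles and the local behaviour of the edge morphism. -/

section Classes

variable {T : TopCat.{u}}

/-- The section `s` of the cohomology sheaf is the class of the cocycle `z`. -/
def IsClass (M : CochainComplex (AbSheaf T) ℕ) (q : ℕ) (V : Opens T) (z : (M.X q).obj.obj (op V))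
    (s : (M.homology q).obj.obj (op V)) : Prop :=
  ∃ c : (M.cycles q).obj.obj (op V), secHom (M.iCycles q) V c = z ∧ secHom (M.homologyπ q) V c = s

theorem IsClass.unique {M : CochainComplex (AbSheaf T) ℕ} {q : ℕ} {V : Opens T}
    {z : (M.X q).obj.obj (op V)} {s s' : (M.homology q).obj.obj (op V)} (h : IsClass M q V z s)
    (h' : IsClass M q V z s') : s = s' := by
  obtain ⟨c, hc, rfl⟩ := h
  obtain ⟨c', hc', rfl⟩ := h'
  rw [secHom_injective (M.iCycles q) V (hc.trans hc'.symm)]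

theorem IsClass.d_eq_zero {M : CochainComplex (AbSheaf T) ℕ} {q : ℕ} {V : Opens T}
    {z : (M.X q).obj.obj (op V)} {s : (M.homology q).obj.obj (op V)} (h : IsClass M q V z s)
    (j : ℕ) : secHom (M.d q j) V z = 0 := by
  obtain ⟨c, rfl, rfl⟩ := h
  rw [← secHom_comp, HomologicalComplex.iCycles_d, secHom_zero]

theorem IsClass.res {M : CochainComplex (AbSheaf T) ℕ} {q : ℕ} {V W : Opens T} (hW : W ≤ V)
    {z : (M.X q).obj.obj (op V)} {s : (M.homology q).obj.obj (op V)} (h : IsClass M q V z s) :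
    IsClass M q W (resHom _ hW z) (resHom _ hW s) := by
  obtain ⟨c, rfl, rfl⟩ := h
  exact ⟨resHom _ hW c, secHom_resHom _ _ _, secHom_resHom _ _ _⟩

theorem exists_isClass (M : CochainComplex (AbSheaf T) ℕ) (q : ℕ) {V : Opens T}
    (s : (M.homology q).obj.obj (op V)) (x : T) (hx : x ∈ V) :
    ∃ (W : Opens T) (hW : W ≤ V), x ∈ W ∧ ∃ z, IsClass M q W z (resHom _ hW s) := by
  obtain ⟨W, hW, hxW, c, hc⟩ := exists_local_lift_of_epi (M.homologyπ q) s x hx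
  exact ⟨W, hW, hxW, _, c, rfl, hc⟩

theorem IsClass.exists_primitive {M : CochainComplex (AbSheaf T) ℕ} {q : ℕ} {V : Opens T}
    {z : (M.X q).obj.obj (op V)} (h : IsClass M q V z 0) (x : T) (hx : x ∈ V) :
    ∃ (W : Opens T) (hW : W ≤ V), x ∈ W ∧
      ∃ y, secHom (M.d ((ComplexShape.up ℕ).prev q) q) W y = resHom _ hW z := by
  obtain ⟨c, rfl, hc⟩ := h
  obtain ⟨W, hW, hxW, y, hy⟩ := exists_local_lift_of_exact
    (ShortComplex.exact_of_g_is_cokernel (ShortComplex.mk (M.toCycles _ q) (M.homologyπ q)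
      (M.toCycles_comp_homologyπ _ q)) (M.homologyIsCokernel _ q rfl)) c hc x hx
  refine ⟨W, hW, hxW, y, ?_⟩
  have := M.toCycles_i ((ComplexShape.up ℕ).prev q) q
  rw [← this, secHom_comp, ← secHom_resHom]
  exact congrArg _ hy

theorem IsClass.map {T' : TopCat.{u}} {h : T' ⟶ T} {M : CochainComplex (AbSheaf T) ℕ}
    {K : CochainComplex (AbSheaf T') ℕ} (θ : ComplexHom (push h) M K) {q : ℕ} {V : Opens T}
    {z : (M.X q).obj.obj (op V)} {s : (M.homology q).obj.obj (op V)} (hz : IsClass M q V z s) :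
    IsClass K q ((Opens.map h).obj V) (secHom (θ.f q) V z) (secHom (θ.homologyMap q) V s) := by
  obtain ⟨c, rfl, rfl⟩ := hz
  refine ⟨secHom (θ.cyclesMap q) V c, ?_, ?_⟩
  · exact (secHom_comp (θ.cyclesMap q) ((push h).map (K.iCycles q)) V c).symm.trans
      (congrArg (fun k => secHom k V c) (θ.cyclesMap_i q))
  · exact (secHom_comp (θ.cyclesMap q) ((push h).map (K.homologyπ q)) V c).symm.trans
      (congrArg (fun k => secHom k V c) (θ.homologyπ_homologyMap q).symm)

/-- The element `c` of the cohomology group is the class of the cocycle `z`. -/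
def IsGroupClass (M : CochainComplex AddCommGrpCat.{u} ℕ) (q : ℕ) (z : M.X q) (s : M.homology q) :
    Prop :=
  ∃ c : M.cycles q, M.iCycles q c = z ∧ M.homologyπ q c = s

theorem exists_isGroupClass (M : CochainComplex AddCommGrpCat.{u} ℕ) (q : ℕ) (s : M.homology q) :
    ∃ z, IsGroupClass M q z s := by
  obtain ⟨c, hc⟩ := (AddCommGrpCat.epi_iff_surjective (M.homologyπ q)).mp inferInstance s
  exact ⟨_, c, rfl, hc⟩

theorem IsGroupClass.exists_of_d_eq_zero (M : CochainComplex AddCommGrpCat.{u} ℕ) (q : ℕ)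
    (z : M.X q) (hz : M.d q ((ComplexShape.up ℕ).next q) z = 0) : ∃ s, IsGroupClass M q z s := by
  have he : (ShortComplex.mk (M.iCycles q) (M.d q ((ComplexShape.up ℕ).next q))
      (M.iCycles_d _ _)).Exact := ShortComplex.exact_of_f_is_kernel _ (M.cyclesIsKernel q _ rfl)
  obtain ⟨c, hc⟩ := (ShortComplex.ab_exact_iff _).mp he z hz
  exact ⟨_, c, hc, rfl⟩

theorem IsGroupClass.eq_zero {M : CochainComplex AddCommGrpCat.{u} ℕ} {q : ℕ} {s : M.homology q}
    {z : M.X q} (h : IsGroupClass M q z s) {p : ℕ} (y : M.X p) (hy : M.d p q y = z) : s = 0 := by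
  obtain ⟨c, rfl, rfl⟩ := h
  have : M.toCycles p q y = c := by
    apply (AddCommGrpCat.mono_iff_injective (M.iCycles q)).mp inferInstance
    rw [← ConcreteCategory.comp_apply, M.toCycles_i, hy]
  rw [← this, ← ConcreteCategory.comp_apply, M.toCycles_comp_homologyπ]
  rfl

theorem IsGroupClass.map {M K : CochainComplex AddCommGrpCat.{u} ℕ} (u : M ⟶ K) {q : ℕ}
    {z : M.X q} {s : M.homology q} (hz : IsGroupClass M q z s) :
    IsGroupClass K q (u.f q z) (HomologicalComplex.homologyMap u q s) := by
  obtain ⟨c, rfl, rfl⟩ := hz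
  refine ⟨HomologicalComplex.cyclesMap u q c, ?_, ?_⟩
  · rw [← ConcreteCategory.comp_apply, HomologicalComplex.cyclesMap_i, ConcreteCategory.comp_apply]
  · rw [← ConcreteCategory.comp_apply, ← HomologicalComplex.homologyπ_naturality,
      ConcreteCategory.comp_apply]

theorem IsGroupClass.isClass {Y T : TopCat.{u}} (a : Y ⟶ T) (K : CochainComplex (AbSheaf Y) ℕ)
    {q : ℕ} {z : (gammaComplex K).X q} {s : (gammaComplex K).homology q}
    (hz : IsGroupClass (gammaComplex K) q z s) :
    IsClass (((push a).mapHomologicalComplex (.up ℕ)).obj K) q ⊤ z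
      ((edgeComplexHom a K).homologyMap q s) := by
  obtain ⟨c, rfl, rfl⟩ := hz
  refine ⟨(edgeComplexHom a K).cyclesMap q c, ?_, ?_⟩
  · exact ConcreteCategory.congr_hom ((edgeComplexHom a K).cyclesMap_i q) c
  · exact (ConcreteCategory.congr_hom ((edgeComplexHom a K).homologyπ_homologyMap q) c).symm

theorem edge_eq_zero_iff {Y T : TopCat.{u}} (a : Y ⟶ T) (F : AbSheaf Y) (q : ℕ) (c : coh F q) :
    edge a F q c = 0 ↔
      (edgeComplexHom a (injectiveResolution F).cocomplex).homologyMap q c = 0 := by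
  constructor
  · intro h
    have h1 := congrArg ((gammaTop T).map
      ((injectiveResolution F).isoRightDerivedObj (push a) q).hom) h
    rw [map_zero] at h1
    refine Eq.trans ?_ h1
    exact (ConcreteCategory.congr_hom ((gammaTop T).mapIso
      ((injectiveResolution F).isoRightDerivedObj (push a) q)).inv_hom_id _).symm
  · intro h
    exact (congrArg ((gammaTop T).map
      ((injectiveResolution F).isoRightDerivedObj (push a) q).inv) h).trans (map_zero _)

/-- A class in the kernel of the edge morphism vanishes locally on the base. -/
theorem exists_open_cohMap_eq_zero {Y T : TopCat.{u}} (a : Y ⟶ T) (F : AbSheaf Y) (q : ℕ)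
    (c : coh F q) (hc : edge a F q c = 0) (t : T) :
    ∃ V : Opens T, t ∈ V ∧ ∀ {Y' : TopCat.{u}} (h' : Y' ⟶ Y) (_ : ∀ y, a (h' y) ∈ V)
      {F' : AbSheaf Y'} (φ : F ⟶ (push h').obj F'), cohMap h' φ q c = 0 := by
  obtain ⟨z, hz⟩ := exists_isGroupClass _ q c
  have hz' := hz.isClass a (injectiveResolution F).cocomplex
  rw [(edge_eq_zero_iff a F q c).mp hc] at hz'
  -- Over `V` the cocycle has a primitive on `a⁻¹(V)`. Pulled back along any map with image in
  -- `a⁻¹(V)` this becomes a primitive on the whole source.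
  obtain ⟨V, hV, htV, y, hy⟩ := hz'.exists_primitive t trivial
  refine ⟨V, htV, fun {Y'} h' hh' {F'} φ => ?_⟩
  have hle : (⊤ : Opens Y') ≤ (Opens.map h').obj ((Opens.map a).obj V) := fun y _ => hh' y
  let u := resolutionHom h' φ
  refine (hz.map (gammaMap h' u)).eq_zero (p := (ComplexShape.up ℕ).prev q)
    (resHom ((injectiveResolution F').cocomplex.X _) hle
      (secHom (u.f ((ComplexShape.up ℕ).prev q)) ((Opens.map a).obj V) y)) ?_
  let I' := (injectiveResolution F').cocomplex
  refine (secHom_resHom (I'.d ((ComplexShape.up ℕ).prev q) q) hle _).trans ?_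
  have h1 := congrArg (fun k => secHom k ((Opens.map a).obj V) y)
    (u.comm ((ComplexShape.up ℕ).prev q) q)
  refine (congrArg (resHom (I'.X q) hle) (h1.trans (congrArg (secHom (u.f q) _) hy))).trans ?_
  refine (congrArg (resHom (I'.X q) hle) (secHom_resHom (u.f q)
    ((Opens.map a).monotone hV) z)).trans ?_
  exact (resHom_resHom (I'.X q) _ hle _).trans (resHom_self (I'.X q) _ _)

/-- Sections of a higher direct image come from cohomology classes locally on the base. -/
theorem exists_open_edge_eq {Y T : TopCat.{u}} (a : Y ⟶ T) (F : AbSheaf Y) (q : ℕ)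
    (s : ((higherDirectImage a q).obj F).obj.obj (op ⊤)) (t : T) :
    ∃ V : Opens T, t ∈ V ∧ ∀ {Y' T' : TopCat.{u}} {h' : Y' ⟶ Y} {a' : Y' ⟶ T'} {h : T' ⟶ T}
      (w : h' ≫ a = a' ≫ h) (_ : ∀ t', h t' ∈ V) {F' : AbSheaf Y'} (φ : F ⟶ (push h').obj F'),
      ∃ c, edge a' F' q c = (baseChange w φ q).hom.app (op ⊤) s := by
  let M := ((push a).mapHomologicalComplex (.up ℕ)).obj (injectiveResolution F).cocomplex
  let s₀ : (M.homology q).obj.obj (op ⊤) :=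
    secHom ((injectiveResolution F).isoRightDerivedObj (push a) q).hom ⊤ s
  -- Over `V` the section is the class of a cocycle on `a⁻¹(V)`. Its pull-back to `Y'` is a global
  -- cocycle, and the class of that is the required `c`.
  obtain ⟨V, hV, htV, z, hz⟩ := exists_isClass M q s₀ t trivial
  refine ⟨V, htV, fun {Y' T' h' a' h} w hh {F'} φ => ?_⟩
  let θ := ComplexHom.precomp (((push a).mapHomologicalComplex (.up ℕ)).map (resolutionHom h' φ))
      (directImageComplexHom w (injectiveResolution F').cocomplex)
  have hle : (⊤ : Opens T') ≤ (Opens.map h).obj V := fun y _ => hh y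
  let M' := ((push a').mapHomologicalComplex (.up ℕ)).obj (injectiveResolution F').cocomplex
  let z' : (M'.X q).obj.obj (op ⊤) := resHom (M'.X q) hle (secHom (θ.f q) V z)
  have hz' : IsClass M' q ⊤ z' _ := (hz.map θ).res hle
  obtain ⟨c, hc⟩ := IsGroupClass.exists_of_d_eq_zero
    (gammaComplex (injectiveResolution F').cocomplex) q z' (hz'.d_eq_zero _)
  refine ⟨c, ?_⟩
  have h1 := (hc.isClass a' _).unique hz'
  have h2 : resHom (M'.homology q) hle (secHom (θ.homologyMap q) V (resHom (M.homology q) hV s₀)) =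
      secHom (θ.homologyMap q) ⊤ s₀ := by
    refine (congrArg (resHom (M'.homology q) hle) (secHom_resHom (θ.homologyMap q) hV s₀)).trans ?_
    exact (resHom_resHom (M'.homology q) _ hle _).trans (resHom_self (M'.homology q) _ _)
  exact congrArg (secHom ((injectiveResolution F').isoRightDerivedObj (push a') q).inv ⊤)
    (h1.trans h2)

end Classes

/-! ### Comparison with cohomology defined by Ext groups. -/

section FunctorH

open Abelian

/-- A representative of the zero class is a coboundary coming from degree `-1`, where the resolution
vanishes. -/
theorem extMk_injective_zero {C : Type*} [Category* C] [Abelian C] [HasExt C] {X Y : C}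
    (J : InjectiveResolution Y) (f : X ⟶ J.cocomplex.X 0) (hf : f ≫ J.cocomplex.d 0 1 = 0)
    (h : J.extMk f 1 rfl hf = 0) : f = 0 := by
  rw [← J.extEquivCohomologyClass.apply_eq_iff_eq,
    InjectiveResolution.extEquivCohomologyClass_extMk,
    InjectiveResolution.extEquivCohomologyClass_zero,
    CochainComplex.HomComplex.CohomologyClass.mk_eq_zero_iff,
    CochainComplex.HomComplex.Cocycle.fromSingleMk_mem_coboundaries_iff _ _ _ _ _ (-1) (by lia)]
    at h
  obtain ⟨g, hg⟩ := h
  have hz : IsZero (J.cochainComplex.X (-1)) :=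
    J.cochainComplex.isZero_of_isStrictlyGE 0 (-1) (by lia)
  rw [hz.eq_of_tgt g 0, zero_comp] at hg
  rw [← cancel_mono (J.cochainComplexXIso (0 : ℕ) 0 rfl).inv, zero_comp]
  exact hg.symm

universe w

variable {C : Type*} [Category* C] [Abelian C] [HasExt.{w} C] {Z : C} (Γ : C ⥤ AddCommGrpCat.{w})
  [Γ.Additive] (e : ∀ F, (Z ⟶ F) ≃+ Γ.obj F)
  (he : ∀ {F G : C} (a : Z ⟶ F) (m : F ⟶ G), e G (a ≫ m) = Γ.map m (e F a))
  {F : C} (J : InjectiveResolution F) (q : ℕ)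
include he

omit [HasExt C] [Γ.Additive] in
theorem symm_comp_eq {F G : C} (s : Γ.obj F) (m : F ⟶ G) :
    (e F).symm s ≫ m = (e G).symm (Γ.map m s) := by
  apply (e G).injective
  rw [he, AddEquiv.apply_symm_apply, AddEquiv.apply_symm_apply]

omit [HasExt C] in
theorem cycle_comp_d (c : ((Γ.mapHomologicalComplex (.up ℕ)).obj J.cocomplex).cycles q) :
    (e (J.cocomplex.X q)).symm
      (((Γ.mapHomologicalComplex (.up ℕ)).obj J.cocomplex).iCycles q c) ≫
        J.cocomplex.d q (q + 1) = 0 := by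
  refine (symm_comp_eq Γ e he _ _).trans ?_
  have := ConcreteCategory.congr_hom
    (((Γ.mapHomologicalComplex (.up ℕ)).obj J.cocomplex).iCycles_d q (q + 1)) c
  exact (congrArg (e _).symm this).trans (map_zero _)

/-- The element of `Ext^q(Z, F)` given by a cocycle. -/
def cyclesToExt : ((Γ.mapHomologicalComplex (.up ℕ)).obj J.cocomplex).cycles q ⟶
      AddCommGrpCat.of (Ext Z F q) :=
  AddCommGrpCat.ofHom (AddMonoidHom.mk'
    (fun c => J.extMk _ (q + 1) rfl (cycle_comp_d Γ e he J q c)) (by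
      intro c c'
      refine Eq.trans ?_ (J.add_extMk _ _ _ _ _ _).symm
      congr 1
      refine (congrArg (e _).symm (map_add _ c c')).trans (map_add _ _ _)))

theorem toCycles_cyclesToExt :
    ((Γ.mapHomologicalComplex (.up ℕ)).obj J.cocomplex).toCycles ((ComplexShape.up ℕ).prev q) q ≫
      cyclesToExt Γ e he J q = 0 := by
  let K := (Γ.mapHomologicalComplex (.up ℕ)).obj J.cocomplex
  ext y
  have hy : K.iCycles q (K.toCycles ((ComplexShape.up ℕ).prev q) q y) = K.d _ q y := by
    rw [← ConcreteCategory.comp_apply, K.toCycles_i]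
  cases q with
  | zero =>
    -- No natural number precedes `0`, so whatever value `prev 0` takes, the differential arriving
    -- in degree `0` is zero.
    have h0 : K.d ((ComplexShape.up ℕ).prev 0) 0 = 0 := K.shape _ _ (by simp)
    rw [h0] at hy
    have hy' : K.toCycles ((ComplexShape.up ℕ).prev 0) 0 y = 0 := by
      apply (AddCommGrpCat.mono_iff_injective (K.iCycles 0)).mp inferInstance
      exact hy.trans (map_zero (K.iCycles 0).hom).symm
    exact (congrArg (cyclesToExt Γ e he J 0) hy').trans (map_zero (cyclesToExt Γ e he J 0).hom)
  | succ q =>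
    have hp : (ComplexShape.up ℕ).prev (q + 1) = q := by simp
    revert y hy
    rw [hp]
    intro y hy
    refine (J.extMk_eq_zero_iff _ (q + 1 + 1) rfl
      (cycle_comp_d Γ e he J (q + 1) (K.toCycles q (q + 1) y)) q rfl).mpr ⟨(e _).symm y, ?_⟩
    refine (symm_comp_eq Γ e he _ _).trans ?_
    exact congrArg (e _).symm hy.symm

/-- The comparison map from the cohomology of an injective resolution to `Ext^q(Z, F)`. -/
def homologyToExt : ((Γ.mapHomologicalComplex (.up ℕ)).obj J.cocomplex).homology q ⟶
    AddCommGrpCat.of (Ext Z F q) :=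
  (((Γ.mapHomologicalComplex (.up ℕ)).obj J.cocomplex).homologyIsCokernel _ q rfl).desc
    (CokernelCofork.ofπ (cyclesToExt Γ e he J q) (toCycles_cyclesToExt Γ e he J q))

theorem homologyπ_homologyToExt :
    ((Γ.mapHomologicalComplex (.up ℕ)).obj J.cocomplex).homologyπ q ≫ homologyToExt Γ e he J q =
      cyclesToExt Γ e he J q :=
  (((Γ.mapHomologicalComplex (.up ℕ)).obj J.cocomplex).homologyIsCokernel _ q rfl).fac _
    WalkingParallelPair.one

variable {Γ J q} in
omit [HasExt C] in
theorem IsGroupClass.symm_comp_d {z : ((Γ.mapHomologicalComplex (.up ℕ)).obj J.cocomplex).X q}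
    {s : ((Γ.mapHomologicalComplex (.up ℕ)).obj J.cocomplex).homology q}
    (h : IsGroupClass _ q z s) :
    (e (J.cocomplex.X q)).symm z ≫ J.cocomplex.d q (q + 1) = 0 := by
  obtain ⟨c, rfl, rfl⟩ := h
  exact cycle_comp_d Γ e he J q c

variable {Γ J q} in
theorem homologyToExt_apply {z : ((Γ.mapHomologicalComplex (.up ℕ)).obj J.cocomplex).X q}
    {s : ((Γ.mapHomologicalComplex (.up ℕ)).obj J.cocomplex).homology q}
    (h : IsGroupClass _ q z s) :
    homologyToExt Γ e he J q s = J.extMk ((e (J.cocomplex.X q)).symm z) (q + 1) rfl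
      (h.symm_comp_d e he) := by
  obtain ⟨c, rfl, rfl⟩ := h
  exact ConcreteCategory.congr_hom (homologyπ_homologyToExt Γ e he J q) c

/-- Under `e`, cocycles of `Γ(J)` are morphisms `Z ⟶ J^q` killed by the differential and
coboundaries are those factoring through `J^(q-1)`, which is how the resolution computes `Ext^q(Z,
F)`. Degree `0` has no coboundaries and is treated separately. -/
theorem bijective_homologyToExt : Function.Bijective (homologyToExt Γ e he J q) := by
  constructor
  · rw [injective_iff_map_eq_zero]
    intro s hs
    obtain ⟨z, hz⟩ := exists_isGroupClass _ q s
    rw [homologyToExt_apply e he hz] at hs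
    cases q with
    | zero =>
      have h0 := extMk_injective_zero _ _ _ hs
      have : z = 0 := (e (J.cocomplex.X 0)).symm.injective (h0.trans (map_zero _).symm)
      refine hz.eq_zero (p := 0) (0 : ((Γ.mapHomologicalComplex (.up ℕ)).obj J.cocomplex).X 0) ?_
      rw [this]
      exact map_zero _
    | succ q =>
      obtain ⟨g, hg⟩ := (J.extMk_eq_zero_iff _ _ _ _ q rfl).mp hs
      refine hz.eq_zero (p := q) (e _ g) ?_
      refine (he g (J.cocomplex.d q (q + 1))).symm.trans ?_
      rw [hg]
      exact AddEquiv.apply_symm_apply _ _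
  · intro x
    obtain ⟨g, hg, rfl⟩ := J.extMk_surjective x (q + 1) rfl
    obtain ⟨s, hs⟩ := IsGroupClass.exists_of_d_eq_zero
      ((Γ.mapHomologicalComplex (.up ℕ)).obj J.cocomplex) q (e _ g) (by
        have h1 : (ComplexShape.up ℕ).next q = q + 1 := by simp
        rw [h1]
        refine (he g (J.cocomplex.d q (q + 1))).symm.trans ?_
        rw [hg]
        exact map_zero _)
    refine ⟨s, (homologyToExt_apply e he hs).trans ?_⟩
    congr 1
    exact AddEquiv.symm_apply_apply _ _

-- On representatives both sides are composition of `Z ⟶ J^q` with the component `φ^q` of a lift of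
-- `m`.
variable {J} in
theorem homologyToExt_naturality {G : C} {J' : InjectiveResolution G} {m : F ⟶ G}
    (φ : InjectiveResolution.Hom J J' m)
    (s : ((Γ.mapHomologicalComplex (.up ℕ)).obj J.cocomplex).homology q) :
    homologyToExt Γ e he J' q (HomologicalComplex.homologyMap
      ((Γ.mapHomologicalComplex (.up ℕ)).map φ.hom) q s) =
      Ext.comp (homologyToExt Γ e he J q s : Ext Z F q) (Ext.mk₀ m) (add_zero q) := by
  obtain ⟨z, hz⟩ := exists_isGroupClass _ q s
  have hz' := hz.map ((Γ.mapHomologicalComplex (.up ℕ)).map φ.hom)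
  refine (homologyToExt_apply e he hz').trans ?_
  refine Eq.trans ?_ (congrArg (fun x : Ext Z F q => x.comp (Ext.mk₀ m) (add_zero q))
    (homologyToExt_apply e he hz)).symm
  refine Eq.trans ?_ (InjectiveResolution.extMk_comp_mk₀ _ _ _ _ φ).symm
  congr 1
  exact (symm_comp_eq Γ e he z (φ.hom.f q)).symm

end FunctorH

section FunctorH

open Abelian

variable (Y : TopCat.{u})

/-- The constant sheaf `ℤ`. -/
abbrev constZ : AbSheaf Y :=
  (constantSheaf (Opens.grothendieckTopology Y) AddCommGrpCat.{u}).obj (.of (ULift ℤ))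

/-- Morphisms from the constant sheaf `ℤ` are global sections. -/
def constZEquiv (F : AbSheaf Y) : (constZ Y ⟶ F) ≃+ (gammaTop Y).obj F :=
  AddEquiv.trans ((constantSheafAdj (Opens.grothendieckTopology Y) AddCommGrpCat.{u}
    (isTerminalTop : IsTerminal (⊤ : Opens Y))).homAddEquiv (.of (ULift ℤ)) F)
      (AddCommGrpCat.uliftZMultiplesAddEquiv _)

variable {Y}

theorem constZEquiv_comp {F G : AbSheaf Y} (a : constZ Y ⟶ F) (m : F ⟶ G) :
    constZEquiv Y G (a ≫ m) = (gammaTop Y).map m (constZEquiv Y F a) := rfl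

instance : HasExt.{u} (AbSheaf Y) :=
  inferInstanceAs (HasExt.{u} (Sheaf (Opens.grothendieckTopology Y) AddCommGrpCat.{u}))

/-- The comparison map from the cohomology defined by injective resolutions to `Ext^q(ℤ, F)`. -/
def cohToH (F : AbSheaf Y) (q : ℕ) :
    coh F q ⟶ (Sheaf.functorH (Opens.grothendieckTopology Y) q).obj F :=
  homologyToExt (gammaTop Y) (constZEquiv Y) constZEquiv_comp (injectiveResolution F) q

theorem bijective_cohToH (F : AbSheaf Y) (q : ℕ) : Function.Bijective (cohToH F q) :=
  bijective_homologyToExt (gammaTop Y) (constZEquiv Y) constZEquiv_comp (injectiveResolution F) q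

/-- `cohMap` expects a morphism to a direct image, so a morphism of sheaves on one space enters it
through the direct image under the identity, which is harmless on global sections. -/
theorem cohMap_cohToH {F G : AbSheaf Y} (m : F ⟶ G) (q : ℕ) :
    cohMap (𝟙 Y) (m ≫ (toPushId Y).app G) q ≫ cohToH G q =
      cohToH F q ≫ (Sheaf.functorH (Opens.grothendieckTopology Y) q).map m := by
  let I := injectiveResolution F
  let J := injectiveResolution G
  let φ : InjectiveResolution.Hom I J m :=
    { hom := descTo I J.cocomplex J.injective (m ≫ augmentation J) (by
        rw [Category.assoc, augmentation_d, comp_zero])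
      ι_f_zero_comp_hom_f_zero := (augmentation_descTo _ _ _ _ _).trans rfl }
  let c : J.cocomplex ⟶ ((push (𝟙 Y)).mapHomologicalComplex (.up ℕ)).obj J.cocomplex :=
    { f n := (toPushId Y).app (J.cocomplex.X n)
      comm' _ _ _ := ((toPushId Y).naturality _).symm }
  have h1 := homologyMap_gammaMap (𝟙 Y) (m ≫ (toPushId Y).app G) (φ.hom ≫ c) (by
    have h2 : augmentation I ≫ φ.hom.f 0 = m ≫ augmentation J := φ.ι_f_zero_comp_hom_f_zero
    refine (Category.assoc _ _ _).symm.trans ((congrArg (· ≫ _) h2).trans ?_)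
    refine (Category.assoc _ _ _).trans ?_
    refine Eq.trans ?_ (Category.assoc _ _ _).symm
    exact congrArg (m ≫ ·) ((toPushId Y).naturality (augmentation J))) q
  have h3 : gammaMap (𝟙 Y) (φ.hom ≫ c) =
      ((gammaTop Y).mapHomologicalComplex (.up ℕ)).map φ.hom := by
    ext n : 1
    exact (congrArg ((φ.hom.f n).hom.app (op ⊤) ≫ ·)
      ((J.cocomplex.X n).obj.map_id (op ⊤))).trans (Category.comp_id _)
  rw [← h1, h3]
  ext s
  exact homologyToExt_naturality (gammaTop Y) (constZEquiv Y) constZEquiv_comp q φ s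

end FunctorH

/-! ### The reduced subscheme and a description of the sections of `Ẽ_T`. -/

section Reduced

theorem isIso_app {Y : TopCat.{u}} {F G : AbSheaf Y} (φ : F ⟶ G) (h : IsIso φ) (U : Opens Y) :
    IsIso (φ.hom.app (op U)) :=
  ⟨(inv φ).hom.app (op U), congrArg (fun m => m.hom.app (op U)) (IsIso.hom_inv_id φ),
    congrArg (fun m => m.hom.app (op U)) (IsIso.inv_hom_id φ)⟩

theorem isReduced_reduced (T : Scheme.{u}) : IsReduced (reduced T) := by
  have (U : T.nilradical.subschemeCover.openCover.I₀) :
      IsReduced (T.nilradical.subschemeCover.openCover.X U) := by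
    have : _root_.IsReduced (Γ(T, U.1) ⧸ T.nilradical.ideal U) :=
      (Ideal.isRadical_iff_quotient_reduced _).mp (Ideal.radical_isRadical _)
    exact inferInstanceAs (IsReduced (Spec (.of (Γ(T, U.1) ⧸ T.nilradical.ideal U))))
  exact IsReduced.of_openCover _ T.nilradical.subschemeCover.openCover

/-- For reduced `T₀` the closed immersion of its reduced subscheme is an isomorphism, so the
functoriality of the reduced subscheme supplies the factorization. -/
theorem exists_lift_reduced {T₀ T : Scheme.{u}} [IsReduced T₀] (h : T₀ ⟶ T) :
    ∃ k : T₀ ⟶ reduced T, k ≫ reducedι T = h := by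
  obtain ⟨k, hk⟩ := exists_reducedMap h
  have : IsIso (reducedι T₀) :=
    (Scheme.isIso_subschemeι_iff_eq_bot _).mpr Scheme.nilradical_eq_bot
  exact ⟨inv (reducedι T₀) ≫ k, by rw [Category.assoc, hk, IsIso.inv_hom_id_assoc]⟩

/-- A morphism of `X`-schemes `Z ⟶ Y` whose image is contained in the open set `W`, as a morphism
`Z ⟶ W`. -/
def liftOpens {X Y : Scheme.{u}} (p : Y ⟶ X) (W : Y.Opens) {Z : Over X} (m : Z.left ⟶ Y)
    (hm : m ≫ p = Z.hom) (hW : ∀ z, m z ∈ W) : Z ⟶ (opensOver p).obj W :=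
  Over.homMk (V := Over.mk (W.ι ≫ p)) (IsOpenImmersion.lift W.ι m (by
    rintro _ ⟨z, rfl⟩
    rw [Scheme.Opens.range_ι]
    exact hW z)) ((IsOpenImmersion.lift_fac_assoc _ _ _ _).trans hm)

/-- The morphism to `Y` underlying a morphism of `X`-schemes to an open subscheme of `Y`. -/
def ambient {X Y : Scheme.{u}} {p : Y ⟶ X} {W : Y.Opens} {Z : Over X}
    (z : Z ⟶ (opensOver p).obj W) : Z.left ⟶ Y :=
  CategoryStruct.comp (Y := W.toScheme) z.left W.ι

section Ambient

variable {X Y : Scheme.{u}} {p : Y ⟶ X} {W : Y.Opens} {Z : Over X}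

theorem ambient_comp (z : Z ⟶ (opensOver p).obj W) : ambient z ≫ p = Z.hom :=
  (Category.assoc _ _ _).trans (Over.w z)

theorem ambient_mem (z : Z ⟶ (opensOver p).obj W) (x : Z.left) : ambient z x ∈ W := by
  have : ambient z x = W.ι ((show Z.left ⟶ W.toScheme from z.left) x) :=
    Scheme.Hom.comp_apply (show Z.left ⟶ W.toScheme from z.left) W.ι x
  rw [this]
  exact Subtype.prop _

theorem ambient_injective {z z' : Z ⟶ (opensOver p).obj W} (h : ambient z = ambient z') : z = z' :=
  opensOver_hom_ext h

theorem ambient_precomp {Z' : Over X} (k : Z' ⟶ Z) (z : Z ⟶ (opensOver p).obj W) :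
    ambient (k ≫ z) = k.left ≫ ambient z :=
  Category.assoc _ _ _

theorem ambient_liftOpens (m : Z.left ⟶ Y) (hm : m ≫ p = Z.hom) (hW : ∀ z, m z ∈ W) :
    ambient (liftOpens p W m hm hW) = m :=
  IsOpenImmersion.lift_fac _ _ _

theorem ambient_opensOverHom {Y' : Scheme.{u}} {p' : Y' ⟶ X} (h : Y' ⟶ Y)
    (w : h ≫ p = p') (U : Y.Opens) (V : Y'.Opens) (e : V ≤ h ⁻¹ᵁ U) :
    ambient (opensOverHom h w U V e) = V.ι ≫ h :=
  Scheme.Hom.resLE_comp_ι _ _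

theorem ambient_opensOver_map {U V : Y.Opens} (i : V ⟶ U) :
    ambient ((opensOver p).map i) = V.ι :=
  Scheme.homOfLE_ι _ i.le

theorem ambient_comp_opensOverHom {Y' : Scheme.{u}} {p' : Y' ⟶ X} (h : Y' ⟶ Y)
    (w : h ≫ p = p') (U : Y.Opens) (V : Y'.Opens) (e : V ≤ h ⁻¹ᵁ U)
    (z : Z ⟶ (opensOver p').obj V) :
    ambient (z ≫ opensOverHom h w U V e) = ambient z ≫ h := by
  rw [ambient_precomp, ambient_opensOverHom]
  exact (Category.assoc _ _ _).symm

end Ambient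

variable {X S T : Scheme.{u}} (f : X ⟶ S) (E : BigZariskiSheaf X) (g : T ⟶ S)

/-- The sections of `Ẽ_T` are the sections of `E` which vanish on all schemes over reduced
`T`-schemes. -/
theorem tilde_iff (W : (pullback f g).Opens)
    (s : E.obj.obj (op ((opensOver (pullback.fst f g)).obj W))) :
    (restrictHom E (prodMap f (reducedι T) (rfl : reducedι T ≫ g = reducedι T ≫ g))
      (prodMap_fst ..)).hom.app (op W) s = 0 ↔
    ∀ (Z : Over X) (z : Z ⟶ (opensOver (pullback.fst f g)).obj W) (T₀ : Scheme.{u}),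
      IsReduced T₀ → ∀ (a : Z.left ⟶ T₀) (b : T₀ ⟶ T),
      ambient z ≫ pullback.snd f g = a ≫ b → E.obj.map z.op s = 0 := by
  constructor
  · intro hs Z z T₀ _ a b hab
    obtain ⟨k, rfl⟩ := exists_lift_reduced b
    have hk : Z.hom ≫ f = (a ≫ k) ≫ reducedι T ≫ g := by
      rw [← ambient_comp z, Category.assoc, pullback.condition, reassoc_of% hab, Category.assoc]
    -- Because `b` factors through `T_red`, the scheme `Z` maps to `X ×_S T_red`, where `s` vanishes
    -- by assumption.
    let m : Z.left ⟶ pullback f (reducedι T ≫ g) := pullback.lift Z.hom (a ≫ k) hk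
    have hm : m ≫ prodMap f (reducedι T) (rfl : reducedι T ≫ g = reducedι T ≫ g) =
        ambient z := by
      apply pullback.hom_ext
      · rw [Category.assoc, prodMap_fst, pullback.lift_fst, ambient_comp]
      · rw [Category.assoc, prodMap_snd, pullback.lift_snd_assoc, Category.assoc, hab]
    let z' := liftOpens (pullback.fst f (reducedι T ≫ g))
      (prodMap f (reducedι T) (rfl : reducedι T ≫ g = reducedι T ≫ g) ⁻¹ᵁ W) (Z := Z) m
      (pullback.lift_fst ..) (by
        intro x
        change prodMap f (reducedι T) _ (m x) ∈ W
        rw [← Scheme.Hom.comp_apply, hm]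
        exact ambient_mem z x)
    have hz' : z' ≫ opensOverHom (prodMap f (reducedι T) rfl) (prodMap_fst ..) W _ le_rfl = z := by
      apply ambient_injective
      rw [ambient_comp_opensOverHom, ambient_liftOpens, hm]
    rw [← map_map_apply' E _ _ _ hz' s]
    exact (congrArg (E.obj.map z'.op) hs).trans (map_zero _)
  · intro h
    refine h _ (opensOverHom (prodMap f (reducedι T) rfl) (prodMap_fst ..) W _ le_rfl) (reduced T)
      (isReduced_reduced T) (CategoryStruct.comp (Y := pullback f (reducedι T ≫ g))
        (Scheme.Opens.ι _) (pullback.snd _ _)) (reducedι T) ?_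
    rw [ambient_opensOverHom]
    refine (Category.assoc _ _ _).trans ((congrArg (_ ≫ ·) (prodMap_snd ..)).trans ?_)
    exact (Category.assoc _ _ _).symm

end Reduced

/-! ### Compatibility of `Ẽ_T` and its higher direct images with open immersions `T' ⟶ T`. -/

section OpenSubscheme

variable {X S T T' : Scheme.{u}} (f : X ⟶ S) {g : T ⟶ S} {g' : T' ⟶ S} (h : T' ⟶ T)
  (w : h ≫ g = g')

theorem isPullback_prodMap :
    IsPullback (prodMap f h w) (pullback.snd f g') (pullback.snd f g) h := by
  subst w
  refine (IsPullback.of_bot ?_ (prodMap_snd f h rfl).symm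
    (IsPullback.of_hasPullback f g).flip).flip
  rw [prodMap_fst]
  exact (IsPullback.of_hasPullback f (h ≫ g)).flip

theorem isOpenImmersion_prodMap [IsOpenImmersion h] : IsOpenImmersion (prodMap f h w) :=
  MorphismProperty.of_isPullback (isPullback_prodMap f h w).flip ‹_›

/-- This is the pointwise form of `X_{T'}` being the inverse image of `T'`, needed by
`isIso_openRestrict_baseChange`. -/
theorem mem_range_prodMap (y : (pullback f g : Scheme.{u})) (hy : pullback.snd f g y ∈ Set.range h) :
    y ∈ Set.range (prodMap f h w) := by
  obtain ⟨t, ht⟩ := hy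
  obtain ⟨z, hz, -⟩ := Scheme.exists_preimage_of_isPullback (isPullback_prodMap f h w) y t ht.symm
  exact ⟨z, hz⟩

/-- Over an open subscheme `T'` of `T` the sheaf `Ẽ_{T'}` is the restriction of `Ẽ_T`. -/
theorem isIso_tildeHom_app (E : BigZariskiSheaf X) [IsOpenImmersion h] (W : (pullback f g).Opens)
    (hW : ∀ y ∈ W, y ∈ Set.range (prodMap f h w)) :
    IsIso ((tildeHom f E h w).hom.app (op W)) := by
  have := isOpenImmersion_prodMap f h w
  let z := opensOverHom (prodMap f h w) (prodMap_fst ..) W (prodMap f h w ⁻¹ᵁ W) le_rfl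
  let m : W.toScheme ⟶ pullback f g' := IsOpenImmersion.lift (prodMap f h w) W.ι (by
    rintro _ ⟨y, rfl⟩
    exact hW _ y.2)
  have hm : m ≫ prodMap f h w = W.ι := IsOpenImmersion.lift_fac ..
  have hmW (y : W.toScheme) : prodMap f h w (m y) ∈ W := by
    rw [← Scheme.Hom.comp_apply, hm]
    exact y.2
  -- `W` lies in the image of the open immersion `X_{T'} ⟶ X_T`, so it is the same `X`-scheme as its
  -- inverse image; `k` is the inverse of `z`, and pull-back along it inverts the map on sections of
  -- `E`. What remains is to keep the kernel condition.
  let k : (opensOver (pullback.fst f g)).obj W ⟶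
      (opensOver (pullback.fst f g')).obj (prodMap f h w ⁻¹ᵁ W) :=
    liftOpens _ _ m (by rw [← prodMap_fst f h w]; exact (congrArg (· ≫ _) hm)) hmW
  have hk : ambient k = m := ambient_liftOpens ..
  have hkz : k ≫ z = 𝟙 _ := by
    apply ambient_injective
    rw [ambient_comp_opensOverHom, hk]
    exact hm
  have hzk : z ≫ k = 𝟙 _ := by
    apply ambient_injective
    rw [← cancel_mono (prodMap f h w), ambient_precomp, hk]
    refine (Category.assoc _ _ _).trans ((congrArg (_ ≫ ·) hm).trans ?_)
    exact ambient_opensOverHom ..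
  rw [ConcreteCategory.isIso_iff_bijective]
  constructor
  · intro s s' hs
    apply Subtype.ext
    have h1 : E.obj.map z.op s.1 = E.obj.map z.op s'.1 := congrArg Subtype.val hs
    have h2 (r : E.obj.obj (op ((opensOver (pullback.fst f g)).obj W))) :
        E.obj.map k.op (E.obj.map z.op r) = r :=
      (map_map_apply' E _ _ _ hkz r).trans (ConcreteCategory.congr_hom (E.obj.map_id _) r)
    exact (h2 s.1).symm.trans ((congrArg (E.obj.map k.op) h1).trans (h2 s'.1))
  · intro t
    refine ⟨⟨E.obj.map k.op t.1, (tilde_iff f E g W _).mpr ?_⟩, Subtype.ext ?_⟩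
    · intro Z y T₀ _ a b hab
      have hy : ambient (y ≫ k) ≫ prodMap f h w = ambient y := by
        rw [ambient_precomp, hk]
        exact (Category.assoc _ _ _).trans (congrArg (_ ≫ ·) hm)
      have hab' : a ≫ b = (ambient (y ≫ k) ≫ pullback.snd f g') ≫ h := by
        rw [← hab, ← hy, Category.assoc, Category.assoc, prodMap_snd]
      -- The reduced test scheme `T₀` over `T` need not map to `T'`; it is replaced by its open,
      -- hence reduced, subscheme `T₀ ×_T T'`.
      have : IsReduced (pullback b h) := isReduced_of_isOpenImmersion (pullback.fst b h)
      refine (map_map_apply' E y k _ rfl t.1).trans ?_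
      exact (tilde_iff f E g' _ t.1).mp t.2 Z (y ≫ k) (pullback b h) this
        (pullback.lift _ _ hab') (pullback.snd b h) (pullback.lift_snd ..).symm
    · exact (map_map_apply' E z k _ hzk t.1).trans
        (ConcreteCategory.congr_hom (E.obj.map_id _) t.1)

theorem isIso_openRestrict_tildeHom (E : BigZariskiSheaf X) [IsOpenImmersion h]
    (hh' : Topology.IsOpenEmbedding (prodMap f h w).base) :
    IsIso ((openRestrict hh').map (tildeHom f E h w)) := by
  apply isIso_of_app
  intro U
  exact isIso_tildeHom_app f h w E (hh'.functor.obj U) (by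
    rintro _ ⟨y, -, rfl⟩
    exact ⟨y, rfl⟩)

/-- The sections of `R^q f_{T*} Ẽ_T` over an open subset of `T`. -/
theorem isIso_baseChange_app (E : BigZariskiSheaf X) [IsOpenImmersion h] (q : ℕ) (W : T.Opens)
    (hW : ∀ y ∈ W, y ∈ Set.range h) :
    IsIso ((baseChange (prodMap_base_snd f h w) (tildeHom f E h w) q).hom.app (op W)) := by
  have := isOpenImmersion_prodMap f h w
  have hh : Topology.IsOpenEmbedding h.base := h.isOpenEmbedding
  have hh' : Topology.IsOpenEmbedding (prodMap f h w).base := (prodMap f h w).isOpenEmbedding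
  have := isIso_openRestrict_tildeHom f h w E hh'
  have h1 := isIso_openRestrict_baseChange (prodMap_base_snd f h w) hh hh'
    (mem_range_prodMap f h w) (tildeHom f E h w) q
  have h2 : hh.functor.obj ((Opens.map h.base).obj W) = W := by
    ext y
    constructor
    · rintro ⟨x, hx, rfl⟩
      exact hx
    · intro hy
      obtain ⟨x, rfl⟩ := hW y hy
      exact ⟨x, hy, rfl⟩
  have h3 : IsIso ((baseChange (prodMap_base_snd f h w) (tildeHom f E h w) q).hom.app
      (op (hh.functor.obj ((Opens.map h.base).obj W)))) :=
    isIso_app _ h1 ((Opens.map h.base).obj W)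
  rwa [h2] at h3

end OpenSubscheme

/-! ### `Φ^q` is a sheaf on the small Zariski site of every `S`-scheme. -/

section PhiSheaf

variable {X S : Scheme.{u}} (f : X ⟶ S) (E : BigZariskiSheaf X) (q : ℕ)

/-- The sheaf `R^q f_{T*} Ẽ_T`. -/
def phiSheaf {T : Scheme.{u}} (g : T ⟶ S) : AbSheaf T :=
  (higherDirectImage (pullback.snd f g).base q).obj (tildeSheaf f E g)

/-- The base change map `R^q f_{T*} Ẽ_T ⟶ h_* R^q f_{T'*} Ẽ_{T'}`. -/
def phiBaseChange {T T' : Scheme.{u}} {g : T ⟶ S} {g' : T' ⟶ S} (h : T' ⟶ T) (w : h ≫ g = g') :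
    phiSheaf f E q g ⟶ (push h.base).obj (phiSheaf f E q g') :=
  baseChange (prodMap_base_snd f h w) (tildeHom f E h w) q

/-- Transitivity of base change for sections over arbitrary open sets. It makes the identification
of `R^q f_{T*} Ẽ_T` on an open set with the value of `Φ^q` on that open subscheme compatible with
restriction. -/
theorem phiBaseChange_comp {T T' T'' : Scheme.{u}} {g : T ⟶ S} {g' : T' ⟶ S} {g'' : T'' ⟶ S}
    (h : T' ⟶ T) (w : h ≫ g = g') (k : T'' ⟶ T') (w' : k ≫ g' = g'') (m : T'' ⟶ T)
    (wm : m ≫ g = g'') (hm : k ≫ h = m) {U : T.Opens} {V : T'.Opens} {W : T''.Opens}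
    (hV : V ≤ h ⁻¹ᵁ U) (hW : W ≤ k ⁻¹ᵁ V) (hW' : W ≤ m ⁻¹ᵁ U)
    (s : (phiSheaf f E q g).obj.obj (op U)) :
    resHom (phiSheaf f E q g'') hW (secHom (phiBaseChange f E q k w') V
      (resHom (phiSheaf f E q g') hV (secHom (phiBaseChange f E q h w) U s))) =
    resHom (phiSheaf f E q g'') hW' (secHom (phiBaseChange f E q m wm) U s) := by
  subst hm
  have e : (prodMap f (k ≫ h) wm).base = (prodMap f k w').base ≫ (prodMap f h w).base :=
    congrArg (fun k : pullback f g'' ⟶ pullback f g => k.base)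
      (prodMap_comp f h w k w' (k ≫ h) wm rfl).symm
  have e' : ((prodMap f k w').base ≫ (prodMap f h w).base) ≫ (pullback.snd f g).base =
      (pullback.snd f g'').base ≫ k.base ≫ h.base := by
    rw [Category.assoc, prodMap_base_snd, ← Category.assoc, prodMap_base_snd, Category.assoc]
  have h1 := (baseChange_congr (prodMap_base_snd f (k ≫ h) wm) e' e rfl _ _
    (tildeHom_comp f E h w k w' wm e) q).trans (baseChange_comp (prodMap_base_snd f h w)
    (prodMap_base_snd f k w') e' (tildeHom f E h w) (tildeHom f E k w') q).symm
  have h2 : secHom (phiBaseChange f E q k w') (h ⁻¹ᵁ U) (secHom (phiBaseChange f E q h w) U s) =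
      secHom (phiBaseChange f E q (k ≫ h) wm) U s :=
    (congrArg (fun m => secHom m U s) h1).symm.trans
      (ConcreteCategory.congr_hom ((phiSheaf f E q g'').obj.map_id _) _)
  refine (congrArg _ (secHom_resHom (phiBaseChange f E q k w') hV _)).trans ?_
  refine (congrArg _ (congrArg _ h2)).trans ?_
  exact resHom_resHom _ _ _ _

theorem top_le_ι_preimage {T : Scheme.{u}} (U : T.Opens) : ⊤ ≤ U.ι ⁻¹ᵁ U :=
  fun x _ => x.2

/-- The value of `Φ^q` on an open subscheme. -/
def phiOpenMap {T : Scheme.{u}} (g : T ⟶ S) (U : T.Opens) :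
    (phiSheaf f E q g).obj.obj (op U) ⟶ (Phi f E q).obj (op ((opensOver g).obj U)) :=
  (phiBaseChange f E q U.ι rfl).hom.app (op U) ≫
    (phiSheaf f E q (U.ι ≫ g)).obj.map (homOfLE (top_le_ι_preimage U)).op

theorem isIso_phiOpenMap {T : Scheme.{u}} (g : T ⟶ S) (U : T.Opens) :
    IsIso (phiOpenMap f E q g U) := by
  have h1 : IsIso ((phiBaseChange f E q (g := g) U.ι rfl).hom.app (op U)) :=
    isIso_baseChange_app f (g := g) U.ι rfl E q U (by
      intro y hy
      exact ⟨⟨y, hy⟩, rfl⟩)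
  have h2 : IsIso (homOfLE (top_le_ι_preimage U)) :=
    ⟨homOfLE le_top, Subsingleton.elim _ _, Subsingleton.elim _ _⟩
  have h3 : IsIso ((phiSheaf f E q (U.ι ≫ g)).obj.map
    (homOfLE (top_le_ι_preimage U)).op) := inferInstance
  exact IsIso.comp_isIso' h1 h3

theorem phiOpenMap_naturality {T : Scheme.{u}} (g : T ⟶ S) {U V : T.Opens} (i : V ⟶ U) :
    (phiSheaf f E q g).obj.map i.op ≫ phiOpenMap f E q g V =
      phiOpenMap f E q g U ≫ (Phi f E q).map ((opensOver g).map i).op := by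
  ext s
  have h1 := phiBaseChange_comp f E q U.ι rfl (T.homOfLE i.le) (by simp) V.ι rfl (by simp)
    (U := U) (V := ⊤) (W := ⊤) (fun x _ => x.2) le_rfl (fun x _ => i.le x.2) s
  refine Eq.trans ?_ (h1.symm.trans (resHom_self _ _ _))
  refine (congrArg (resHom (phiSheaf f E q (V.ι ≫ g)) (top_le_ι_preimage V))
    (secHom_resHom (phiBaseChange f E q V.ι rfl) i.le s)).trans ?_
  exact resHom_resHom _ _ _ _

/-- Although `Φ^q(U)` is computed from scratch for each open subscheme `U` of `T`, it agrees with
the sections over `U` of the single sheaf `R^q f_{T*} Ẽ_T`, naturally in `U`. -/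
theorem isSheaf_phi {T : Scheme.{u}} (g : T ⟶ S) :
    TopCat.Presheaf.IsSheaf (X := T) ((opensOver g).op ⋙ Phi f E q) := by
  have (U : T.Opens) := isIso_phiOpenMap f E q g U
  refine TopCat.Presheaf.isSheaf_of_iso (F := (phiSheaf f E q g).obj)
    (NatIso.ofComponents (fun U => asIso (phiOpenMap f E q g U.unop)) ?_) (phiSheaf f E q g).2
  intro U V i
  exact phiOpenMap_naturality f E q g i.unop

end PhiSheaf

/-! ### Comparing two Zariski sheaves by locally bijective maps from one functor on affine
noetherian schemes. -/

section Gluing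

variable {S : Scheme.{u}}

/-- The inclusion of an open subscheme. -/
def openIncl (T : Over S) (U : T.left.Opens) : (opensOver T.hom).obj U ⟶ T :=
  Over.homMk U.ι rfl

theorem openIncl_range (T : Over S) (U : T.left.Opens) (t : T.left) (ht : t ∈ U) :
    t ∈ Set.range (openIncl T U).left :=
  ⟨(⟨t, ht⟩ : U.toScheme), rfl⟩

instance (T : Over S) (U : T.left.Opens) : IsOpenImmersion (openIncl T U).left :=
  inferInstanceAs (IsOpenImmersion U.ι)

theorem openIncl_mem (T : Over S) (U : T.left.Opens) (x : ((opensOver T.hom).obj U).left) :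
    (openIncl T U).left x ∈ U :=
  Subtype.prop (show U.toScheme from x)

theorem map_openIncl (T : Over S) {U V : T.left.Opens} (i : V ⟶ U) :
    (opensOver T.hom).map i ≫ openIncl T U = openIncl T V := by
  ext1
  exact Scheme.homOfLE_ι _ i.le

/-- The affine noetherian `S`-schemes. -/
def affineNoetherianOver (S : Scheme.{u}) : ObjectProperty (Over S) :=
  fun T => IsAffine T.left ∧ AlgebraicGeometry.IsNoetherian T.left

theorem noetherianOver_open {T : Over S} (hT : noetherianOver S T) (U : T.left.Opens) :
    noetherianOver S ((opensOver T.hom).obj U) := by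
  have : AlgebraicGeometry.IsNoetherian T.left := hT
  have h : AlgebraicGeometry.IsNoetherian U.toScheme :=
    { toIsLocallyNoetherian := isLocallyNoetherian_of_isOpenImmersion U.ι
      toCompactSpace := by
        have : NoetherianSpace T.left := inferInstance
        exact isCompact_iff_compactSpace.mp (NoetherianSpace.isCompact _) }
  exact h

theorem exists_affineNoetherian {T : Over S} (hT : noetherianOver S T) (V : T.left.Opens)
    (t : T.left) (ht : t ∈ V) :
    ∃ U ≤ V, t ∈ U ∧ affineNoetherianOver S ((opensOver T.hom).obj U) := by
  obtain ⟨U, hU, htU, hUV⟩ := Opens.isBasis_iff_nbhd.mp T.left.isBasis_affineOpens ht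
  exact ⟨U, hUV, htU, hU, noetherianOver_open hT U⟩

/-- A functor on `S`-schemes which is a sheaf on the small Zariski site of every `S`-scheme. -/
def IsZariskiSheaf (B : (Over S)ᵒᵖ ⥤ AddCommGrpCat.{u}) : Prop :=
  ∀ T : Over S, TopCat.Presheaf.IsSheaf (X := T.left) ((opensOver T.hom).op ⋙ B)

theorem map_comp_apply (B : (Over S)ᵒᵖ ⥤ AddCommGrpCat.{u}) {T₁ T₂ T₃ : Over S} (a : T₁ ⟶ T₂)
    (b : T₂ ⟶ T₃) (r : B.obj (op T₃)) :
    B.map a.op (B.map b.op r) = B.map (a ≫ b).op r := by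
  rw [← ConcreteCategory.comp_apply, ← B.map_comp, ← op_comp]

theorem map_comp_apply' (B : (Over S)ᵒᵖ ⥤ AddCommGrpCat.{u}) {T₁ T₂ T₃ : Over S} (a : T₁ ⟶ T₂)
    (b : T₂ ⟶ T₃) (c : T₁ ⟶ T₃) (h : a ≫ b = c) (r : B.obj (op T₃)) :
    B.map a.op (B.map b.op r) = B.map c.op r := by
  rw [map_comp_apply, h]

theorem map_id_apply (B : (Over S)ᵒᵖ ⥤ AddCommGrpCat.{u}) {T : Over S} (r : B.obj (op T)) :
    B.map (𝟙 T).op r = r :=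
  ConcreteCategory.congr_hom (B.map_id (op T)) r

/-- The identification of `T` with its largest open subscheme. -/
def toTop (T : Over S) : T ⟶ (opensOver T.hom).obj ⊤ :=
  liftOpens T.hom ⊤ (𝟙 T.left) (Category.id_comp _) fun _ => trivial

theorem toTop_openIncl (T : Over S) : toTop T ≫ openIncl T ⊤ = 𝟙 T := by
  ext1
  exact ambient_liftOpens (p := T.hom) (W := ⊤) (Z := T) (𝟙 T.left)
    (Category.id_comp _) fun _ => trivial

theorem openIncl_toTop (T : Over S) (U : T.left.Opens) :
    openIncl T U ≫ toTop T = (opensOver T.hom).map (homOfLE le_top) := by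
  apply ambient_injective
  rw [ambient_precomp, ambient_opensOver_map]
  exact (congrArg (U.ι ≫ ·) (ambient_liftOpens (p := T.hom) (W := ⊤) (Z := T) (𝟙 T.left)
    (Category.id_comp _) fun _ => trivial)).trans (Category.comp_id _)

variable {B : (Over S)ᵒᵖ ⥤ AddCommGrpCat.{u}} (hB : IsZariskiSheaf B)
include hB

/-- The sheaf condition concerns open subschemes of `T`, so the comparison takes place on the
largest of them and is carried back to `T` along `toTop`. -/
theorem IsZariskiSheaf.eq_of_opens {T : Over S} (r r' : B.obj (op T))
    (h : ∀ t : T.left, ∃ U : T.left.Opens, t ∈ U ∧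
      B.map (openIncl T U).op r = B.map (openIncl T U).op r') : r = r' := by
  have h1 : B.map (openIncl T ⊤).op r = B.map (openIncl T ⊤).op r' := by
    refine eq_of_locally_eq (Y := T.left) ⟨_, hB T⟩ (U := ⊤) _ _ ?_
    intro t _
    obtain ⟨U, hU, he⟩ := h t
    refine ⟨U, le_top, hU, ?_⟩
    exact (map_comp_apply' B _ _ _ (map_openIncl T _) r).trans
      (he.trans (map_comp_apply' B _ _ _ (map_openIncl T _) r').symm)
  have h2 := congrArg (B.map (toTop T).op) h1
  rw [map_comp_apply' B _ _ _ (toTop_openIncl T), map_comp_apply' B _ _ _ (toTop_openIncl T)] at h2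
  rwa [map_id_apply, map_id_apply] at h2

theorem IsZariskiSheaf.eq_of_locally {T : Over S} (r r' : B.obj (op T))
    (h : ∀ t : T.left, ∃ (U : Over S) (k : U ⟶ T), IsOpenImmersion k.left ∧
      t ∈ Set.range k.left ∧ B.map k.op r = B.map k.op r') : r = r' := by
  refine hB.eq_of_opens r r' fun t => ?_
  obtain ⟨U, k, _, ht, he⟩ := h t
  refine ⟨k.left.opensRange, ht, ?_⟩
  let l : (opensOver T.hom).obj k.left.opensRange ⟶ U :=
    Over.homMk (U := Over.mk (k.left.opensRange.ι ≫ T.hom))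
      (IsOpenImmersion.lift k.left k.left.opensRange.ι
      (Scheme.Opens.range_ι _).le) ((congrArg (_ ≫ ·) (Over.w k).symm).trans
        (IsOpenImmersion.lift_fac_assoc _ _ _ _))
  have hl : l ≫ k = openIncl T k.left.opensRange := by
    ext1
    exact IsOpenImmersion.lift_fac ..
  rw [← hl, ← map_comp_apply, ← map_comp_apply, he]

theorem IsZariskiSheaf.exists_glue {T : Over S} {ι : Type u} (U : ι → T.left.Opens)
    (hU : ∀ t, ∃ i, t ∈ U i) (r : ∀ i, B.obj (op ((opensOver T.hom).obj (U i))))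
    (h : ∀ i j, B.map ((opensOver T.hom).map (Opens.infLELeft (U i) (U j))).op (r i) =
      B.map ((opensOver T.hom).map (Opens.infLERight (U i) (U j))).op (r j)) :
    ∃ s : B.obj (op T), ∀ i, B.map (openIncl T (U i)).op s = r i := by
  obtain ⟨s, hs, -⟩ := TopCat.Sheaf.existsUnique_gluing' (X := T.left) ⟨_, hB T⟩ U ⊤
    (fun i => homOfLE le_top) (by
      intro t _
      obtain ⟨i, hi⟩ := hU t
      exact Opens.mem_iSup.mpr ⟨i, hi⟩) r h
  refine ⟨B.map (toTop T).op s, fun i => ?_⟩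
  exact (map_comp_apply' B _ _ _ (openIncl_toTop T (U i)) s).trans (hs i)

omit hB
variable {P A : (Over S)ᵒᵖ ⥤ AddCommGrpCat.{u}}

/-- A natural transformation between the restrictions of two functors to affine noetherian
schemes. -/
structure AffineHom (P A : (Over S)ᵒᵖ ⥤ AddCommGrpCat.{u}) where
  /-- the components -/
  app (T : Over S) (hT : affineNoetherianOver S T) : P.obj (op T) →+ A.obj (op T)
  naturality {T T' : Over S} (hT : affineNoetherianOver S T) (hT' : affineNoetherianOver S T')
    (h : T' ⟶ T) (c : P.obj (op T)) : app T' hT' (P.map h.op c) = A.map h.op (app T hT c)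

/-- Sections in the kernel vanish locally. -/
def AffineHom.LocallyInjective (a : AffineHom P A) : Prop :=
  ∀ (T : Over S) (hT : affineNoetherianOver S T) (c : P.obj (op T)), a.app T hT c = 0 →
    ∀ t : T.left, ∃ V : T.left.Opens, t ∈ V ∧ ∀ (T' : Over S) (_ : affineNoetherianOver S T')
      (h : T' ⟶ T), (∀ x, h.left x ∈ V) → P.map h.op c = 0

/-- Sections are locally in the image. -/
def AffineHom.LocallySurjective (a : AffineHom P A) : Prop :=
  ∀ (T : Over S) (_ : noetherianOver S T) (s : A.obj (op T)) (t : T.left),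
    ∃ V : T.left.Opens, t ∈ V ∧ ∀ (T' : Over S) (hT' : affineNoetherianOver S T')
      (h : T' ⟶ T), (∀ x, h.left x ∈ V) → ∃ c, a.app T' hT' c = A.map h.op s

variable (a : AffineHom P A) (ha : a.LocallyInjective) (ha' : a.LocallySurjective)
  (b : AffineHom P B)

theorem AffineHom.exists_local_section (ha' : a.LocallySurjective) {T : Over S}
    (hT : noetherianOver S T) (s : A.obj (op T)) (t : T.left) (V : T.left.Opens) (ht : t ∈ V) :
    ∃ (U : T.left.Opens) (_ : U ≤ V) (_ : t ∈ U)
      (hU : affineNoetherianOver S ((opensOver T.hom).obj U)) (c : _),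
      a.app _ hU c = A.map (openIncl T U).op s := by
  obtain ⟨V', htV', hV'⟩ := ha' T hT s t
  obtain ⟨U, hUV, htU, hU⟩ := exists_affineNoetherian hT (V ⊓ V') t ⟨ht, htV'⟩
  obtain ⟨c, hc⟩ := hV' _ hU (openIncl T U) fun x => (hUV (openIncl_mem T U x)).2
  exact ⟨U, fun x hx => (hUV hx).1, htU, hU, c, hc⟩

/-- If two sections of `P` have the same image under a locally injective map, then their images
under any map to a sheaf agree. -/
theorem AffineHom.app_eq_app (hB : IsZariskiSheaf B) (ha : a.LocallyInjective) {T T₁ T₂ : Over S}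
    (hT : noetherianOver S T) (h₁ : affineNoetherianOver S T₁) (h₂ : affineNoetherianOver S T₂)
    (k₁ : T ⟶ T₁) (k₂ : T ⟶ T₂) (c₁ : P.obj (op T₁)) (c₂ : P.obj (op T₂))
    (h : A.map k₁.op (a.app T₁ h₁ c₁) = A.map k₂.op (a.app T₂ h₂ c₂)) :
    B.map k₁.op (b.app T₁ h₁ c₁) = B.map k₂.op (b.app T₂ h₂ c₂) := by
  refine hB.eq_of_locally _ _ fun t => ?_
  obtain ⟨W, -, htW, hW⟩ := exists_affineNoetherian hT ⊤ t trivial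
  let k := openIncl T W
  -- `T` is only noetherian, while `P` is controlled on affine schemes; on an affine piece the
  -- difference lies in the kernel of `a`, hence vanishes after further localization, and so does
  -- its image under `b`.
  let c := P.map (k ≫ k₁).op c₁ - P.map (k ≫ k₂).op c₂
  have hc : a.app _ hW c = 0 := by
    rw [map_sub, a.naturality h₁ hW, a.naturality h₂ hW, ← map_comp_apply, ← map_comp_apply, h,
      sub_self]
  obtain ⟨t', ht'⟩ := openIncl_range T W t htW
  obtain ⟨V, ht'V, hV⟩ := ha _ hW c hc t'
  obtain ⟨W', hWV, htW', hW'⟩ := exists_affineNoetherian (T := (opensOver T.hom).obj W) hW.2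
    V t' ht'V
  let k' := openIncl ((opensOver T.hom).obj W) W'
  have h0 : P.map k'.op c = 0 := hV _ hW' k' fun x => hWV (openIncl_mem _ W' x)
  refine ⟨_, k' ≫ k, inferInstanceAs (IsOpenImmersion (k'.left ≫ k.left)), ?_, ?_⟩
  · obtain ⟨t'', ht''⟩ := openIncl_range _ W' t' htW'
    refine ⟨t'', ?_⟩
    rw [Over.comp_left, Scheme.Hom.comp_apply, ht'', ht']
  · rw [map_sub, sub_eq_zero, map_comp_apply, map_comp_apply] at h0
    have h1 := congrArg (b.app _ hW') h0
    rw [b.naturality h₁ hW', b.naturality h₂ hW'] at h1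
    rw [map_comp_apply, map_comp_apply, Category.assoc, Category.assoc]
    exact h1

/-- The section `s` of `A` corresponds to the section `r` of `B`. -/
def AffineHom.Rel {T : Over S} (s : A.obj (op T)) (r : B.obj (op T)) : Prop :=
  ∀ (T' : Over S) (hT' : affineNoetherianOver S T') (h : T' ⟶ T) (c : P.obj (op T')),
    a.app T' hT' c = A.map h.op s → b.app T' hT' c = B.map h.op r

variable {a b} in
theorem AffineHom.Rel.map {T T' : Over S} {s : A.obj (op T)} {r : B.obj (op T)} (h : a.Rel b s r)
    (k : T' ⟶ T) : a.Rel b (A.map k.op s) (B.map k.op r) := by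
  intro T'' hT'' l c hc
  rw [map_comp_apply] at hc ⊢
  exact h T'' hT'' _ c hc

-- Locally `s` and `s'` have lifts to `P` over a common affine open set; their sum lifts `s + s'`,
-- and `b` is additive.
variable {a b} in
theorem AffineHom.Rel.add (hB : IsZariskiSheaf B) (ha' : a.LocallySurjective) {T : Over S}
    (hT : noetherianOver S T) {s s' : A.obj (op T)} {r r' r'' : B.obj (op T)} (h : a.Rel b s r)
    (h' : a.Rel b s' r') (h'' : a.Rel b (s + s') r'') : r'' = r + r' := by
  refine hB.eq_of_opens _ _ fun t => ?_
  obtain ⟨V, htV, hV⟩ := ha' T hT s t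
  obtain ⟨U, hUV, htU, hU, c', hc'⟩ := a.exists_local_section ha' hT s' t V htV
  obtain ⟨c, hc⟩ := hV _ hU (openIncl T U) fun x => hUV (openIncl_mem T U x)
  refine ⟨U, htU, ?_⟩
  rw [map_add, ← h _ hU _ c hc, ← h' _ hU _ c' hc', ← map_add]
  refine (h'' _ hU _ (c + c') ?_).symm
  rw [map_add, map_add, hc, hc']

variable {a b} in
theorem AffineHom.Rel.unique (hB : IsZariskiSheaf B) (ha' : a.LocallySurjective) {T : Over S}
    (hT : noetherianOver S T) {s : A.obj (op T)} {r r' : B.obj (op T)} (h : a.Rel b s r)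
    (h' : a.Rel b s r') : r = r' := by
  refine hB.eq_of_opens _ _ fun t => ?_
  obtain ⟨U, -, htU, hU, c, hc⟩ := a.exists_local_section ha' hT s t ⊤ trivial
  exact ⟨U, htU, (h _ hU _ c hc).symm.trans (h' _ hU _ c hc)⟩

/-- Lift `s` locally to `P`, map the lifts to `B` and glue. On overlaps the lifts have the same
image in `A`, so their images in `B` agree by `app_eq_app`; the same lemma shows that any other lift
of a pull-back of `s` leads to the same section. -/
theorem AffineHom.exists_rel (hB : IsZariskiSheaf B) (ha : a.LocallyInjective)
    (ha' : a.LocallySurjective) {T : Over S} (hT : noetherianOver S T) (s : A.obj (op T)) :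
    ∃ r, a.Rel b s r := by
  choose U _ htU hU c hc using fun t => a.exists_local_section ha' hT s t ⊤ trivial
  obtain ⟨r, hr⟩ := hB.exists_glue U (fun t => ⟨t, htU t⟩) (fun t => b.app _ (hU t) (c t)) (by
    intro t t'
    refine a.app_eq_app b hB ha (noetherianOver_open hT _) (hU t) (hU t') _ _ _ _ ?_
    rw [hc, hc, map_comp_apply, map_comp_apply, map_openIncl, map_openIncl])
  refine ⟨r, ?_⟩
  intro T' hT' h d hd
  refine hB.eq_of_opens _ _ fun x => ?_
  refine ⟨h.left ⁻¹ᵁ U (h.left x), htU (h.left x), ?_⟩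
  let t := h.left x
  let k := openIncl T' (h.left ⁻¹ᵁ U t)
  let k₁ : (opensOver T'.hom).obj (h.left ⁻¹ᵁ U t) ⟶ (opensOver T.hom).obj (U t) :=
    opensOverHom h.left (Over.w h) _ _ le_rfl
  have hk : k₁ ≫ openIncl T (U t) = k ≫ h := by
    ext1
    exact ambient_opensOverHom ..
  have h1 := a.app_eq_app b hB ha (noetherianOver_open hT'.2 (h.left ⁻¹ᵁ U t)) hT' (hU t)
    k k₁ d (c t) (by
      rw [hd, hc, map_comp_apply, map_comp_apply, hk])
  refine h1.trans ?_
  rw [← hr t, map_comp_apply, map_comp_apply, hk]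

/-- The morphism of functors on noetherian schemes induced by two maps from `P`. -/
def AffineHom.compare (hB : IsZariskiSheaf B) (ha : a.LocallyInjective)
    (ha' : a.LocallySurjective) : restrictNoetherian A ⟶ restrictNoetherian B where
  app T := AddCommGrpCat.ofHom (AddMonoidHom.mk'
    (fun s => (a.exists_rel b hB ha ha' T.unop.2 s).choose) (by
      intro s s'
      exact AffineHom.Rel.add hB ha' T.unop.2 (a.exists_rel b hB ha ha' T.unop.2 s).choose_spec
        (a.exists_rel b hB ha ha' T.unop.2 s').choose_spec
        (a.exists_rel b hB ha ha' T.unop.2 (s + s')).choose_spec))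
  naturality T T' h := by
    ext s
    exact AffineHom.Rel.unique hB ha' T'.unop.2 (a.exists_rel b hB ha ha' T'.unop.2 _).choose_spec
      ((a.exists_rel b hB ha ha' T.unop.2 s).choose_spec.map h.unop.hom)

theorem AffineHom.rel_compare (hB : IsZariskiSheaf B) (ha : a.LocallyInjective)
    (ha' : a.LocallySurjective) (T : (noetherianOver S).FullSubcategoryᵒᵖ)
    (s : A.obj (op T.unop.obj)) : a.Rel b s ((a.compare b hB ha ha').app T s) :=
  (a.exists_rel b hB ha ha' T.unop.2 s).choose_spec

/-- A local lift `c` of `s` is also a local lift of the section of `B` corresponding to `s`, so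
going back returns the image of `c`, which is `s`. -/
theorem AffineHom.compare_comp_compare (hA : IsZariskiSheaf A) (hB : IsZariskiSheaf B)
    (ha : a.LocallyInjective) (ha' : a.LocallySurjective) (hb : b.LocallyInjective)
    (hb' : b.LocallySurjective) : a.compare b hB ha ha' ≫ b.compare a hA hb hb' = 𝟙 _ := by
  ext T s
  refine hA.eq_of_opens (T := T.unop.obj) _ _ fun t => ?_
  obtain ⟨U, -, htU, hU, c, hc⟩ := a.exists_local_section ha' T.unop.2 s t ⊤ trivial
  refine ⟨U, htU, ?_⟩
  have h1 := a.rel_compare b hB ha ha' T s _ hU _ c hc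
  have h2 := b.rel_compare a hA hb hb' T _ _ hU _ c h1
  exact h2.symm.trans hc

/-- Two sheaves which receive locally bijective maps from the same functor are isomorphic. -/
theorem AffineHom.nonempty_iso (hA : IsZariskiSheaf A) (hB : IsZariskiSheaf B)
    (ha : a.LocallyInjective) (ha' : a.LocallySurjective) (hb : b.LocallyInjective)
    (hb' : b.LocallySurjective) : Nonempty (restrictNoetherian A ≅ restrictNoetherian B) :=
  ⟨{ hom := a.compare b hB ha ha'
     inv := b.compare a hA hb hb'
     hom_inv_id := a.compare_comp_compare b hA hB ha ha' hb hb'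
     inv_hom_id := b.compare_comp_compare a hB hA hb hb' ha ha' }⟩

end Gluing

/-! ### Reduction of `Φ^q` to the groups `H^q(X_T, Ẽ_T)` for affine noetherian `T`. -/

section TildeCohomology

variable {X S : Scheme.{u}} (f : X ⟶ S) (E : BigZariskiSheaf X) (q : ℕ)

/-- The functor `T ↦ H^q(X_T, Ẽ_T)`. -/
def tildeCoh : (Over S)ᵒᵖ ⥤ AddCommGrpCat.{u} where
  obj T := coh (tildeSheaf f E T.unop.hom) q
  map h := cohMap (prodMap f h.unop.left (Over.w h.unop)).base
    (tildeHom f E h.unop.left (Over.w h.unop)) q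
  map_id T := by
    have e : (prodMap f (𝟙 T.unop.left) (Over.w (𝟙 T.unop))).base = 𝟙 _ :=
      congrArg (fun k : pullback f T.unop.hom ⟶ pullback f T.unop.hom => k.base)
        (prodMap_id f _ rfl _)
    exact (cohMap_congr e _ _ (tildeHom_id f E T.unop.hom _ e) q).trans (cohMap_id _ q)
  map_comp {T T' T''} h k := by
    have e : (prodMap f (k.unop.left ≫ h.unop.left) (Over.w (k.unop ≫ h.unop))).base =
        (prodMap f k.unop.left (Over.w k.unop)).base ≫
          (prodMap f h.unop.left (Over.w h.unop)).base :=
      congrArg (fun k : pullback f T''.unop.hom ⟶ pullback f T.unop.hom => k.base)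
        (prodMap_comp f h.unop.left (Over.w h.unop) k.unop.left (Over.w k.unop)
          (k.unop.left ≫ h.unop.left) (Over.w (k.unop ≫ h.unop)) rfl).symm
    exact (cohMap_congr e _ _ (tildeHom_comp f E h.unop.left (Over.w h.unop) k.unop.left
      (Over.w k.unop) (Over.w (k.unop ≫ h.unop)) e) q).trans (cohMap_comp _ _ _ _ q).symm

/-- The edge morphism `H^q(X_T, Ẽ_T) ⟶ Γ(T, R^q f_{T*} Ẽ_T)`. -/
def tildeEdge : AffineHom (tildeCoh f E q) (Phi f E q) where
  app T _ := (edge (pullback.snd f T.hom).base (tildeSheaf f E T.hom) q).hom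
  naturality _ _ h c := ConcreteCategory.congr_hom
    (cohMap_edge (prodMap_base_snd f h.left (Over.w h)) (tildeHom f E h.left (Over.w h)) q) c

theorem tildeEdge_locallyInjective : (tildeEdge f E q).LocallyInjective := by
  intro T hT c hc t
  obtain ⟨V, htV, hV⟩ := exists_open_cohMap_eq_zero _ _ q c hc t
  refine ⟨V, htV, fun T' hT' h hh => ?_⟩
  refine hV (prodMap f h.left (Over.w h)).base ?_ _
  intro y
  have h1 : pullback.snd f T.hom (prodMap f h.left (Over.w h) y) =
      h.left (pullback.snd f T'.hom y) :=
    ConcreteCategory.congr_hom (prodMap_base_snd f h.left (Over.w h)) y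
  exact (congrArg (· ∈ V) h1).mpr (hh _)

theorem tildeEdge_locallySurjective : (tildeEdge f E q).LocallySurjective := by
  intro T _ s t
  obtain ⟨V, htV, hV⟩ := exists_open_edge_eq (pullback.snd f T.hom).base _ q s t
  refine ⟨V, htV, fun T' hT' h hh => ?_⟩
  exact hV (prodMap_base_snd f h.left (Over.w h)) hh _

theorem isZariskiSheaf_phi : IsZariskiSheaf (Phi f E q) := fun T => isSheaf_phi f E q T.hom

theorem isZariskiSheaf_bigZariskiSheaf (G : BigZariskiSheaf S) : IsZariskiSheaf G.obj :=
  fun T => isSheaf_opensOver G T.hom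

/-- To identify `Φ^q` with a sheaf it suffices to identify `H^q(X_T, Ẽ_T)` with its sections for
affine noetherian `T`. -/
theorem nonempty_phi_iso (G : BigZariskiSheaf S) (b : AffineHom (tildeCoh f E q) G.obj)
    (hb : ∀ T hT, Function.Bijective (b.app T hT)) :
    Nonempty (restrictNoetherian (Phi f E q) ≅ restrictNoetherian G.obj) := by
  refine (tildeEdge f E q).nonempty_iso b (isZariskiSheaf_phi f E q)
    (isZariskiSheaf_bigZariskiSheaf G) (tildeEdge_locallyInjective f E q)
    (tildeEdge_locallySurjective f E q) ?_ ?_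
  · intro T hT c hc t
    refine ⟨⊤, trivial, fun T' _ h _ => ?_⟩
    rw [(injective_iff_map_eq_zero _).mp (hb T hT).1 c hc, map_zero]
  · intro T _ s t
    exact ⟨⊤, trivial, fun T' hT' h _ => (hb T' hT').2 _⟩

end TildeCohomology

/-! ### Homomorphisms from power series rings which kill a power of the ideal of the variables. -/

section PowerSeries

variable {σ : Type*} [Fintype σ] {A : Type*} [CommRing A]

theorem mem_span_X_of_constantCoeff_eq_zero (b : MvPowerSeries σ A)
    (hb : MvPowerSeries.constantCoeff b = 0) :
    b ∈ Ideal.span (Set.range (MvPowerSeries.X : σ → MvPowerSeries σ A)) := by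
  classical
  have hex (m : σ →₀ ℕ) (hm : m ≠ 0) : ∃ i, m i ≠ 0 := by
    by_contra! h
    exact hm (Finsupp.ext h)
  -- Each nonconstant monomial is assigned to one variable dividing it. The series `c i` collects
  -- the monomials assigned to `i`, divided by that variable, so that every monomial is counted
  -- exactly once in the sum of the `c i * X i`.
  let ν (m : σ →₀ ℕ) : Option σ := if hm : m = 0 then none else some (hex m hm).choose
  have hν (m : σ →₀ ℕ) (i : σ) (h : ν m = some i) : m i ≠ 0 := by
    by_cases hm : m = 0
    · simp [ν, hm] at h
    · simp only [ν, hm, dite_false, Option.some.injEq] at h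
      rw [← h]
      exact (hex m hm).choose_spec
  let c (i : σ) : MvPowerSeries σ A := fun m =>
    if ν (m + Finsupp.single i 1) = some i then
      MvPowerSeries.coeff (m + Finsupp.single i 1) b else 0
  have hc (i : σ) (m : σ →₀ ℕ) : MvPowerSeries.coeff m (c i * MvPowerSeries.X i) =
      if ν m = some i then MvPowerSeries.coeff m b else 0 := by
    rw [MvPowerSeries.X, MvPowerSeries.coeff_mul_monomial, mul_one]
    split_ifs with h1 h2 h2
    · change (if _ then _ else _) = _
      rw [tsub_add_cancel_of_le h1, if_pos h2]
    · change (if _ then _ else _) = _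
      rw [tsub_add_cancel_of_le h1, if_neg h2]
    · exact absurd (Finsupp.single_le_iff.mpr (Nat.one_le_iff_ne_zero.mpr (hν m i h2))) h1
    · rfl
  have hsum : b = ∑ i, c i * MvPowerSeries.X i := by
    ext m
    rw [map_sum]
    simp_rw [hc]
    by_cases hm : m = 0
    · subst hm
      have : ν 0 = none := by simp [ν]
      simp only [this, reduceCtorEq, if_false, Finset.sum_const_zero]
      exact hb
    · obtain ⟨i, hi⟩ : ∃ i, ν m = some i := ⟨_, dif_neg hm⟩
      simp [hi]
  rw [hsum]
  exact Ideal.sum_mem _ fun i _ => Ideal.mul_mem_left _ _ (Ideal.subset_span ⟨i, rfl⟩)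

/-- Modulo every power of the ideal of the variables a power series is a polynomial. -/
theorem exists_polynomial_sub_mem_pow (n : ℕ) (b : MvPowerSeries σ A) :
    ∃ p : MvPolynomial σ A, b - (p : MvPowerSeries σ A) ∈
      Ideal.span (Set.range (MvPowerSeries.X : σ → MvPowerSeries σ A)) ^ n := by
  induction n generalizing b with
  | zero => exact ⟨0, by simp⟩
  | succ n ih =>
    have h := mem_span_X_of_constantCoeff_eq_zero
      (b - MvPowerSeries.C (MvPowerSeries.constantCoeff b)) (by simp)
    obtain ⟨c, hc⟩ := Ideal.mem_span_range_iff_exists_fun.mp h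
    choose p hp using fun i => ih (c i)
    refine ⟨MvPolynomial.C (MvPowerSeries.constantCoeff b) + ∑ i, p i * MvPolynomial.X i, ?_⟩
    have hs : ((∑ i, p i * MvPolynomial.X i : MvPolynomial σ A) : MvPowerSeries σ A) =
        ∑ i, (p i : MvPowerSeries σ A) * MvPowerSeries.X i := by
      refine (map_sum (MvPolynomial.coeToMvPowerSeries.ringHom (R := A) (σ := σ))
        (fun i => p i * MvPolynomial.X i) Finset.univ).trans ?_
      refine Finset.sum_congr rfl fun i _ => ?_
      exact (map_mul _ _ _).trans (congrArg _ (MvPolynomial.coe_X i))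
    rw [MvPolynomial.coe_add, MvPolynomial.coe_C, hs, ← sub_sub, ← hc, ← Finset.sum_sub_distrib]
    refine Ideal.sum_mem _ fun i _ => ?_
    rw [← sub_mul, pow_succ]
    exact Ideal.mul_mem_mul (hp i) (Ideal.subset_span ⟨i, rfl⟩)

/-- Two homomorphisms on power series which agree on the constants and the variables and kill the
same power of the ideal of the variables agree. -/
theorem ringHom_eq_of_X {D : Type*} [CommRing D] (φ ψ : MvPowerSeries σ A →+* D) (n : ℕ)
    (hφ : ∀ b ∈ Ideal.span (Set.range (MvPowerSeries.X : σ → MvPowerSeries σ A)) ^ n, φ b = 0)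
    (hψ : ∀ b ∈ Ideal.span (Set.range (MvPowerSeries.X : σ → MvPowerSeries σ A)) ^ n, ψ b = 0)
    (hC : ∀ a, φ (MvPowerSeries.C a) = ψ (MvPowerSeries.C a))
    (hX : ∀ i, φ (MvPowerSeries.X i) = ψ (MvPowerSeries.X i)) : φ = ψ := by
  have hp : φ.comp MvPolynomial.coeToMvPowerSeries.ringHom =
      ψ.comp MvPolynomial.coeToMvPowerSeries.ringHom := by
    apply MvPolynomial.ringHom_ext
    · intro a
      simpa using hC a
    · intro i
      simpa using hX i
  ext b
  obtain ⟨p, hb⟩ := exists_polynomial_sub_mem_pow n b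
  have h1 := hφ _ hb
  have h2 := hψ _ hb
  rw [map_sub, sub_eq_zero] at h1 h2
  rw [h1, h2]
  exact RingHom.congr_fun hp p

theorem exists_span_pow_eq_bot {D : Type*} [CommRing D] (a : σ → D) (ha : ∀ i, IsNilpotent (a i)) :
    ∃ n, Ideal.span (Set.range a) ^ n = ⊥ := by
  have hfg : (Ideal.span (Set.range a)).FG :=
    ⟨(Set.finite_range a).toFinset, by rw [Set.Finite.coe_toFinset]⟩
  exact hfg.isNilpotent_iff_le_nilradical.mpr (Ideal.span_le.mpr (by
    rintro _ ⟨i, rfl⟩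
    exact ha i))

/-- Evaluation of power series at nilpotent elements. -/
theorem exists_ringHom_of_isNilpotent {D : Type*} [CommRing D] (φ₀ : A →+* D) (a : σ → D)
    (ha : ∀ i, IsNilpotent (a i)) :
    ∃ φ : MvPowerSeries σ A →+* D, (∀ r, φ (MvPowerSeries.C r) = φ₀ r) ∧
      (∀ i, φ (MvPowerSeries.X i) = a i) ∧
      ∃ n, ∀ b ∈ Ideal.span (Set.range (MvPowerSeries.X : σ → MvPowerSeries σ A)) ^ n, φ b = 0 := by
  -- With this `n` the evaluation of polynomials at `a` kills the `n`-th power of the ideal of the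
  -- variables, so it factors through the truncation of power series.
  obtain ⟨n, hn⟩ := exists_span_pow_eq_bot a ha
  let ev := MvPolynomial.eval₂Hom φ₀ a
  have hev : ∀ p ∈ MvPolynomial.idealOfVars σ A ^ n, ev p = 0 := by
    intro p hp
    have h1 := Ideal.mem_map_of_mem ev hp
    rw [Ideal.map_pow, MvPolynomial.idealOfVars, Ideal.map_span, ← Set.range_comp] at h1
    have h2 : (fun i => ev (MvPolynomial.X i)) = a := by
      ext i
      simp [ev]
    have h3 : (ev ∘ MvPolynomial.X) = a := h2
    rw [h3, hn] at h1
    exact h1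
  let φ : MvPowerSeries σ A →+* D := (Ideal.Quotient.lift _ ev hev).comp
    (MvPowerSeries.truncTotalAlgHom σ A n).toRingHom
  have hφ (p : MvPolynomial σ A) : φ p = ev p :=
    (congrArg (Ideal.Quotient.lift _ ev hev)
      ((MvPowerSeries.truncTotalAlgHom σ A n).commutes p)).trans (Ideal.Quotient.lift_mk _ ev hev)
  have hX (i : σ) : φ (MvPowerSeries.X i) = a i := by
    rw [← MvPolynomial.coe_X, hφ]
    simp [ev]
  refine ⟨φ, fun r => ?_, hX, n, fun b hb => ?_⟩
  · rw [← MvPolynomial.coe_C, hφ]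
    simp [ev]
  · have h1 := Ideal.mem_map_of_mem φ hb
    have h3 : φ ∘ MvPowerSeries.X = a := funext hX
    rw [Ideal.map_pow, Ideal.map_span, ← Set.range_comp, h3, hn] at h1
    exact h1

end PowerSeries

/-! ### Local coordinates on a formal Lie group. -/

section Coordinates

variable {X : Scheme.{u}}

/-- Coordinates on the points of `E` with values in the schemes over an open subset `W`. -/
structure Coord (E : BigZariskiSheaf X) (W : X.Opens) where
  /-- the number of coordinates -/
  dim : ℕ
  /-- the coordinates of a point -/
  coord (Z : Over X) (hZ : ∀ z, Z.hom z ∈ W) : E.obj.obj (op Z) → Fin dim → Γ(Z.left, ⊤)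
  naturality {Z Z' : Over X} (hZ : ∀ z, Z.hom z ∈ W) (hZ' : ∀ z, Z'.hom z ∈ W) (h : Z' ⟶ Z)
    (s : E.obj.obj (op Z)) (i : Fin dim) :
    coord Z' hZ' (E.obj.map h.op s) i = h.left.appTop (coord Z hZ s i)
  injective (Z : Over X) (hZ : ∀ z, Z.hom z ∈ W) : Function.Injective (coord Z hZ)
  coord_zero (Z : Over X) (hZ : ∀ z, Z.hom z ∈ W) (i : Fin dim) : coord Z hZ 0 i = 0
  coord_reduced (Z : Over X) (hZ : ∀ z, Z.hom z ∈ W) [IsReduced Z.left] (s : E.obj.obj (op Z))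
    (i : Fin dim) : coord Z hZ s i = 0
  exists_of_isNilpotent (Z : Over X) (hZ : ∀ z, Z.hom z ∈ W) (t : Fin dim → Γ(Z.left, ⊤))
    (ht : ∀ i, IsNilpotent (t i)) : ∃ s, coord Z hZ s = t

theorem eq_of_locally_map_eq {Z : Scheme.{u}} (a b : Γ(Z, ⊤))
    (h : ∀ z : Z, ∃ U : Z.Opens, z ∈ U ∧ Z.presheaf.map (homOfLE (le_top : U ≤ ⊤)).op a =
      Z.presheaf.map (homOfLE (le_top : U ≤ ⊤)).op b) : a = b := by
  choose U hzU hU using h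
  exact TopCat.Sheaf.eq_of_locally_eq' Z.sheaf U ⊤ (fun z => homOfLE le_top)
    (fun z _ => Opens.mem_iSup.mpr ⟨z, hzU z⟩) a b hU

variable {A : CommRingCat.{u}} {d : ℕ}

/-- Near each point both homomorphisms kill some power of the ideal of the variables, and modulo
that power a series is a polynomial. So a continuous homomorphism of `A`-algebras is determined by
the images of the variables. -/
theorem spfPoints_ext {T : Over (Spec A)} (φ ψ : (spfPoints A (MvPowerSeries (Fin d) A)
      (Ideal.span (Set.range MvPowerSeries.X))).obj (op T))
    (h : ∀ i, φ.1 (MvPowerSeries.X i) = ψ.1 (MvPowerSeries.X i)) : φ = ψ := by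
  apply Subtype.ext
  ext b
  apply eq_of_locally_map_eq
  intro t
  obtain ⟨U, hU, n, hn⟩ := φ.2.2 t
  obtain ⟨V, hV, m, hm⟩ := ψ.2.2 t
  refine ⟨U ⊓ V, ⟨hU, hV⟩, ?_⟩
  have hres (W : T.left.Opens) (h : U ⊓ V ≤ W) (x : Γ(T.left, ⊤))
      (hx : T.left.presheaf.map (homOfLE (le_top : W ≤ ⊤)).op x = 0) :
      T.left.presheaf.map (homOfLE (le_top : U ⊓ V ≤ ⊤)).op x = 0 := by
    have : (homOfLE (le_top : U ⊓ V ≤ ⊤)).op =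
      (homOfLE (le_top : W ≤ ⊤)).op ≫ (homOfLE h).op := rfl
    rw [this, Functor.map_comp, ConcreteCategory.comp_apply, hx, map_zero]
  have hC (a : A) : φ.1 (MvPowerSeries.C a) = ψ.1 (MvPowerSeries.C a) :=
    (RingHom.congr_fun φ.2.1 a).trans (RingHom.congr_fun ψ.2.1 a).symm
  refine RingHom.congr_fun (ringHom_eq_of_X
    ((T.left.presheaf.map (homOfLE (le_top : U ⊓ V ≤ ⊤)).op).hom.comp φ.1)
    ((T.left.presheaf.map (homOfLE (le_top : U ⊓ V ≤ ⊤)).op).hom.comp ψ.1) (max n m)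
    (fun b hb => ?_) (fun b hb => ?_) (fun a => ?_) (fun i => ?_)) b
  · exact hres U inf_le_left _ (hn b (Ideal.pow_le_pow_right (le_max_left n m) hb))
  · exact hres V inf_le_right _ (hm b (Ideal.pow_le_pow_right (le_max_right n m) hb))
  · exact congrArg _ (hC a)
  · exact congrArg _ (h i)

/-- By continuity the images of the variables are locally nilpotent. -/
theorem spfPoints_reduced {T : Over (Spec A)} [IsReduced T.left]
    (φ : (spfPoints A (MvPowerSeries (Fin d) A)
      (Ideal.span (Set.range MvPowerSeries.X))).obj (op T)) (i : Fin d) :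
    φ.1 (MvPowerSeries.X i) = 0 := by
  apply eq_of_locally_map_eq
  intro t
  obtain ⟨U, hU, n, hn⟩ := φ.2.2 t
  refine ⟨U, hU, ?_⟩
  rw [map_zero]
  have h := hn (MvPowerSeries.X i ^ n)
    (Ideal.pow_mem_pow (Ideal.subset_span (Set.mem_range_self i)) n)
  rw [map_pow, map_pow] at h
  exact eq_zero_of_pow_eq_zero h

theorem exists_spfPoints {T : Over (Spec A)} (t : Fin d → Γ(T.left, ⊤))
    (ht : ∀ i, IsNilpotent (t i)) : ∃ φ : (spfPoints A (MvPowerSeries (Fin d) A)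
      (Ideal.span (Set.range MvPowerSeries.X))).obj (op T),
      ∀ i, φ.1 (MvPowerSeries.X i) = t i := by
  obtain ⟨φ, hC, hX, n, hn⟩ := exists_ringHom_of_isNilpotent
    ((Scheme.ΓSpecIso A).inv ≫ T.hom.appTop).hom t ht
  refine ⟨⟨φ, RingHom.ext hC, fun z => ⟨⊤, trivial, n, fun b hb => ?_⟩⟩, hX⟩
  rw [hn b hb, map_zero]

section Construction

variable (E : BigZariskiSheaf X) (j : Spec A ⟶ X) [IsOpenImmersion j]

/-- The factorization of an `X`-scheme through an open subscheme. -/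
def overLift (Z : Over X) (hZ : ∀ z, Z.hom z ∈ j.opensRange) : Over (Spec A) :=
  Over.mk (IsOpenImmersion.lift j Z.hom (by
    rintro _ ⟨z, rfl⟩
    exact hZ z))

theorem overLift_hom (Z : Over X) (hZ : ∀ z, Z.hom z ∈ j.opensRange) :
    (overLift j Z hZ).hom ≫ j = Z.hom :=
  IsOpenImmersion.lift_fac ..

/-- The factorization of an `X`-scheme through an open subscheme does not change its points. -/
def overLiftIso (Z : Over X) (hZ : ∀ z, Z.hom z ∈ j.opensRange) :
    (Over.map j).obj (overLift j Z hZ) ≅ Z :=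
  Over.isoMk (Iso.refl Z.left) ((Category.id_comp _).trans (overLift_hom j Z hZ).symm)

/-- The functoriality of `overLift`. -/
def overLiftMap {Z Z' : Over X} (hZ : ∀ z, Z.hom z ∈ j.opensRange)
    (hZ' : ∀ z, Z'.hom z ∈ j.opensRange) (h : Z' ⟶ Z) : overLift j Z' hZ' ⟶ overLift j Z hZ :=
  Over.homMk (U := overLift j Z' hZ') (V := overLift j Z hZ) h.left (by
    rw [← cancel_mono j]
    refine (Category.assoc _ _ _).trans ?_
    rw [overLift_hom, overLift_hom]
    exact Over.w h)

theorem overLiftMap_iso {Z Z' : Over X} (hZ : ∀ z, Z.hom z ∈ j.opensRange)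
    (hZ' : ∀ z, Z'.hom z ∈ j.opensRange) (h : Z' ⟶ Z) :
    (Over.map j).map (overLiftMap j hZ hZ' h) ≫ (overLiftIso j Z hZ).hom =
      (overLiftIso j Z' hZ').hom ≫ h := by
  ext1
  exact (Category.comp_id _).trans (Category.id_comp _).symm

variable {E j} (e : (Over.map j).op ⋙ E.obj ⋙ forget AddCommGrpCat.{u} ≅
        spfPoints A (MvPowerSeries (Fin d) A) (Ideal.span (Set.range MvPowerSeries.X)))

/-- The point of the formal scheme which corresponds to a section of `E`. -/
def toSpf (Z : Over X) (hZ : ∀ z, Z.hom z ∈ j.opensRange) (s : E.obj.obj (op Z)) :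
    (spfPoints A (MvPowerSeries (Fin d) A) (Ideal.span (Set.range MvPowerSeries.X))).obj
      (op (overLift j Z hZ)) :=
  e.hom.app (op (overLift j Z hZ)) (E.obj.map (overLiftIso j Z hZ).hom.op s)

theorem toSpf_naturality {Z Z' : Over X} (hZ : ∀ z, Z.hom z ∈ j.opensRange)
    (hZ' : ∀ z, Z'.hom z ∈ j.opensRange) (h : Z' ⟶ Z) (s : E.obj.obj (op Z)) :
    toSpf e Z' hZ' (E.obj.map h.op s) =
      (spfPoints A _ _).map (overLiftMap j hZ hZ' h).op (toSpf e Z hZ s) := by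
  have h1 := ConcreteCategory.congr_hom (e.hom.naturality (overLiftMap j hZ hZ' h).op)
    (E.obj.map (overLiftIso j Z hZ).hom.op s)
  refine Eq.trans ?_ h1
  refine congrArg (e.hom.app (op (overLift j Z' hZ'))) ?_
  exact map_map_apply E _ _ _ _ (overLiftMap_iso j hZ hZ' h).symm s

theorem toSpf_bijective (Z : Over X) (hZ : ∀ z, Z.hom z ∈ j.opensRange) :
    Function.Bijective (toSpf e Z hZ) := by
  refine Function.Bijective.comp (ConcreteCategory.bijective_of_isIso
    (e.hom.app (op (overLift j Z hZ)))) ?_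
  have : IsIso (E.obj.map (overLiftIso j Z hZ).hom.op) := inferInstance
  exact ConcreteCategory.bijective_of_isIso _

variable (he : ∀ i : Fin d, (e.hom.app (op (Over.mk (𝟙 (Spec A))))
        (0 : E.obj.obj (op (Over.mk (𝟙 (Spec A) ≫ j))))).1 (MvPowerSeries.X i) = 0)

-- The normalization of the origin is given only over `Spec A`. As this is the terminal scheme over
-- itself, naturality spreads it to all schemes over `Spec A`.
include he in
theorem toSpf_zero (Z : Over X) (hZ : ∀ z, Z.hom z ∈ j.opensRange) (i : Fin d) :
    (toSpf e Z hZ 0).1 (MvPowerSeries.X i) = 0 := by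
  let t : overLift j Z hZ ⟶ Over.mk (𝟙 (Spec A)) := Over.mkIdTerminal.from _
  have h1 := ConcreteCategory.congr_hom (e.hom.naturality t.op)
    (0 : E.obj.obj (op (Over.mk (𝟙 (Spec A) ≫ j))))
  have h2 : toSpf e Z hZ 0 = (spfPoints A _ _).map t.op (e.hom.app (op (Over.mk (𝟙 (Spec A))))
      (0 : E.obj.obj (op (Over.mk (𝟙 (Spec A) ≫ j))))) := by
    refine Eq.trans ?_ h1
    refine congrArg (e.hom.app (op (overLift j Z hZ))) ?_
    exact (map_zero (E.obj.map (overLiftIso j Z hZ).hom.op).hom).trans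
      (map_zero (E.obj.map ((Over.map j).map t).op).hom).symm
  rw [h2]
  exact (congrArg t.left.appTop (he i)).trans (map_zero _)

/-- The coordinates given by an isomorphism with a formal affine space. -/
def coordOfIso : Coord E j.opensRange where
  dim := d
  coord Z hZ s i := (toSpf e Z hZ s).1 (MvPowerSeries.X i)
  naturality hZ hZ' h s i :=
    congrArg (fun φ => φ.1 (MvPowerSeries.X i)) (toSpf_naturality e hZ hZ' h s)
  injective Z hZ s s' h := (toSpf_bijective e Z hZ).1 (spfPoints_ext _ _ (congrFun h))
  coord_zero Z hZ i := toSpf_zero e he Z hZ i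
  coord_reduced Z hZ hr s i := by
    have : IsReduced (overLift j Z hZ).left := hr
    exact spfPoints_reduced _ i
  exists_of_isNilpotent Z hZ t ht := by
    obtain ⟨φ, hφ⟩ := exists_spfPoints (T := overLift j Z hZ) t ht
    obtain ⟨s, rfl⟩ := (toSpf_bijective e Z hZ).2 φ
    exact ⟨s, funext hφ⟩

end Construction

theorem IsFormalLieGroup.exists_coord {E : BigZariskiSheaf X} (hE : IsFormalLieGroup E) (x : X) :
    ∃ W : X.Opens, x ∈ W ∧ Nonempty (Coord E W) := by
  obtain ⟨A, j, _, hx, d, e, he⟩ := hE x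
  exact ⟨j.opensRange, hx, ⟨coordOfIso e he⟩⟩

end Coordinates

/-! ### To first order the group law is the addition of coordinates. -/

section GroupLaw

/-- A tuple of elements of an ideal of square zero is a point of a ring of dual numbers. -/
theorem exists_algHom_dualNumbers {D : Type*} [CommRing D] {ι : Type*} [Fintype ι] [DecidableEq ι]
    (a b : ι → D) (𝔟 : Ideal D) (h𝔟 : 𝔟 ^ 2 = ⊥) (ha : ∀ i, a i ∈ 𝔟) (hb : ∀ i, b i ∈ 𝔟) :
    ∃ p : TrivSqZeroExt D ((ι → D) × (ι → D)) →ₐ[D] D,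
      (∀ i, p (TrivSqZeroExt.inr (Pi.single i 1, 0)) = a i) ∧
      ∀ i, p (TrivSqZeroExt.inr (0, Pi.single i 1)) = b i := by
  let ℓ : (ι → D) × (ι → D) →ₗ[D] D :=
    LinearMap.coprod (∑ i, (LinearMap.toSpanSingleton D D (a i)).comp (LinearMap.proj i))
      (∑ i, (LinearMap.toSpanSingleton D D (b i)).comp (LinearMap.proj i))
  have hℓ (m) : ℓ m = ∑ i, m.1 i * a i + ∑ i, m.2 i * b i := by
    simp [ℓ]
  have hmem (m) : ℓ m ∈ 𝔟 := by
    rw [hℓ]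
    exact Ideal.add_mem _ (Ideal.sum_mem _ fun j _ => Ideal.mul_mem_left _ _ (ha j))
      (Ideal.sum_mem _ fun j _ => Ideal.mul_mem_left _ _ (hb j))
  have hℓℓ (m m') : ℓ m * ℓ m' = 0 := by
    have : ℓ m * ℓ m' ∈ 𝔟 ^ 2 := by
      rw [sq]
      exact Ideal.mul_mem_mul (hmem m) (hmem m')
    rwa [h𝔟] at this
  have hp (m) : TrivSqZeroExt.liftEquivOfComm ⟨ℓ, hℓℓ⟩ (TrivSqZeroExt.inr m) = ℓ m := by
    rw [TrivSqZeroExt.liftEquivOfComm_apply, TrivSqZeroExt.lift_apply_inr]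
  refine ⟨TrivSqZeroExt.liftEquivOfComm ⟨ℓ, hℓℓ⟩, fun i => ?_, fun i => ?_⟩
  · rw [hp, hℓ]
    simp [Pi.single_apply]
  · rw [hp, hℓ]
    simp [Pi.single_apply]

variable {X : Scheme.{u}}

/-- The morphism of affine `X`-schemes given by a homomorphism of rings. -/
def specHom {D D' : CommRingCat.{u}} {z : Spec D ⟶ X} {z' : Spec D' ⟶ X} (φ : D ⟶ D')
    (w : Spec.map φ ≫ z = z') : Over.mk z' ⟶ Over.mk z :=
  Over.homMk (U := Over.mk z') (V := Over.mk z) (Spec.map φ) w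

theorem apply_mem_of_comp_eq {Y Y' : Scheme.{u}} {z : Y ⟶ X} {z' : Y' ⟶ X} {m : Y' ⟶ Y}
    (w : m ≫ z = z') {W : X.Opens} (hz : ∀ x, z x ∈ W) (x : Y') : z' x ∈ W := by
  rw [← w, Scheme.Hom.comp_apply]
  exact hz _

namespace Coord

variable {E : BigZariskiSheaf X} {W : X.Opens} (κ : Coord E W)

/-- The coordinates of a point of `E` with values in a ring. -/
def ringCoord {D : CommRingCat.{u}} (z : Spec D ⟶ X) (hz : ∀ x, z x ∈ W)
    (s : E.obj.obj (op (Over.mk z))) (i : Fin κ.dim) : D :=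
  (Scheme.ΓSpecIso D).hom (κ.coord (Over.mk z) hz s i)

section Ring

variable {D : CommRingCat.{u}} {z : Spec D ⟶ X} (hz : ∀ x, z x ∈ W)

theorem ringCoord_map {D' : CommRingCat.{u}} {z' : Spec D' ⟶ X} (hz' : ∀ x, z' x ∈ W) (φ : D ⟶ D')
    (w : Spec.map φ ≫ z = z') (s : E.obj.obj (op (Over.mk z))) (i : Fin κ.dim) :
    κ.ringCoord z' hz' (E.obj.map (specHom φ w).op s) i = φ (κ.ringCoord z hz s i) := by
  refine (congrArg _ (κ.naturality hz hz' (specHom φ w) s i)).trans ?_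
  exact ConcreteCategory.congr_hom (Scheme.ΓSpecIso_naturality φ) _

theorem ringCoord_injective : Function.Injective (κ.ringCoord z hz) := by
  intro s s' h
  refine κ.injective _ hz (funext fun i => ?_)
  exact (ConcreteCategory.bijective_of_isIso (Scheme.ΓSpecIso D).hom).1 (congrFun h i)

theorem ringCoord_zero (i : Fin κ.dim) : κ.ringCoord z hz 0 i = 0 :=
  (congrArg _ (κ.coord_zero _ hz i)).trans (map_zero _)

theorem exists_ringCoord_eq (t : Fin κ.dim → D) (ht : ∀ i, IsNilpotent (t i)) :
    ∃ s, κ.ringCoord z hz s = t := by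
  obtain ⟨s, hs⟩ := κ.exists_of_isNilpotent (Over.mk z) hz
    (fun i => (Scheme.ΓSpecIso D).inv (t i)) fun i => (ht i).map (Scheme.ΓSpecIso D).inv.hom
  refine ⟨s, funext fun i => ?_⟩
  refine (congrArg (Scheme.ΓSpecIso D).hom (congrFun hs i)).trans ?_
  exact ConcreteCategory.congr_hom (Scheme.ΓSpecIso D).inv_hom_id (t i)

/-- In first order coordinates the group law is the addition. -/
theorem ringCoord_add_of_mul_eq_zero (s t : E.obj.obj (op (Over.mk z))) (𝔟 : Ideal D)
    (h𝔟 : 𝔟 ^ 2 = ⊥) (hs : ∀ i, κ.ringCoord z hz s i ∈ 𝔟) (ht : ∀ i, κ.ringCoord z hz t i ∈ 𝔟)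
    (i : Fin κ.dim) :
    κ.ringCoord z hz (s + t) i = κ.ringCoord z hz s i + κ.ringCoord z hz t i := by
  classical
  -- The universal case: over `Q = D ⊕ M`, with `M` of square zero, the points `σ` and `τ` have the
  -- two families of basis vectors of `M` as coordinates, and the pair `(s, t)` is a specialization
  -- of `(σ, τ)` along `p`.
  let M : Type u := (Fin κ.dim → D) × (Fin κ.dim → D)
  let Q : Type u := TrivSqZeroExt D M
  obtain ⟨p, hpa, hpb⟩ := exists_algHom_dualNumbers _ _ 𝔟 h𝔟 hs ht
  let q₁ : Q →ₐ[D] Q := TrivSqZeroExt.map ((LinearMap.inl D _ _).comp (LinearMap.fst D _ _))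
  let q₂ : Q →ₐ[D] Q := TrivSqZeroExt.map ((LinearMap.inr D _ _).comp (LinearMap.snd D _ _))
  let ι : D ⟶ CommRingCat.of Q := CommRingCat.ofHom (algebraMap D Q)
  let y : Spec (CommRingCat.of Q) ⟶ X := Spec.map ι ≫ z
  have hy : ∀ x, y x ∈ W := apply_mem_of_comp_eq rfl hz
  have wq (q : Q →ₐ[D] Q) : Spec.map (CommRingCat.ofHom q.toRingHom) ≫ y = y := by
    rw [← Category.assoc, ← Spec.map_comp]
    have : ι ≫ CommRingCat.ofHom q.toRingHom = ι :=
      CommRingCat.hom_ext (RingHom.ext fun d => q.commutes d)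
    rw [this]
  have wp : Spec.map (CommRingCat.ofHom p.toRingHom) ≫ y = z := by
    have : ι ≫ CommRingCat.ofHom p.toRingHom = 𝟙 D := by
      exact CommRingCat.hom_ext (RingHom.ext fun d => p.commutes d)
    rw [← Category.assoc, ← Spec.map_comp, this, Spec.map_id]
    exact Category.id_comp z
  have hnil (m : M) : IsNilpotent (TrivSqZeroExt.inr m : Q) :=
    ⟨2, by rw [sq, TrivSqZeroExt.inr_mul_inr]⟩
  obtain ⟨σ, hσ⟩ := κ.exists_ringCoord_eq hy
    (fun j => (TrivSqZeroExt.inr (Pi.single j 1, 0) : Q)) fun _ => hnil _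
  obtain ⟨τ, hτ⟩ := κ.exists_ringCoord_eq hy
    (fun j => (TrivSqZeroExt.inr (0, Pi.single j 1) : Q)) fun _ => hnil _
  have hσs : E.obj.map (specHom _ wp).op σ = s := by
    refine κ.ringCoord_injective hz (funext fun j => ?_)
    rw [κ.ringCoord_map hy, hσ]
    exact hpa j
  have hτt : E.obj.map (specHom _ wp).op τ = t := by
    refine κ.ringCoord_injective hz (funext fun j => ?_)
    rw [κ.ringCoord_map hy, hτ]
    exact hpb j
  -- The endomorphism `q₁` fixes `σ` and sends `τ` to the origin, so it detects the part of the
  -- coordinates of `σ + τ` coming from `σ`; symmetrically for `q₂`.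
  have h₁ : q₁ (κ.ringCoord y hy (σ + τ) i) = TrivSqZeroExt.inr (Pi.single i 1, 0) := by
    refine (κ.ringCoord_map hy hy (CommRingCat.ofHom q₁.toRingHom) (wq q₁) (σ + τ) i).symm.trans ?_
    have e₁ : E.obj.map (specHom _ (wq q₁)).op σ = σ := by
      refine κ.ringCoord_injective hy (funext fun j => ?_)
      rw [κ.ringCoord_map hy, hσ]
      exact TrivSqZeroExt.map_inr _ _
    have e₂ : E.obj.map (specHom _ (wq q₁)).op τ = 0 := by
      refine κ.ringCoord_injective hy (funext fun j => ?_)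
      rw [κ.ringCoord_map hy, hτ, ringCoord_zero]
      exact (TrivSqZeroExt.map_inr _ _).trans (TrivSqZeroExt.inr_zero _)
    rw [map_add, e₁, e₂, add_zero, hσ]
  have h₂ : q₂ (κ.ringCoord y hy (σ + τ) i) = TrivSqZeroExt.inr (0, Pi.single i 1) := by
    refine (κ.ringCoord_map hy hy (CommRingCat.ofHom q₂.toRingHom) (wq q₂) (σ + τ) i).symm.trans ?_
    have e₁ : E.obj.map (specHom _ (wq q₂)).op τ = τ := by
      refine κ.ringCoord_injective hy (funext fun j => ?_)
      rw [κ.ringCoord_map hy, hτ]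
      exact TrivSqZeroExt.map_inr _ _
    have e₂ : E.obj.map (specHom _ (wq q₂)).op σ = 0 := by
      refine κ.ringCoord_injective hy (funext fun j => ?_)
      rw [κ.ringCoord_map hy, hσ, ringCoord_zero]
      exact (TrivSqZeroExt.map_inr _ _).trans (TrivSqZeroExt.inr_zero _)
    rw [map_add, e₁, e₂, zero_add, hτ]
  -- An element of `Q` is determined by its images under `q₁` and `q₂`: there are no mixed terms
  -- because `M` is the product of the two summands.
  have h : κ.ringCoord y hy (σ + τ) i =
      (TrivSqZeroExt.inr (Pi.single i 1, Pi.single i 1) : Q) := by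
    refine TrivSqZeroExt.ext ?_ (Prod.ext ?_ ?_)
    · have := congrArg (fun x : Q => x.fst) h₁
      exact (TrivSqZeroExt.fst_map _ _).symm.trans this
    · have := congrArg (fun x : Q => x.snd.1) h₁
      exact (congrArg Prod.fst (TrivSqZeroExt.snd_map _ _)).symm.trans this
    · have := congrArg (fun x : Q => x.snd.2) h₂
      exact (congrArg Prod.snd (TrivSqZeroExt.snd_map _ _)).symm.trans this
  have hfin : κ.ringCoord z hz (s + t) i = p (κ.ringCoord y hy (σ + τ) i) := by
    rw [← hσs, ← hτt, ← map_add, κ.ringCoord_map hy]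
    rfl
  rw [hfin, h, ← hpa, ← hpb, ← map_add, ← TrivSqZeroExt.inr_add, Prod.mk_add_mk, add_zero,
    zero_add]

theorem mk_ringCoord (𝔟 : Ideal D) (s : E.obj.obj (op (Over.mk z)))
    (hz' : ∀ x, (Spec.map (CommRingCat.ofHom (Ideal.Quotient.mk 𝔟)) ≫ z) x ∈ W) (i : Fin κ.dim) :
    κ.ringCoord (Spec.map (CommRingCat.ofHom (Ideal.Quotient.mk 𝔟)) ≫ z) hz'
      (E.obj.map (specHom (CommRingCat.ofHom (Ideal.Quotient.mk 𝔟)) rfl).op s) i =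
      Ideal.Quotient.mk 𝔟 (κ.ringCoord z hz s i) :=
  κ.ringCoord_map hz hz' _ rfl s i

/-- Coordinates commute with reduction modulo `𝔟` and the origin has zero coordinates. Being the
kernel of a homomorphism, the points with coordinates in `𝔟` form a subgroup. -/
theorem ringCoord_mem_iff (𝔟 : Ideal D) (s : E.obj.obj (op (Over.mk z))) :
    (∀ i, κ.ringCoord z hz s i ∈ 𝔟) ↔
      E.obj.map (specHom (CommRingCat.ofHom (Ideal.Quotient.mk 𝔟)) rfl).op s = 0 := by
  have hz' : ∀ x, (Spec.map (CommRingCat.ofHom (Ideal.Quotient.mk 𝔟)) ≫ z) x ∈ W :=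
    apply_mem_of_comp_eq rfl hz
  rw [← (κ.ringCoord_injective hz').eq_iff, funext_iff]
  refine forall_congr' fun i => ?_
  rw [mk_ringCoord κ hz, ringCoord_zero]
  exact Ideal.Quotient.eq_zero_iff_mem.symm

/-- The points whose coordinates lie in an ideal form a subgroup, and modulo the square of the
ideal the group law is the addition of coordinates. -/
theorem ringCoord_add_mem (𝔟 : Ideal D) (s t : E.obj.obj (op (Over.mk z)))
    (hs : ∀ i, κ.ringCoord z hz s i ∈ 𝔟) (ht : ∀ i, κ.ringCoord z hz t i ∈ 𝔟) (i : Fin κ.dim) :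
    κ.ringCoord z hz (s + t) i - (κ.ringCoord z hz s i + κ.ringCoord z hz t i) ∈ 𝔟 ^ 2 := by
  have hz' : ∀ x, (Spec.map (CommRingCat.ofHom (Ideal.Quotient.mk (𝔟 ^ 2))) ≫ z) x ∈ W :=
    apply_mem_of_comp_eq rfl hz
  rw [← Ideal.Quotient.eq_zero_iff_mem, map_sub, map_add, sub_eq_zero]
  have h := κ.ringCoord_add_of_mul_eq_zero hz'
    (E.obj.map (specHom (CommRingCat.ofHom (Ideal.Quotient.mk (𝔟 ^ 2))) rfl).op s)
    (E.obj.map (specHom (CommRingCat.ofHom (Ideal.Quotient.mk (𝔟 ^ 2))) rfl).op t)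
    (𝔟.map (Ideal.Quotient.mk (𝔟 ^ 2)))
    (by rw [← Ideal.map_pow, Ideal.map_quotient_self])
    (fun j => by rw [mk_ringCoord κ hz]; exact Ideal.mem_map_of_mem _ (hs j))
    (fun j => by rw [mk_ringCoord κ hz]; exact Ideal.mem_map_of_mem _ (ht j)) i
  rw [← map_add, mk_ringCoord κ hz, mk_ringCoord κ hz, mk_ringCoord κ hz] at h
  exact h

/-- The rule for sums is applied to `(s - t) + t = s`; the coordinates of `s - t` lie in `𝔟` by the
subgroup property. -/
theorem ringCoord_sub_mem (𝔟 : Ideal D) (s t : E.obj.obj (op (Over.mk z)))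
    (hs : ∀ i, κ.ringCoord z hz s i ∈ 𝔟) (ht : ∀ i, κ.ringCoord z hz t i ∈ 𝔟) (i : Fin κ.dim) :
    κ.ringCoord z hz (s - t) i - (κ.ringCoord z hz s i - κ.ringCoord z hz t i) ∈ 𝔟 ^ 2 := by
  have h : ∀ j, κ.ringCoord z hz (s - t) j ∈ 𝔟 := by
    rw [ringCoord_mem_iff] at hs ht ⊢
    rw [map_sub, hs, ht, sub_zero]
  have h' := κ.ringCoord_add_mem hz 𝔟 (s - t) t h ht i
  rw [sub_add_cancel] at h'
  have e : κ.ringCoord z hz (s - t) i - (κ.ringCoord z hz s i - κ.ringCoord z hz t i) =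
    -(κ.ringCoord z hz s i - (κ.ringCoord z hz (s - t) i + κ.ringCoord z hz t i)) := by ring
  rw [e]
  exact neg_mem h'

end Ring

end Coord

end GroupLaw

/-! ### Affine open sets and the coverings by `D(f)` and `D(1 - f)` form a splitting basis. -/

section AffineBasis

variable {Y : Scheme.{u}}

theorem basicOpen_sup_basicOpen_one_sub {U : Y.Opens} (f : Γ(Y, U)) :
    U ≤ Y.basicOpen f ⊔ Y.basicOpen (1 - f) := by
  have h1 : Y.basicOpen (f + (1 - f)) ≤ Y.basicOpen f ⊔ Y.basicOpen (1 - f) :=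
    Y.basicOpen_add_le f (1 - f)
  rw [add_sub_cancel, Y.basicOpen_of_isUnit isUnit_one] at h1
  exact h1

/-- A property of open sets which holds for `U` if it holds for `D(f)` and `D(1 - f)` holds for
`U` if it holds for the sets `D(gᵢ)` with `gᵢ` in a finite family generating the unit ideal. -/
theorem of_basicOpen_span (𝒱 : Set Y.Opens) (p : Y.Opens → Prop) (h₀ : p ⊥)
    (h𝒱 : ∀ U ∈ 𝒱, ∀ f : Γ(Y, U), Y.basicOpen f ∈ 𝒱)
    (hp : ∀ U V : Y.Opens, V ≤ U → p U → p V)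
    (hs : ∀ U ∈ 𝒱, ∀ f : Γ(Y, U), p (Y.basicOpen f) → p (Y.basicOpen (1 - f)) → p U)
    {ι : Type*} (s : Finset ι) (U : Y.Opens) (hU : U ∈ 𝒱) (a g : ι → Γ(Y, U))
    (hag : ∑ i ∈ s, a i * g i = 1) (hg : ∀ i ∈ s, p (Y.basicOpen (g i))) : p U := by
  classical
  induction s using Finset.induction_on generalizing U with
  | empty =>
    -- An empty sum equal to `1` forces `1 = 0` on `U`.
    have : U = ⊥ := by
      rw [← Y.basicOpen_of_isUnit (isUnit_one : IsUnit (1 : Γ(Y, U))), ← hag, Finset.sum_empty]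
      exact Y.basicOpen_zero U
    rwa [this]
  | insert j s hj ih =>
    rw [Finset.sum_insert hj] at hag
    -- `U` is covered by `D(aⱼ gⱼ)`, which lies in `D(gⱼ)`, and `D(1 - aⱼ gⱼ)`. On the latter the
    -- sum of the remaining `aᵢ gᵢ` is the unit `1 - aⱼ gⱼ`; dividing by it gives a relation with
    -- one generator fewer.
    refine hs U hU (a j * g j) (hp _ _ ?_ (hg j (Finset.mem_insert_self j s))) ?_
    · rw [Y.basicOpen_mul]
      exact inf_le_right
    · have hle : Y.basicOpen (1 - a j * g j) ≤ U := Y.basicOpen_le _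
      let ρ := Y.presheaf.map (homOfLE hle).op
      have hu : IsUnit (ρ (1 - a j * g j)) := RingedSpace.isUnit_res_basicOpen _ _
      obtain ⟨v, hv⟩ := hu.exists_left_inv
      refine ih _ (h𝒱 U hU _) (fun i => v * ρ (a i)) (fun i => ρ (g i)) ?_ fun i hi => ?_
      · have h1 : 1 - a j * g j = ∑ i ∈ s, a i * g i := by rw [← hag, add_sub_cancel_left]
        rw [← hv, congrArg ρ h1, map_sum, Finset.mul_sum]
        refine Finset.sum_congr rfl fun i _ => ?_
        rw [map_mul, mul_assoc]
      · refine hp _ _ ?_ (hg i (Finset.mem_insert_of_mem hi))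
        rw [Y.basicOpen_res]
        exact inf_le_right

/-- The splitting basis formed by a class of affine open sets which is stable under the passage to
basic open subsets. -/
def affineBasis (𝒱 : Set Y.Opens) (ha : ∀ U ∈ 𝒱, IsAffineOpen U)
    (h𝒱 : ∀ U ∈ 𝒱, ∀ f : Γ(Y, U), Y.basicOpen f ∈ 𝒱) : SplittingBasis Y where
  opens := 𝒱
  split U U₁ U₂ := U ∈ 𝒱 ∧ ∃ f : Γ(Y, U), U₁ = Y.basicOpen f ∧ U₂ = Y.basicOpen (1 - f)
  left_le := by
    rintro U _ _ ⟨-, f, rfl, rfl⟩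
    exact Y.basicOpen_le f
  right_le := by
    rintro U _ _ ⟨-, f, rfl, rfl⟩
    exact Y.basicOpen_le (1 - f)
  le_sup := by
    rintro U _ _ ⟨-, f, rfl, rfl⟩
    exact basicOpen_sup_basicOpen_one_sub f
  inf_mem := by
    rintro U _ _ ⟨hU, f, rfl, rfl⟩
    have := h𝒱 U hU (f * (1 - f))
    rwa [Y.basicOpen_mul] at this
  of_locally p h₀ hp hs U hU h := by
    -- The basic open sets with the property cover `U`, so the functions defining them generate the
    -- unit ideal, and finitely many suffice.
    have hspan : Ideal.span {g : Γ(Y, U) | p (Y.basicOpen g)} = ⊤ := by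
      rw [← (ha U hU).self_le_iSup_basicOpen_iff]
      intro x hx
      obtain ⟨V, hxV, hVU, hV⟩ := h x hx
      obtain ⟨g, hgV, hxg⟩ := (ha U hU).exists_basicOpen_le ⟨x, hxV⟩ hx
      exact Opens.mem_iSup.mpr ⟨⟨g, hp _ _ hgV hV⟩, hxg⟩
    have h1 : (1 : Γ(Y, U)) ∈ Ideal.span {g : Γ(Y, U) | p (Y.basicOpen g)} := by
      rw [hspan]
      trivial
    obtain ⟨a, t, ht, -, hsum⟩ := Submodule.mem_span_iff_exists_finset_subset.mp h1
    exact of_basicOpen_span 𝒱 p h₀ h𝒱 hp (fun U hU f => hs U _ _ ⟨hU, f, rfl, rfl⟩) t U hU a id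
      hsum fun i hi => ht hi

end AffineBasis

/-! ### Coordinates of sections over open subsets. -/

section OpenCoordinates

namespace Coord

variable {X : Scheme.{u}} {E : BigZariskiSheaf X} {W : X.Opens} (κ : Coord E W)
  {Y : Scheme.{u}} {p : Y ⟶ X}

theorem opensOver_hom_mem {U : Y.Opens} (hU : ∀ y ∈ U, p y ∈ W)
    (y : ((opensOver p).obj U).left) : ((opensOver p).obj U).hom y ∈ W := by
  have : ((opensOver p).obj U).hom y = p (U.ι y) := Scheme.Hom.comp_apply U.ι p y
  rw [this]
  exact hU _ (Subtype.prop (show U.toScheme from y))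

/-- The coordinates of a section over an open subset of an `X`-scheme. -/
def openCoord {U : Y.Opens} (hU : ∀ y ∈ U, p y ∈ W) (s : E.obj.obj (op ((opensOver p).obj U)))
    (i : Fin κ.dim) : Γ(Y, U) :=
  U.topIso.hom (κ.coord ((opensOver p).obj U) (opensOver_hom_mem hU) s i)

theorem openCoord_map {Y' : Scheme.{u}} {p' : Y' ⟶ X} (h : Y' ⟶ Y) (w : h ≫ p = p')
    {U : Y.Opens} {V : Y'.Opens} (e : V ≤ h ⁻¹ᵁ U) (hU : ∀ y ∈ U, p y ∈ W)
    (hV : ∀ y ∈ V, p' y ∈ W) (s : E.obj.obj (op ((opensOver p).obj U))) (i : Fin κ.dim) :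
    κ.openCoord hV (E.obj.map (opensOverHom h w U V e).op s) i =
      h.appLE U V e (κ.openCoord hU s i) := by
  refine (congrArg V.topIso.hom (κ.naturality (opensOver_hom_mem hU) (opensOver_hom_mem hV)
    (opensOverHom h w U V e) s i)).trans ?_
  have h1 : (h.resLE U V e).appTop ≫ V.topIso.hom = U.topIso.hom ≫ h.appLE U V e := by
    refine (congrArg (· ≫ V.topIso.hom) (Scheme.Hom.resLE_app_top h e)).trans ?_
    rw [Category.assoc, Category.assoc, Iso.inv_hom_id, Category.comp_id]
  exact ConcreteCategory.congr_hom h1 (κ.coord ((opensOver p).obj U) (opensOver_hom_mem hU) s i)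

theorem openCoord_res {U V : Y.Opens} (j : V ⟶ U) (hU : ∀ y ∈ U, p y ∈ W)
    (hV : ∀ y ∈ V, p y ∈ W) (s : E.obj.obj (op ((opensOver p).obj U))) (i : Fin κ.dim) :
    κ.openCoord hV (E.obj.map ((opensOver p).map j).op s) i =
      Y.presheaf.map j.op (κ.openCoord hU s i) := by
  have e : V ≤ 𝟙 Y ⁻¹ᵁ U := j.le
  have h := κ.openCoord_map (𝟙 Y) (Category.id_comp p) e hU hV s i
  rw [opensOverHom_id j (𝟙 Y) rfl (Category.id_comp p) e] at h
  have h1 : (𝟙 Y :).appLE U V e = Y.presheaf.map j.op := by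
    simp [Scheme.Hom.appLE]
    rfl
  rw [h, h1]

theorem openCoord_injective {U : Y.Opens} (hU : ∀ y ∈ U, p y ∈ W) :
    Function.Injective (κ.openCoord hU) := by
  intro s s' h
  refine κ.injective _ (opensOver_hom_mem hU) (funext fun i => ?_)
  exact (ConcreteCategory.bijective_of_isIso U.topIso.hom).1 (congrFun h i)

theorem openCoord_zero {U : Y.Opens} (hU : ∀ y ∈ U, p y ∈ W) (i : Fin κ.dim) :
    κ.openCoord hU 0 i = 0 :=
  (congrArg _ (κ.coord_zero _ (opensOver_hom_mem hU) i)).trans (map_zero _)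

theorem exists_openCoord_eq {U : Y.Opens} (hU : ∀ y ∈ U, p y ∈ W) (t : Fin κ.dim → Γ(Y, U))
    (ht : ∀ i, IsNilpotent (t i)) : ∃ s, κ.openCoord hU s = t := by
  obtain ⟨s, hs⟩ := κ.exists_of_isNilpotent ((opensOver p).obj U) (opensOver_hom_mem hU)
    (fun i => U.topIso.inv (t i)) fun i => (ht i).map U.topIso.inv.hom
  refine ⟨s, funext fun i => ?_⟩
  refine (congrArg U.topIso.hom (congrFun hs i)).trans ?_
  exact ConcreteCategory.congr_hom U.topIso.inv_hom_id (t i)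

/-- The first order group law is known for points with values in a ring; for affine `U` it is
transported along `U ≅ Spec Γ(Y, U)`. -/
theorem openCoord_sub_mem {U : Y.Opens} (hUa : IsAffineOpen U) (hU : ∀ y ∈ U, p y ∈ W)
    (𝔟 : Ideal Γ(Y, U)) (s t : E.obj.obj (op ((opensOver p).obj U)))
    (hs : ∀ i, κ.openCoord hU s i ∈ 𝔟) (ht : ∀ i, κ.openCoord hU t i ∈ 𝔟) (i : Fin κ.dim) :
    κ.openCoord hU (s - t) i - (κ.openCoord hU s i - κ.openCoord hU t i) ∈ 𝔟 ^ 2 ∧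
    κ.openCoord hU (s + t) i - (κ.openCoord hU s i + κ.openCoord hU t i) ∈ 𝔟 ^ 2 := by
  let m : Over.mk (hUa.isoSpec.inv ≫ U.ι ≫ p) ⟶ (opensOver p).obj U :=
    Over.homMk (V := Over.mk (U.ι ≫ p)) hUa.isoSpec.inv rfl
  have hz : ∀ x, (hUa.isoSpec.inv ≫ U.ι ≫ p) x ∈ W :=
    apply_mem_of_comp_eq rfl (opensOver_hom_mem hU)
  have h (r : E.obj.obj (op ((opensOver p).obj U))) (j : Fin κ.dim) :
      κ.openCoord hU r j = κ.ringCoord _ hz (E.obj.map m.op r) j := by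
    refine Eq.trans ?_ (congrArg (Scheme.ΓSpecIso Γ(Y, U)).hom
      (κ.naturality (opensOver_hom_mem hU) hz m r j)).symm
    have h1 : hUa.isoSpec.inv.appTop ≫ (Scheme.ΓSpecIso Γ(Y, U)).hom = U.topIso.hom := by
      rw [hUa.isoSpec_inv_appTop, Category.assoc, Iso.inv_hom_id, Category.comp_id]
    exact (ConcreteCategory.congr_hom h1
      (κ.coord ((opensOver p).obj U) (opensOver_hom_mem hU) r j)).symm
  simp only [h] at hs ht ⊢
  rw [map_sub, map_add]
  exact ⟨κ.ringCoord_sub_mem hz 𝔟 _ _ hs ht i, κ.ringCoord_add_mem hz 𝔟 _ _ hs ht i⟩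

end Coord

end OpenCoordinates

/-! ### Splitting the sections of `ker (E|_Y ⟶ ι_* E|_{Y₀})` over small affine open sets. -/

section KernelSplitting

/-- The elements of an extended ideal in a localization. -/
theorem exists_eq_pow_mul_of_mem_map {A B : Type*} [CommRing A] [CommRing B] (ρ : A →+* B) (g : A)
    (hρ : ∀ x, ∃ (n : ℕ) (a : A), ρ a = ρ g ^ n * x) (I : Ideal A) (x : B) (hx : x ∈ I.map ρ) :
    ∃ (n : ℕ) (a : A), a ∈ I ∧ ρ a = ρ g ^ n * x := by
  refine Submodule.span_induction (p := fun x _ => ∃ (n : ℕ) (a : A), a ∈ I ∧ ρ a = ρ g ^ n * x)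
    ?_ ?_ ?_ ?_ hx
  · rintro _ ⟨a, ha, rfl⟩
    exact ⟨0, a, ha, by rw [pow_zero, one_mul]⟩
  · exact ⟨0, 0, I.zero_mem, by simp⟩
  · rintro x y - - ⟨n, a, ha, h⟩ ⟨m, b, hb, h'⟩
    refine ⟨n + m, g ^ m * a + g ^ n * b,
      I.add_mem (I.mul_mem_left _ ha) (I.mul_mem_left _ hb), ?_⟩
    rw [map_add, map_mul, map_mul, h, h', map_pow, map_pow]
    ring
  · rintro c x - ⟨n, a, ha, h⟩
    obtain ⟨m, b, hb⟩ := hρ c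
    refine ⟨m + n, b * a, I.mul_mem_left _ ha, ?_⟩
    rw [map_mul, hb, h, smul_eq_mul]
    ring

/-- A finite family of elements of a localization has a common denominator. -/
theorem exists_common_pow {A B ι : Type*} [CommRing A] [CommRing B] [Fintype ι] (ρ : A →+* B)
    (g : A) (I : Ideal A) (x : ι → B) (hx : ∀ i, ∃ (n : ℕ) (a : A), a ∈ I ∧ ρ a = ρ g ^ n * x i) :
    ∃ (n : ℕ) (a : ι → A), ∀ i, a i ∈ I ∧ ρ (a i) = ρ g ^ n * x i := by
  choose n a ha h using hx
  refine ⟨∑ i, n i, fun i => g ^ (∑ j, n j - n i) * a i, fun i => ⟨I.mul_mem_left _ (ha i), ?_⟩⟩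
  have hle : n i ≤ ∑ j, n j := Finset.single_le_sum (fun _ _ => Nat.zero_le _) (Finset.mem_univ i)
  rw [map_mul, h, ← mul_assoc, map_pow, ← pow_add, Nat.sub_add_cancel hle]

variable {Y Y₀ : Scheme.{u}} (ι : Y₀ ⟶ Y)

/-- The inverse image of `D(a)` is empty and `ι` is surjective, so `D(a)` is empty; on a
quasi-compact open set this makes `a` nilpotent. -/
theorem isNilpotent_of_app_eq_zero [Surjective ι] {U : Y.Opens} (hU : IsAffineOpen U) (a : Γ(Y, U))
    (ha : ι.app U a = 0) : IsNilpotent a := by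
  rw [Scheme.isNilpotent_iff_basicOpen_eq_bot_of_isCompact hU.isCompact]
  have h : ι ⁻¹ᵁ Y.basicOpen a = ⊥ := by
    rw [Scheme.preimage_basicOpen, ha]
    exact Y₀.basicOpen_zero _
  ext y
  obtain ⟨x, rfl⟩ := ι.surjective y
  exact (congrArg (x ∈ ·) h).to_iff

/-- The functions vanishing on `Y₀` form a quasi-coherent ideal. Some `g ^ n * x` extends to a
function `b` on `U`; its restriction to `Y₀` dies where `g` is invertible, hence is killed by a
power of `g` because the inverse image of `U` is quasi-compact. -/
theorem exists_extend_of_app_eq_zero [QuasiCompact ι] {U O : Y.Opens} (hU : IsAffineOpen U)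
    (g : Γ(Y, U)) (hOU : O ≤ U) (hO : O = Y.basicOpen g) (x : Γ(Y, O)) (hx : ι.app O x = 0) :
    ∃ (n : ℕ) (a : Γ(Y, U)), ι.app U a = 0 ∧ Y.presheaf.map (homOfLE hOU).op a =
      Y.presheaf.map (homOfLE hOU).op g ^ n * x := by
  subst hO
  obtain ⟨n, b, hb⟩ := exists_eq_pow_mul_of_isAffineOpen Y U hU g x
  change Y.presheaf.map (homOfLE hOU).op b = Y.presheaf.map (homOfLE hOU).op g ^ n * x at hb
  have hc : IsCompact (ι ⁻¹ᵁ U : Set Y₀) := ι.isCompact_preimage hU.isCompact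
  have hnat := ConcreteCategory.congr_hom (ι.naturality (homOfLE hOU).op) b
  have h0 : ι.app (Y.basicOpen g) (Y.presheaf.map (homOfLE hOU).op b) = 0 := by
    rw [hb, map_mul, hx, mul_zero]
  have h1 := hnat.symm.trans h0
  have hle : Y₀.basicOpen (ι.app U g) ≤ ι ⁻¹ᵁ (Y.basicOpen g) := by
    rw [Scheme.preimage_basicOpen]
  obtain ⟨m, hm⟩ := exists_pow_mul_eq_zero_of_res_basicOpen_eq_zero_of_isCompact Y₀ hc
    (ι.app U b) (ι.app U g) (by
      have h2 := congrArg (Y₀.presheaf.map (homOfLE hle).op) h1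
      rw [map_zero] at h2
      refine Eq.trans ?_ h2
      exact ConcreteCategory.congr_hom (Y₀.presheaf.map_comp
        ((Opens.map ι.base).map (homOfLE hOU)).op (homOfLE hle).op) _)
  refine ⟨m + n, g ^ m * b, ?_, ?_⟩
  · rw [map_mul, map_pow]
    exact hm
  · rw [map_mul, map_pow, hb, pow_add, mul_assoc]

variable {X : Scheme.{u}} {E : BigZariskiSheaf X} {p : Y ⟶ X} {p₀ : Y₀ ⟶ X} (w : ι ≫ p = p₀)
  {W : X.Opens} (κ : Coord E W)

include κ in
/-- A section lies in the kernel of the restriction along `ι` iff its coordinates do. -/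
theorem Coord.restrictHom_eq_zero_iff {U : Y.Opens} (hU : ∀ y ∈ U, p y ∈ W)
    (s : E.obj.obj (op ((opensOver p).obj U))) :
    (restrictHom E ι w).hom.app (op U) s = 0 ↔ ∀ i, ι.app U (κ.openCoord hU s i) = 0 := by
  have hV : ∀ y ∈ ι ⁻¹ᵁ U, p₀ y ∈ W := by
    intro y hy
    rw [← w, Scheme.Hom.comp_apply]
    exact hU _ hy
  have h (i : Fin κ.dim) : κ.openCoord hV
      (E.obj.map (opensOverHom ι w U (ι ⁻¹ᵁ U) le_rfl).op s) i =
      ι.app U (κ.openCoord hU s i) := by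
    rw [Scheme.Hom.app_eq_appLE]
    exact κ.openCoord_map ι w le_rfl hU hV s i
  constructor
  · intro hs i
    rw [← h]
    exact (congrArg (κ.openCoord hV · i) hs).trans (κ.openCoord_zero hV i)
  · intro hs
    refine κ.openCoord_injective hV (funext fun i => ?_)
    exact ((h i).trans (hs i)).trans (κ.openCoord_zero hV i).symm

/-- The data of a covering of an affine open set by two complementary basic open sets. -/
structure ComplementaryCover (U : Y.Opens) where
  /-- the function defining the first open set -/
  f : Γ(Y, U)
  /-- the first open set -/
  left : Y.Opens
  /-- the second open set -/
  right : Y.Opens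
  left_eq : left = Y.basicOpen f
  right_eq : right = Y.basicOpen (1 - f)

namespace ComplementaryCover

variable {U : Y.Opens} (c : ComplementaryCover U)

theorem left_le : c.left ≤ U := c.left_eq.trans_le (Y.basicOpen_le _)

theorem right_le : c.right ≤ U := c.right_eq.trans_le (Y.basicOpen_le _)

theorem inf_eq : c.left ⊓ c.right = Y.basicOpen (c.f * (1 - c.f)) := by
  rw [c.left_eq, c.right_eq, Y.basicOpen_mul]

theorem inf_le : c.left ⊓ c.right ≤ U := inf_le_left.trans c.left_le

/-- restriction to the intersection -/
def res : Γ(Y, U) →+* Γ(Y, c.left ⊓ c.right) := (Y.presheaf.map (homOfLE c.inf_le).op).hom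

/-- restriction from the first open set to the intersection -/
def resLeft : Γ(Y, c.left) →+* Γ(Y, c.left ⊓ c.right) :=
  (Y.presheaf.map (homOfLE inf_le_left).op).hom

/-- restriction from the second open set to the intersection -/
def resRight : Γ(Y, c.right) →+* Γ(Y, c.left ⊓ c.right) :=
  (Y.presheaf.map (homOfLE inf_le_right).op).hom

theorem resLeft_comp :
    c.resLeft.comp (Y.presheaf.map (homOfLE c.left_le).op).hom = c.res :=
  congrArg CommRingCat.Hom.hom (Y.presheaf.map_comp (homOfLE c.left_le).op
    (homOfLE (inf_le_left : c.left ⊓ c.right ≤ c.left)).op).symm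

theorem resRight_comp :
    c.resRight.comp (Y.presheaf.map (homOfLE c.right_le).op).hom = c.res :=
  congrArg CommRingCat.Hom.hom (Y.presheaf.map_comp (homOfLE c.right_le).op
    (homOfLE (inf_le_right : c.left ⊓ c.right ≤ c.right)).op).symm

theorem exists_res_eq (hU : IsAffineOpen U) (x : Γ(Y, c.left ⊓ c.right)) :
    ∃ (n : ℕ) (a : Γ(Y, U)), c.res a = c.res (c.f * (1 - c.f)) ^ n * x := by
  have h (O : Y.Opens) (g : Γ(Y, U)) (hOU : O ≤ U) (hO : O = Y.basicOpen g) (x : Γ(Y, O)) :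
      ∃ (n : ℕ) (a : Γ(Y, U)), Y.presheaf.map (homOfLE hOU).op a =
        Y.presheaf.map (homOfLE hOU).op g ^ n * x := by
    subst hO
    exact exists_eq_pow_mul_of_isAffineOpen Y U hU g x
  exact h _ _ c.inf_le c.inf_eq x

theorem isUnit_res (O : Y.Opens) (g : Γ(Y, U)) (hOU : O ≤ U) (hO : O = Y.basicOpen g) :
    IsUnit (Y.presheaf.map (homOfLE hOU).op g) := by
  subst hO
  exact RingedSpace.isUnit_res_basicOpen _ _

/-- Elements with coordinates in an ideal split additively. -/
theorem exists_add_eq (hU : IsAffineOpen U) {κ : Type*} [Fintype κ] (I : Ideal Γ(Y, U))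
    (t : κ → Γ(Y, c.left ⊓ c.right)) (ht : ∀ i, t i ∈ I.map c.res) :
    ∃ (t₁ : κ → Γ(Y, c.left)) (t₂ : κ → Γ(Y, c.right)),
      (∀ i, t₁ i ∈ I.map (Y.presheaf.map (homOfLE c.left_le).op).hom) ∧
      (∀ i, t₂ i ∈ I.map (Y.presheaf.map (homOfLE c.right_le).op).hom) ∧
      ∀ i, c.resLeft (t₁ i) + c.resRight (t₂ i) = t i := by
  obtain ⟨n, a, ha⟩ := exists_common_pow c.res (c.f * (1 - c.f)) I t fun i =>
    exists_eq_pow_mul_of_mem_map c.res _ (c.exists_res_eq hU) I (t i) (ht i)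
  let ρ₁ := (Y.presheaf.map (homOfLE c.left_le).op).hom
  let ρ₂ := (Y.presheaf.map (homOfLE c.right_le).op).hom
  have h₁ (x : Γ(Y, U)) : c.resLeft (ρ₁ x) = c.res x := RingHom.congr_fun c.resLeft_comp x
  have h₂ (x : Γ(Y, U)) : c.resRight (ρ₂ x) = c.res x := RingHom.congr_fun c.resRight_comp x
  obtain ⟨w₁, hw₁⟩ := (isUnit_res c.left c.f c.left_le c.left_eq).exists_right_inv
  obtain ⟨w₂, hw₂⟩ := (isUnit_res c.right (1 - c.f) c.right_le c.right_eq).exists_right_inv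
  have hco : IsCoprime c.f (1 - c.f) := ⟨1, 1, by ring⟩
  -- A partition of unity `u f^n + v (1 - f)^n = 1`. On the intersection `aᵢ = (f (1 - f))^n tᵢ`, so
  -- the two summands chosen below restrict to `v (1 - f)^n tᵢ` and `u f^n tᵢ`, while each is
  -- defined on its own open set.
  obtain ⟨u, v, huv⟩ := (hco.pow (m := n) (n := n))
  refine ⟨fun i => w₁ ^ n * ρ₁ (v * a i), fun i => w₂ ^ n * ρ₂ (u * a i), fun i => ?_, fun i => ?_,
    fun i => ?_⟩
  · exact Ideal.mul_mem_left _ _ (Ideal.mem_map_of_mem _ (I.mul_mem_left _ (ha i).1))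
  · exact Ideal.mul_mem_left _ _ (Ideal.mem_map_of_mem _ (I.mul_mem_left _ (ha i).1))
  · have e₁ : c.res c.f * c.resLeft w₁ = 1 := by
      rw [← h₁, ← map_mul]
      exact (congrArg c.resLeft hw₁).trans (map_one _)
    have e₂ : c.res (1 - c.f) * c.resRight w₂ = 1 := by
      rw [← h₂, ← map_mul]
      exact (congrArg c.resRight hw₂).trans (map_one _)
    have e₃ := congrArg c.res huv
    rw [map_add, map_mul, map_mul, map_pow, map_pow, map_one] at e₃
    have e₄ : (c.res c.f * c.resLeft w₁) ^ n = 1 := by rw [e₁, one_pow]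
    have e₅ : (c.res (1 - c.f) * c.resRight w₂) ^ n = 1 := by rw [e₂, one_pow]
    have e₆ := (ha i).2
    rw [map_mul, mul_pow] at e₆
    change c.resLeft (w₁ ^ n * ρ₁ (v * a i)) + c.resRight (w₂ ^ n * ρ₂ (u * a i)) = t i
    rw [map_mul c.resLeft, map_mul c.resRight, h₁, h₂, map_pow, map_pow, map_mul, map_mul, e₆]
    rw [mul_pow] at e₄ e₅
    linear_combination (c.res v * c.res (1 - c.f) ^ n * t i) * e₄ +
      (c.res u * c.res c.f ^ n * t i) * e₅ + t i * e₃

end ComplementaryCover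

theorem eq_zero_of_mem_map {A B C : Type*} [CommRing A] [CommRing B] [CommRing C] (ρ : A →+* B)
    (ψ : B →+* C) (I : Ideal A) (h : ∀ a ∈ I, ψ (ρ a) = 0) (x : B) (hx : x ∈ I.map ρ) :
    ψ x = 0 := by
  have : I.map ρ ≤ RingHom.ker ψ := Ideal.map_le_iff_le_comap.mpr fun a ha => h a ha
  exact this hx

/-- A section over the intersection of two complementary basic open sets whose coordinates come
from an ideal of functions vanishing on `Y₀` is a sum of sections over the two open sets which
vanish on `Y₀`. -/
theorem Coord.exists_split {U : Y.Opens} (hUa : IsAffineOpen U) (hU : ∀ y ∈ U, p y ∈ W)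
    (c : ComplementaryCover U) [Surjective ι] (I : Ideal Γ(Y, U)) (hI : ∀ a ∈ I, ι.app U a = 0)
    (m k : ℕ) (hk : 1 ≤ k) (hIk : I ^ (k + m) = ⊥)
    (z : E.obj.obj (op ((opensOver p).obj (c.left ⊓ c.right))))
    (hz : ∀ i, κ.openCoord (fun y hy => hU y (c.inf_le hy)) z i ∈ I.map c.res ^ k) :
    ∃ (z₁ : E.obj.obj (op ((opensOver p).obj c.left)))
      (z₂ : E.obj.obj (op ((opensOver p).obj c.right))),
      (restrictHom E ι w).hom.app (op c.left) z₁ = 0 ∧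
      (restrictHom E ι w).hom.app (op c.right) z₂ = 0 ∧
      E.obj.map ((opensOver p).map (homOfLE inf_le_left)).op z₁ +
        E.obj.map ((opensOver p).map (homOfLE inf_le_right)).op z₂ = z := by
  induction m generalizing k z with
  | zero =>
    refine ⟨0, 0, map_zero _, map_zero _, ?_⟩
    rw [map_zero, map_zero, add_zero]
    refine κ.openCoord_injective (fun y hy => hU y (c.inf_le hy)) (funext fun i => ?_)
    have := hz i
    rw [← Ideal.map_pow, ← add_zero k, hIk, Ideal.map_bot] at this
    exact (κ.openCoord_zero _ i).trans this.symm
  | succ m ih =>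
    have hO : ∀ y ∈ c.left ⊓ c.right, p y ∈ W := fun y hy => hU y (c.inf_le hy)
    have hOa : IsAffineOpen (c.left ⊓ c.right) := by
      rw [c.inf_eq]
      exact hUa.basicOpen _
    have h₁ : ∀ y ∈ c.left, p y ∈ W := fun y hy => hU y (c.left_le hy)
    have h₂ : ∀ y ∈ c.right, p y ∈ W := fun y hy => hU y (c.right_le hy)
    have hla : IsAffineOpen c.left := c.left_eq ▸ hUa.basicOpen _
    have hra : IsAffineOpen c.right := c.right_eq ▸ hUa.basicOpen _
    have hIk' : ∀ a ∈ I ^ k, ι.app U a = 0 := fun a ha =>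
      hI a (Ideal.pow_le_self (Nat.one_le_iff_ne_zero.mp hk) ha)
    -- The coordinates of `z` are split additively within `I ^ k`. The pieces vanish on `Y₀`, hence
    -- are nilpotent and are the coordinates of sections `z₁` and `z₂`.
    obtain ⟨t₁, t₂, ht₁, ht₂, ht⟩ := c.exists_add_eq hUa (I ^ k) (κ.openCoord hO z) (by
      rw [Ideal.map_pow]
      exact hz)
    have happ (V : Y.Opens) (hV : V ≤ U) (a : Γ(Y, U)) (ha : a ∈ I ^ k) :
        ι.app V (Y.presheaf.map (homOfLE hV).op a) = 0 := by
      have := ConcreteCategory.congr_hom (ι.naturality (homOfLE hV).op) a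
      refine this.trans ?_
      rw [ConcreteCategory.comp_apply, hIk' a ha, map_zero]
    have hv₁ (i) : ι.app c.left (t₁ i) = 0 :=
      eq_zero_of_mem_map _ (ι.app c.left).hom (I ^ k) (happ c.left c.left_le) _ (ht₁ i)
    have hv₂ (i) : ι.app c.right (t₂ i) = 0 :=
      eq_zero_of_mem_map _ (ι.app c.right).hom (I ^ k) (happ c.right c.right_le) _ (ht₂ i)
    obtain ⟨z₁, hz₁⟩ := κ.exists_openCoord_eq h₁ t₁ fun i =>
      isNilpotent_of_app_eq_zero ι hla _ (hv₁ i)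
    obtain ⟨z₂, hz₂⟩ := κ.exists_openCoord_eq h₂ t₂ fun i =>
      isNilpotent_of_app_eq_zero ι hra _ (hv₂ i)
    let y₁ := E.obj.map ((opensOver p).map (homOfLE (inf_le_left : c.left ⊓ c.right ≤ _))).op z₁
    let y₂ := E.obj.map ((opensOver p).map (homOfLE (inf_le_right : c.left ⊓ c.right ≤ _))).op z₂
    have hy₁ (i) : κ.openCoord hO y₁ i = c.resLeft (t₁ i) := by
      rw [κ.openCoord_res _ h₁, hz₁]
      rfl
    have hy₂ (i) : κ.openCoord hO y₂ i = c.resRight (t₂ i) := by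
      rw [κ.openCoord_res _ h₂, hz₂]
      rfl
    have hr₁ (i) : κ.openCoord hO y₁ i ∈ I.map c.res ^ k := by
      rw [hy₁, ← Ideal.map_pow]
      have := Ideal.mem_map_of_mem c.resLeft (ht₁ i)
      rw [Ideal.map_map, c.resLeft_comp] at this
      exact this
    have hr₂ (i) : κ.openCoord hO y₂ i ∈ I.map c.res ^ k := by
      rw [hy₂, ← Ideal.map_pow]
      have := Ideal.mem_map_of_mem c.resRight (ht₂ i)
      rw [Ideal.map_map, c.resRight_comp] at this
      exact this
    have hsq : (I.map c.res ^ k) ^ 2 ≤ I.map c.res ^ k := Ideal.pow_le_self two_ne_zero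
    have hadd (i) := (κ.openCoord_sub_mem hOa hO (I.map c.res ^ k) y₁ y₂ hr₁ hr₂ i).2
    have hr (i) : κ.openCoord hO (y₁ + y₂) i ∈ I.map c.res ^ k := by
      have := Ideal.add_mem _ (hsq (hadd i)) (Ideal.add_mem _ (hr₁ i) (hr₂ i))
      rwa [sub_add_cancel] at this
    have hsub (i) := (κ.openCoord_sub_mem hOa hO (I.map c.res ^ k) z (y₁ + y₂) hz hr i).1
    -- The coordinates of `y₁ + y₂` equal those of `z` up to `(I ^ k) ^ 2`, which lies in `I ^ (k +
    -- 1)` because `k ≥ 1`. So the remaining error is one order smaller, and the induction removes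
    -- it.
    have hnew (i) : κ.openCoord hO (z - (y₁ + y₂)) i ∈ I.map c.res ^ (k + 1) := by
      have hle : (I.map c.res ^ k) ^ 2 ≤ I.map c.res ^ (k + 1) := by
        rw [← pow_mul]
        exact Ideal.pow_le_pow_right (by omega)
      refine hle ?_
      have h := Ideal.sub_mem _ (hsub i) (hadd i)
      rw [hy₁, hy₂, ht] at h
      have e : κ.openCoord hO (z - (y₁ + y₂)) i = κ.openCoord hO (z - (y₁ + y₂)) i -
          (κ.openCoord hO z i - κ.openCoord hO (y₁ + y₂) i) -
          (κ.openCoord hO (y₁ + y₂) i - κ.openCoord hO z i) := by ring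
      rw [e]
      exact h
    obtain ⟨z₁', z₂', hz₁', hz₂', hz'⟩ := ih (k + 1) (by omega)
      (by rw [← hIk]; congr 1; omega) (z - (y₁ + y₂)) hnew
    refine ⟨z₁ + z₁', z₂ + z₂', ?_, ?_, ?_⟩
    · have h0 : (restrictHom E ι w).hom.app (op c.left) z₁ = 0 :=
        (Coord.restrictHom_eq_zero_iff ι w κ h₁ z₁).mpr fun i => by rw [hz₁]; exact hv₁ i
      exact (map_add _ _ _).trans (by rw [h0, hz₁', add_zero])
    · have h0 : (restrictHom E ι w).hom.app (op c.right) z₂ = 0 :=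
        (Coord.restrictHom_eq_zero_iff ι w κ h₂ z₂).mpr fun i => by rw [hz₂]; exact hv₂ i
      exact (map_add _ _ _).trans (by rw [h0, hz₂', add_zero])
    · rw [map_add, map_add]
      have : z = (y₁ + y₂) + (z - (y₁ + y₂)) := by abel
      rw [this, ← hz']
      simp only [y₁, y₂]
      abel

/-- The affine open subsets which map into an open set with coordinates. -/
def smallAffine (E : BigZariskiSheaf X) (p : Y ⟶ X) : Set Y.Opens :=
  {U | IsAffineOpen U ∧ ∃ W : X.Opens, Nonempty (Coord E W) ∧ ∀ y ∈ U, p y ∈ W}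

/-- The splitting basis of small affine open sets. -/
def smallAffineBasis (E : BigZariskiSheaf X) (p : Y ⟶ X) : SplittingBasis Y :=
  affineBasis (smallAffine E p) (fun _ hU => hU.1) (by
    rintro U ⟨hU, W, hW, h⟩ f
    exact ⟨hU.basicOpen f, W, hW, fun y hy => h y (Y.basicOpen_le f hy)⟩)

/-- The whole kernel ideal need not be nilpotent, but a section has only finitely many coordinates;
up to a power of `f (1 - f)` these extend to finitely many nilpotent functions on `U`, and the ideal
they generate is nilpotent. `Coord.exists_split` then applies. -/
theorem splits_kernelSheaf [Surjective ι] [QuasiCompact ι] :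
    (smallAffineBasis E p).Splits (kernelSheaf (restrictHom E ι w)) := by
  rintro U U₁ U₂ ⟨⟨hUa, W, ⟨κ⟩, hU⟩, f, h₁, h₂⟩ z
  let c : ComplementaryCover U := ⟨f, U₁, U₂, h₁, h₂⟩
  have hO : ∀ y ∈ c.left ⊓ c.right, p y ∈ W := fun y hy => hU y (c.inf_le hy)
  let t := κ.openCoord hO z.1
  have ht (i) : ι.app (c.left ⊓ c.right) (t i) = 0 :=
    (Coord.restrictHom_eq_zero_iff ι w κ hO z.1).mp z.2 i
  let J : Ideal Γ(Y, U) := RingHom.ker (ι.app U).hom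
  obtain ⟨n, a, ha⟩ := exists_common_pow c.res (f * (1 - f)) J t fun i =>
    exists_extend_of_app_eq_zero ι hUa (f * (1 - f)) c.inf_le c.inf_eq (t i) (ht i)
  have hann (i) : IsNilpotent (a i) := isNilpotent_of_app_eq_zero ι hUa _ (ha i).1
  obtain ⟨N, hN⟩ := exists_span_pow_eq_bot a hann
  have hunit : IsUnit (c.res (f * (1 - f)) ^ n) :=
    (ComplementaryCover.isUnit_res _ _ c.inf_le c.inf_eq).pow n
  obtain ⟨v, hv⟩ := hunit.exists_left_inv
  have hmem (i) : t i ∈ (Ideal.span (Set.range a)).map c.res ^ 1 := by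
    rw [pow_one, ← one_mul (t i), ← hv, mul_assoc, ← (ha i).2]
    exact Ideal.mul_mem_left _ _ (Ideal.mem_map_of_mem _ (Ideal.subset_span ⟨i, rfl⟩))
  have hJ : Ideal.span (Set.range a) ≤ J := Ideal.span_le.mpr (by
    rintro _ ⟨i, rfl⟩
    exact (ha i).1)
  obtain ⟨z₁, z₂, hz₁, hz₂, hz⟩ := κ.exists_split ι w hUa hU c (Ideal.span (Set.range a))
    (fun x hx => hJ hx) N 1 le_rfl (by rw [pow_add, hN, Ideal.mul_bot]) z.1 hmem
  exact ⟨⟨z₁, hz₁⟩, ⟨z₂, hz₂⟩, Subtype.ext hz⟩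

end KernelSplitting

/-! ### Comparison of kernels in coordinates. -/

section KernelComparison

/-- A morphism of sheaves which is bijective on sections over a basis is an isomorphism. -/
theorem isIso_of_bijective_basis {Y : TopCat.{u}} {F G : AbSheaf Y} (φ : F ⟶ G)
    (h : ∀ (U : Opens Y), ∀ x ∈ U, ∃ V ≤ U, x ∈ V ∧ Function.Bijective (secHom φ V)) :
    IsIso φ := by
  have hinj (U : Opens Y) : Function.Injective (secHom φ U) := by
    rw [injective_iff_map_eq_zero]
    intro s hs
    apply eq_of_locally_eq
    intro x hx
    obtain ⟨V, hV, hxV, hb⟩ := h U x hx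
    refine ⟨V, hV, hxV, hb.1 ?_⟩
    rw [secHom_resHom, hs, map_zero, map_zero, map_zero]
  have hm : Mono φ := by
    have (U : (Opens Y)ᵒᵖ) : Mono (φ.hom.app U) :=
      (AddCommGrpCat.mono_iff_injective _).mpr (hinj U.unop)
    have : Mono φ.hom := NatTrans.mono_of_mono_app φ.hom
    exact Sheaf.Hom.mono_of_presheaf_mono _ _ φ
  have he : Epi φ := by
    refine (Sheaf.isLocallySurjective_iff_epi' AddCommGrpCat.{u} φ).mp ?_
    refine (TopCat.Presheaf.isLocallySurjective_iff _).mpr ?_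
    intro U s x hx
    obtain ⟨V, hV, hxV, hb⟩ := h U x hx
    obtain ⟨t, ht⟩ := hb.2 (resHom G hV s)
    exact ⟨V, hV, ⟨t, ht⟩, hxV⟩
  exact isIso_of_mono_of_epi φ

variable {X Y Y₀ Y' Y₀' : Scheme.{u}} {E : BigZariskiSheaf X} {p : Y ⟶ X} {p₀ : Y₀ ⟶ X}
  {p' : Y' ⟶ X} {p₀' : Y₀' ⟶ X} (ι : Y₀ ⟶ Y) (w : ι ≫ p = p₀) (ι' : Y₀' ⟶ Y')
  (w' : ι' ≫ p' = p₀') (h : Y' ⟶ Y) (wh : h ≫ p = p')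

/-- Sections of the kernel over `U` are exactly the tuples of functions vanishing on `Y₀`, since
such functions are nilpotent and every nilpotent tuple is the coordinate vector of a section. The
statement for `E` thus follows coordinatewise from that for functions. -/
theorem Coord.kernel_bijective {W : X.Opens} (κ : Coord E W) [Surjective ι] {U : Y.Opens}
    {U' : Y'.Opens} (e : U' ≤ h ⁻¹ᵁ U) (hUa : IsAffineOpen U) (hU : ∀ y ∈ U, p y ∈ W)
    (hU' : ∀ y ∈ U', p' y ∈ W)
    (hinj : ∀ a, ι.app U a = 0 → h.appLE U U' e a = 0 → a = 0)
    (hsurj : ∀ b, ι'.app U' b = 0 → ∃ a, ι.app U a = 0 ∧ h.appLE U U' e a = b) :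
    (∀ s, (restrictHom E ι w).hom.app (op U) s = 0 →
      E.obj.map (opensOverHom h wh U U' e).op s = 0 → s = 0) ∧
    ∀ s', (restrictHom E ι' w').hom.app (op U') s' = 0 →
      ∃ s, (restrictHom E ι w).hom.app (op U) s = 0 ∧
        E.obj.map (opensOverHom h wh U U' e).op s = s' := by
  constructor
  · intro s hs hs'
    refine κ.openCoord_injective hU (funext fun i => ?_)
    refine Eq.trans (hinj _ ((Coord.restrictHom_eq_zero_iff ι w κ hU s).mp hs i) ?_)
      (κ.openCoord_zero hU i).symm
    refine (κ.openCoord_map h wh e hU hU' s i).symm.trans ?_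
    exact (congrArg (κ.openCoord hU' · i) hs').trans (κ.openCoord_zero hU' i)
  · intro s' hs'
    choose a ha ha' using fun i => hsurj (κ.openCoord hU' s' i)
      ((Coord.restrictHom_eq_zero_iff ι' w' κ hU' s').mp hs' i)
    obtain ⟨s, hs⟩ := κ.exists_openCoord_eq hU a fun i =>
      isNilpotent_of_app_eq_zero ι hUa _ (ha i)
    refine ⟨s, (Coord.restrictHom_eq_zero_iff ι w κ hU s).mpr fun i => ?_,
      κ.openCoord_injective hU' (funext fun i => ?_)⟩
    · rw [hs]
      exact ha i
    · rw [κ.openCoord_map h wh e hU hU', hs, ha']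

variable (E) in
/-- The morphism between the direct images on `X` of the kernels of `E|_Y ⟶ ι_* E|_{Y₀}` and
`E|_Y' ⟶ ι'_* E|_{Y₀'}` given by a commutative square. -/
def kernelMap (k : Y₀' ⟶ Y₀) (hk : ι' ≫ h = k ≫ ι) :
    (push p.base).obj (kernelSheaf (restrictHom E ι w)) ⟶
      (push p'.base).obj (kernelSheaf (restrictHom E ι' w')) :=
  (push p.base).map (kernelHom h.base _ _ (restrictHom E h wh) fun U s hs =>
      restrictHom_eq_zero_of_comm E h wh ι w ι' w' k hk U s hs) ≫
    pushCongr (congrArg (fun k : Y' ⟶ X => k.base) wh) (kernelSheaf (restrictHom E ι' w'))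

include wh in
theorem preimage_le_preimage (U : X.Opens) : p' ⁻¹ᵁ U ≤ h ⁻¹ᵁ (p ⁻¹ᵁ U) := by
  rw [← wh, Scheme.Hom.comp_preimage]

theorem kernelMap_val (k : Y₀' ⟶ Y₀) (hk : ι' ≫ h = k ≫ ι) (U : X.Opens)
    (s : ((push p.base).obj (kernelSheaf (restrictHom E ι w))).obj.obj (op U)) :
    (secHom (kernelMap E ι w ι' w' h wh k hk) U s).1 =
      E.obj.map (opensOverHom h wh _ _ (preimage_le_preimage h wh U)).op s.1 := by
  refine map_map_apply' E _ _ _ ?_ s.1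
  refine (congrArg (· ≫ _) (opensOverHom_id _ (𝟙 _) rfl (Category.id_comp _) ?_).symm).trans ?_
  · exact preimage_le_preimage h wh U
  · exact opensOverHom_comp _ _ _ _ _ _ (Category.id_comp _) _ _ _ _ _ _

/-- The comparison of kernels is an isomorphism if the kernels of functions on the inverse images
of affine open subsets of `X` correspond to each other. -/
theorem isIso_kernelMap (hE : IsFormalLieGroup E) [Surjective ι] (k : Y₀' ⟶ Y₀)
    (hk : ι' ≫ h = k ≫ ι)
    (hW : ∀ W : X.Opens, IsAffineOpen W → IsAffineOpen (p ⁻¹ᵁ W))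
    (hinj : ∀ W : X.Opens, IsAffineOpen W → ∀ a, ι.app (p ⁻¹ᵁ W) a = 0 →
      h.appLE (p ⁻¹ᵁ W) (p' ⁻¹ᵁ W) (preimage_le_preimage h wh W) a = 0 → a = 0)
    (hsurj : ∀ W : X.Opens, IsAffineOpen W → ∀ b, ι'.app (p' ⁻¹ᵁ W) b = 0 →
      ∃ a, ι.app (p ⁻¹ᵁ W) a = 0 ∧
        h.appLE (p ⁻¹ᵁ W) (p' ⁻¹ᵁ W) (preimage_le_preimage h wh W) a = b) :
    IsIso (kernelMap E ι w ι' w' h wh k hk) := by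
  apply isIso_of_bijective_basis
  intro U x hx
  obtain ⟨W₀, hxW₀, ⟨κ⟩⟩ := hE.exists_coord x
  obtain ⟨W, hWa, hxW, hWle⟩ := Opens.isBasis_iff_nbhd.mp X.isBasis_affineOpens
    (show x ∈ U ⊓ W₀ from ⟨hx, hxW₀⟩)
  refine ⟨W, hWle.trans inf_le_left, hxW, ?_⟩
  have hb := κ.kernel_bijective ι w ι' w' h wh (preimage_le_preimage h wh W) (hW W hWa)
    (fun y hy => (hWle hy).2) (fun y hy => (hWle hy).2) (hinj W hWa) (hsurj W hWa)
  constructor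
  · rw [injective_iff_map_eq_zero]
    intro s hs
    refine Subtype.ext (hb.1 s.1 s.2 ?_)
    rw [← kernelMap_val ι w ι' w' h wh k hk W s, hs]
    rfl
  · intro s'
    obtain ⟨s, hs, hs'⟩ := hb.2 s'.1 s'.2
    exact ⟨⟨s, hs⟩, Subtype.ext ((kernelMap_val ι w ι' w' h wh k hk W ⟨s, hs⟩).trans hs')⟩

end KernelComparison

/-! ### Kernels under flat base change. -/

section FlatKernel

open TensorProduct

/-- The hypotheses say that `ψ` restricts to an isomorphism from `ker π` to `ker σ`, and tensoring
with the flat module `B` commutes with forming kernels. Nothing is assumed about `ψ` outside `ker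
π`. -/
theorem flat_lTensor_ker {R : Type*} [CommRing R] (B : Type*) [AddCommGroup B] [Module R B]
    [Module.Flat R B] {M M₀ N N₀ : Type*} [AddCommGroup M] [Module R M] [AddCommGroup M₀]
    [Module R M₀] [AddCommGroup N] [Module R N] [AddCommGroup N₀] [Module R N₀]
    (π : M →ₗ[R] M₀) (σ : N →ₗ[R] N₀) (ψ : M →ₗ[R] N)
    (hinj : ∀ m, π m = 0 → ψ m = 0 → m = 0)
    (hsurj : ∀ n, σ n = 0 → ∃ m, π m = 0 ∧ ψ m = n) (hψ : ∀ m, π m = 0 → σ (ψ m) = 0) :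
    (∀ x, π.lTensor B x = 0 → ψ.lTensor B x = 0 → x = 0) ∧
      ∀ y, σ.lTensor B y = 0 → ∃ x, π.lTensor B x = 0 ∧ ψ.lTensor B x = y := by
  have hπe : Function.Exact (LinearMap.ker π).subtype π := LinearMap.exact_subtype_ker_map π
  have hσe : Function.Exact (LinearMap.ker σ).subtype σ := LinearMap.exact_subtype_ker_map σ
  constructor
  · intro x hx hx'
    obtain ⟨x', rfl⟩ := (Module.Flat.lTensor_exact B hπe x).mp hx
    have h1 : Function.Injective (ψ ∘ₗ (LinearMap.ker π).subtype) := by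
      rw [injective_iff_map_eq_zero]
      intro m hm
      exact Subtype.ext (hinj m.1 m.2 hm)
    have h2 := Module.Flat.lTensor_preserves_injective_linearMap (M := B) _ h1
    have h3 : x' = 0 := h2 (by rw [map_zero, LinearMap.lTensor_comp_apply]; exact hx')
    rw [h3, map_zero]
  · intro y hy
    obtain ⟨y', rfl⟩ := (Module.Flat.lTensor_exact B hσe y).mp hy
    let e₀ : LinearMap.ker π →ₗ[R] LinearMap.ker σ :=
      (ψ ∘ₗ (LinearMap.ker π).subtype).codRestrict _ fun m => hψ m.1 m.2
    let e : LinearMap.ker π ≃ₗ[R] LinearMap.ker σ := LinearEquiv.ofBijective e₀ (by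
      constructor
      · rw [injective_iff_map_eq_zero]
        intro m hm
        exact Subtype.ext (hinj m.1 m.2 (congrArg Subtype.val hm))
      · intro n
        obtain ⟨m, hm, hm'⟩ := hsurj n.1 n.2
        exact ⟨⟨m, hm⟩, Subtype.ext hm'⟩)
    refine ⟨((LinearMap.ker π).subtype ∘ₗ e.symm.toLinearMap).lTensor B y', ?_, ?_⟩
    · rw [← LinearMap.lTensor_comp_apply, ← LinearMap.comp_assoc, hπe.linearMap_comp_eq_zero,
        LinearMap.zero_comp, LinearMap.lTensor_zero, LinearMap.zero_apply]
    · rw [← LinearMap.lTensor_comp_apply]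
      congr 2
      ext n
      exact congrArg Subtype.val (e.apply_symm_apply n)

/-- The base change of a ring under a fixed homomorphism. -/
structure RingExtension {R B : CommRingCat.{u}} (β : R ⟶ B) where
  /-- the ring -/
  ring : CommRingCat.{u}
  /-- its structure map -/
  structureMap : R ⟶ ring
  /-- the base change -/
  ext : CommRingCat.{u}
  /-- the first structure map of the base change -/
  inl : B ⟶ ext
  /-- the second structure map of the base change -/
  inr : ring ⟶ ext
  isPushout : IsPushout β structureMap inl inr

namespace RingExtension

variable {R B : CommRingCat.{u}} {β : R ⟶ B}

/-- A homomorphism of rings and its base change. -/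
structure Hom (P Q : RingExtension β) where
  /-- the homomorphism -/
  map : P.ring ⟶ Q.ring
  /-- its base change -/
  extMap : P.ext ⟶ Q.ext
  w : P.structureMap ≫ map = Q.structureMap
  inl_extMap : P.inl ≫ extMap = Q.inl
  inr_extMap : P.inr ≫ extMap = map ≫ Q.inr

theorem exists_equiv (P : RingExtension β) :
    letI := β.hom.toAlgebra
    letI := P.structureMap.hom.toAlgebra
    ∃ e : B ⊗[R] P.ring ≃+* P.ext, ∀ b x, e (b ⊗ₜ x) = P.inl b * P.inr x := by
  let _ := β.hom.toAlgebra
  let _ := P.structureMap.hom.toAlgebra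
  let i := (CommRingCat.isPushout_tensorProduct R B P.ring).isoIsPushout _ _ P.isPushout
  refine ⟨i.commRingCatIsoToRingEquiv, fun b x => ?_⟩
  have h₁ : i.hom (b ⊗ₜ 1) = P.inl b := ConcreteCategory.congr_hom
    ((CommRingCat.isPushout_tensorProduct R B P.ring).inl_isoIsPushout_hom B P.ring P.isPushout) b
  have h₂ : i.hom (1 ⊗ₜ x) = P.inr x := ConcreteCategory.congr_hom
    ((CommRingCat.isPushout_tensorProduct R B P.ring).inr_isoIsPushout_hom B P.ring P.isPushout) x
  have h₃ : (b ⊗ₜ x : B ⊗[R] P.ring) = b ⊗ₜ 1 * 1 ⊗ₜ x := by simp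
  change i.hom _ = _
  rw [h₃, map_mul, h₁, h₂]

/-- A bijection between the kernels of two ring homomorphisms is preserved by flat base change. -/
theorem ker_bijective (hβ : β.hom.Flat) {P P₀ Q Q₀ : RingExtension β} (π : Hom P P₀)
    (σ : Hom Q Q₀) (ψ : Hom P Q) (hinj : ∀ a, π.map a = 0 → ψ.map a = 0 → a = 0)
    (hsurj : ∀ b, σ.map b = 0 → ∃ a, π.map a = 0 ∧ ψ.map a = b)
    (hψ : ∀ a, π.map a = 0 → σ.map (ψ.map a) = 0) :
    (∀ a, π.extMap a = 0 → ψ.extMap a = 0 → a = 0) ∧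
      ∀ b, σ.extMap b = 0 → ∃ a, π.extMap a = 0 ∧ ψ.extMap a = b := by
  let _ := β.hom.toAlgebra
  let _ := P.structureMap.hom.toAlgebra
  let _ := P₀.structureMap.hom.toAlgebra
  let _ := Q.structureMap.hom.toAlgebra
  let _ := Q₀.structureMap.hom.toAlgebra
  have : Module.Flat R B := hβ
  obtain ⟨eP, hP⟩ := P.exists_equiv
  obtain ⟨eP₀, hP₀⟩ := P₀.exists_equiv
  obtain ⟨eQ, hQ⟩ := Q.exists_equiv
  obtain ⟨eQ₀, hQ₀⟩ := Q₀.exists_equiv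
  let πₗ : P.ring →ₗ[R] P₀.ring := (⟨π.map.hom, ConcreteCategory.congr_hom π.w⟩ :
    P.ring →ₐ[R] P₀.ring).toLinearMap
  let σₗ : Q.ring →ₗ[R] Q₀.ring := (⟨σ.map.hom, ConcreteCategory.congr_hom σ.w⟩ :
    Q.ring →ₐ[R] Q₀.ring).toLinearMap
  let ψₗ : P.ring →ₗ[R] Q.ring := (⟨ψ.map.hom, ConcreteCategory.congr_hom ψ.w⟩ :
    P.ring →ₐ[R] Q.ring).toLinearMap
  have cπ (x) : π.extMap (eP x) = eP₀ (πₗ.lTensor B x) := by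
    induction x with
    | zero => simp
    | add x y hx hy => rw [map_add, map_add, hx, hy, map_add, map_add]
    | tmul b x =>
      rw [LinearMap.lTensor_tmul, hP, hP₀, map_mul, ← π.inl_extMap]
      exact congrArg (_ * ·) (ConcreteCategory.congr_hom π.inr_extMap x)
  have cσ (x) : σ.extMap (eQ x) = eQ₀ (σₗ.lTensor B x) := by
    induction x with
    | zero => simp
    | add x y hx hy => rw [map_add, map_add, hx, hy, map_add, map_add]
    | tmul b x =>
      rw [LinearMap.lTensor_tmul, hQ, hQ₀, map_mul, ← σ.inl_extMap]
      exact congrArg (_ * ·) (ConcreteCategory.congr_hom σ.inr_extMap x)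
  have cψ (x) : ψ.extMap (eP x) = eQ (ψₗ.lTensor B x) := by
    induction x with
    | zero => simp
    | add x y hx hy => rw [map_add, map_add, hx, hy, map_add, map_add]
    | tmul b x =>
      rw [LinearMap.lTensor_tmul, hP, hQ, map_mul, ← ψ.inl_extMap]
      exact congrArg (_ * ·) (ConcreteCategory.congr_hom ψ.inr_extMap x)
  obtain ⟨h₁, h₂⟩ := flat_lTensor_ker B πₗ σₗ ψₗ hinj hsurj hψ
  constructor
  · intro a ha ha'
    obtain ⟨x, rfl⟩ := eP.surjective a
    rw [cπ, EmbeddingLike.map_eq_zero_iff] at ha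
    rw [cψ, EmbeddingLike.map_eq_zero_iff] at ha'
    rw [h₁ x ha ha', map_zero]
  · intro b hb
    obtain ⟨y, rfl⟩ := eQ.surjective b
    rw [cσ, EmbeddingLike.map_eq_zero_iff] at hb
    obtain ⟨x, hx, rfl⟩ := h₂ y hb
    exact ⟨eP x, by rw [cπ, hx, map_zero], cψ x⟩

end RingExtension

end FlatKernel

/-! ### Base changes of `X` to affine schemes. -/

section CartesianSquares

variable {X S : Scheme.{u}} {f : X ⟶ S}

theorem appLE_appLE_eq {Z Z' : Scheme.{u}} {h : Z' ⟶ Z} {g : Z ⟶ S} {k : Z' ⟶ S} (w : h ≫ g = k)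
    {U : S.Opens} {V : Z.Opens} {V' : Z'.Opens} (e₁ : V ≤ g ⁻¹ᵁ U) (e₂ : V' ≤ h ⁻¹ᵁ V)
    (e₃ : V' ≤ k ⁻¹ᵁ U) : g.appLE U V e₁ ≫ h.appLE V V' e₂ = k.appLE U V' e₃ := by
  subst w
  exact Scheme.Hom.appLE_comp_appLE ..

theorem app_eq_zero_iff {Z Z' : Scheme.{u}} (h : Z' ⟶ Z) {U : Z.Opens} {V : Z'.Opens}
    (e : V = h ⁻¹ᵁ U) (a : Γ(Z, U)) : h.app U a = 0 ↔ h.appLE U V e.le a = 0 := by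
  subst e
  rw [Scheme.Hom.app_eq_appLE]

/-- Base changes of `f : X ⟶ S` to affine schemes. -/
structure BaseChange (f : X ⟶ S) where
  /-- the affine scheme -/
  base : Scheme.{u}
  /-- the base change of `X` -/
  total : Scheme.{u}
  /-- the structure morphism -/
  hom : base ⟶ S
  /-- the first projection -/
  fst : total ⟶ X
  /-- the second projection -/
  snd : total ⟶ base
  isPullback : IsPullback fst snd f hom
  isAffine : IsAffine base

namespace BaseChange

/-- Morphisms of base changes. -/
structure Hom (T' T : BaseChange f) where
  /-- the morphism of base schemes -/
  map : T'.base ⟶ T.base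
  /-- the morphism of total schemes -/
  totalMap : T'.total ⟶ T.total
  w : map ≫ T.hom = T'.hom
  totalMap_fst : totalMap ≫ T.fst = T'.fst
  totalMap_snd : totalMap ≫ T.snd = T'.snd ≫ map

variable [IsAffine S] {W : X.Opens} (hW : IsAffineOpen W)

/-- The ring of functions on the inverse image of an affine open set. -/
def ringExtension (T : BaseChange f) :
    RingExtension (f.appLE ⊤ W le_top) where
  ring := Γ(T.base, ⊤)
  structureMap := T.hom.appLE ⊤ ⊤ le_top
  ext := Γ(T.total, T.fst ⁻¹ᵁ W)
  inl := T.fst.appLE W (T.fst ⁻¹ᵁ W) le_rfl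
  inr := T.snd.appLE ⊤ (T.fst ⁻¹ᵁ W) le_top
  isPushout := by
    have := T.isAffine
    exact (isIso_pushoutSection_iff T.isPullback le_top le_top (by simp)).mp
      (isIso_pushoutSection_of_isAffineOpen T.isPullback _ _ _ (isAffineOpen_top S)
        (isAffineOpen_top T.base) hW)

/-- The restriction of functions along a morphism of base changes. -/
def Hom.ringExtensionHom {T T' : BaseChange f} (h : Hom T' T) :
    RingExtension.Hom (T.ringExtension hW) (T'.ringExtension hW) where
  map := h.map.appLE ⊤ ⊤ le_top
  extMap := h.totalMap.appLE (T.fst ⁻¹ᵁ W) (T'.fst ⁻¹ᵁ W)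
    (preimage_le_preimage h.totalMap h.totalMap_fst W)
  w := appLE_appLE_eq h.w _ _ _
  inl_extMap := appLE_appLE_eq h.totalMap_fst _ _ _
  inr_extMap := (appLE_appLE_eq h.totalMap_snd _ _ _).trans (appLE_appLE_eq rfl _ _ le_top).symm

theorem isAffineHom_fst (T : BaseChange f) : IsAffineHom T.fst := by
  have := T.isAffine
  exact MorphismProperty.of_isPullback T.isPullback.flip
    (inferInstance : IsAffineHom T.hom)

omit [IsAffine S] in
theorem Hom.isPullback {T T' : BaseChange f} (h : Hom T' T) :
    IsPullback h.totalMap T'.snd T.snd h.map := by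
  refine (IsPullback.of_bot ?_ h.totalMap_snd.symm T.isPullback.flip).flip
  rw [h.totalMap_fst, h.w]
  exact T'.isPullback.flip

/-- Deformations of points of a formal Lie group along two nilpotent extensions of the base with
the same kernel agree. -/
theorem isIso_kernelMap [Flat f] {E : BigZariskiSheaf X} (hE : IsFormalLieGroup E)
    {T T₀ T' T₀' : BaseChange f} (i : Hom T₀ T) (i' : Hom T₀' T') (h : Hom T' T) (k : Hom T₀' T₀)
    (hk : i'.map ≫ h.map = k.map ≫ i.map)
    (hk' : i'.totalMap ≫ h.totalMap = k.totalMap ≫ i.totalMap) [Surjective i.map]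
    (hinj : ∀ a, i.map.appTop a = 0 → h.map.appTop a = 0 → a = 0)
    (hsurj : ∀ b, i'.map.appTop b = 0 → ∃ a, i.map.appTop a = 0 ∧ h.map.appTop a = b) :
    IsIso (kernelMap E i.totalMap i.totalMap_fst i'.totalMap i'.totalMap_fst h.totalMap
      h.totalMap_fst k.totalMap hk') := by
  have : Surjective i.totalMap := MorphismProperty.of_isPullback i.isPullback.flip ‹_›
  -- For affine `W` the functions on its inverse images are obtained from those on the affine base
  -- schemes by base change along the flat homomorphism `Γ(S) ⟶ Γ(W)`, so the bijection of kernels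
  -- passes from the base to `X`.
  have hb (W : X.Opens) (hW : IsAffineOpen W) := RingExtension.ker_bijective
    (f.flat_appLE (isAffineOpen_top S) hW le_top) (i.ringExtensionHom hW)
    (i'.ringExtensionHom hW) (h.ringExtensionHom hW)
    (fun a ha ha' => hinj a ((app_eq_zero_iff i.map rfl a).mpr ha)
      ((app_eq_zero_iff h.map rfl a).mpr ha'))
    (fun b hb => by
      obtain ⟨a, ha, ha'⟩ := hsurj b ((app_eq_zero_iff i'.map rfl b).mpr hb)
      refine ⟨a, (app_eq_zero_iff i.map rfl a).mp ha, ?_⟩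
      rw [← ha', Scheme.Hom.appTop, Scheme.Hom.app_eq_appLE]
      rfl)
    (fun a ha => by
      have h1 := (app_eq_zero_iff i.map rfl a).mpr ha
      have h2 := (appLE_appLE_eq (U := ⊤) (V := ⊤) (V' := ⊤) hk le_top le_top le_top).trans
        (appLE_appLE_eq (V := ⊤) rfl le_top le_top le_top).symm
      refine (ConcreteCategory.congr_hom h2 a).trans ?_
      exact (congrArg _ ha).trans (map_zero (k.map.appLE ⊤ ⊤ le_top).hom))
  refine DeformationCohomology.isIso_kernelMap i.totalMap i.totalMap_fst i'.totalMap
    i'.totalMap_fst h.totalMap h.totalMap_fst hE k.totalMap hk' (fun W hW => ?_)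
    (fun W hW a ha ha' => ?_) (fun W hW b hb' => ?_)
  · have := T.isAffineHom_fst
    exact hW.preimage T.fst
  · exact (hb W hW).1 a ((app_eq_zero_iff _ (by rw [← i.totalMap_fst]; rfl) a).mp ha) ha'
  · obtain ⟨a, ha, ha'⟩ := (hb W hW).2 b
      ((app_eq_zero_iff _ (by rw [← i'.totalMap_fst]; rfl) b).mp hb')
    exact ⟨a, (app_eq_zero_iff _ (by rw [← i.totalMap_fst]; rfl) a).mpr ha, ha'⟩

end BaseChange

end CartesianSquares

/-! ### The thickenings `Spec R ⟶ Spec (R ⊕ N)` and `T_red ⟶ T`. -/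

section NilpotentThickening

open NilpotentAlgebra

variable {R : Type u} [CommRing R]

instance (N : NilpotentAlgebra R) : IsAffine (specOver N).left :=
  inferInstanceAs (IsAffine (Spec (.of (Unitization R N.carrier))))

theorem isNilpotent_inr (N : NilpotentAlgebra R) (x : N.carrier) :
    IsNilpotent (Unitization.inr x : Unitization R N.carrier) := by
  obtain ⟨r, -, hr⟩ := N.nilpotent
  refine ⟨r, ?_⟩
  have := hr fun _ => x
  rwa [Finset.prod_const, Finset.card_univ, Fintype.card_fin] at this

/-- A morphism from a reduced scheme to `Spec (R ⊕ N)` factors through `Spec R`. -/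
theorem comp_zeroSection_of_isReduced {T₀ : Scheme.{u}} [IsReduced T₀] (N : NilpotentAlgebra R)
    (m : T₀ ⟶ (specOver N).left) : (m ≫ (specOver N).hom) ≫ (zeroSection N).left = m := by
  have hz : (Scheme.ΓSpecIso (.of (Unitization R N.carrier))).inv ≫ (zeroSection N).left.appTop =
      CommRingCat.ofHom (Unitization.fstHom R N.carrier).toRingHom ≫
        (Scheme.ΓSpecIso (.of R)).inv :=
    (Scheme.ΓSpecIso_inv_naturality _).symm
  have hs : (Scheme.ΓSpecIso (.of R)).inv ≫ (specOver N).hom.appTop =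
      CommRingCat.ofHom (algebraMap R (Unitization R N.carrier)) ≫
        (Scheme.ΓSpecIso (.of (Unitization R N.carrier))).inv :=
    (Scheme.ΓSpecIso_inv_naturality _).symm
  apply ext_of_isAffine
  have hepi : Epi (Scheme.ΓSpecIso (.of (Unitization R N.carrier))).inv := inferInstance
  refine hepi.left_cancellation (Z := Γ(T₀, ⊤)) _ _ ?_
  rw [Scheme.Hom.comp_appTop, Scheme.Hom.comp_appTop]
  have h1 : (Scheme.ΓSpecIso (.of (Unitization R N.carrier))).inv ≫ (zeroSection N).left.appTop ≫
      (specOver N).hom.appTop ≫ m.appTop =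
      CommRingCat.ofHom (Unitization.fstHom R N.carrier).toRingHom ≫
      CommRingCat.ofHom (algebraMap R (Unitization R N.carrier)) ≫
        (Scheme.ΓSpecIso (.of (Unitization R N.carrier))).inv ≫ m.appTop := by
    refine (Category.assoc _ _ _).symm.trans ((congrArg (· ≫ _) hz).trans ?_)
    refine (Category.assoc _ _ _).trans (congrArg (_ ≫ ·) ?_)
    refine (Category.assoc _ _ _).symm.trans ((congrArg (· ≫ _) hs).trans ?_)
    exact Category.assoc _ _ _
  refine h1.trans ?_
  refine CommRingCat.hom_ext (RingHom.ext fun z => ?_)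
  let φ : Unitization R N.carrier →+* Γ(T₀, ⊤) :=
    ((Scheme.ΓSpecIso (.of (Unitization R N.carrier))).inv ≫ m.appTop).hom
  change φ (algebraMap R _ z.fst) = φ z
  -- The elements of `N` are nilpotent in `R ⊕ N`, so a homomorphism to a reduced ring depends only
  -- on the component in `R`.
  have h2 : φ (Unitization.inr z.snd) = 0 := ((isNilpotent_inr N z.snd).map φ).eq_zero
  conv_rhs => rw [← Unitization.inl_fst_add_inr_snd_eq z]
  rw [map_add, h2, add_zero]
  rfl

/-- Every point is the image of the spectrum of its residue field. This is reduced, so its morphism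
to `Spec (R ⊕ N)` factors through the zero section. -/
instance (N : NilpotentAlgebra R) : Surjective (zeroSection N).left where
  surj x := by
    let m := (specOver N).left.fromSpecResidueField x
    obtain ⟨y, hy⟩ : x ∈ Set.range m := by
      rw [Scheme.range_fromSpecResidueField]
      rfl
    refine ⟨(m ≫ (specOver N).hom) y, ?_⟩
    rw [← Scheme.Hom.comp_apply, comp_zeroSection_of_isReduced, hy]

instance (T : Scheme.{u}) : IsClosedImmersion (reducedι T) :=
  inferInstanceAs (IsClosedImmersion T.nilradical.subschemeι)

instance (T : Scheme.{u}) : Surjective (reducedι T) where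
  surj := by
    rw [← Set.range_eq_univ]
    exact (Scheme.IdealSheafData.range_subschemeι _).trans (by
      rw [Scheme.support_nilradical]
      rfl)

end NilpotentThickening

/-! ### The nilradical of an affine noetherian `T` as a nilpotent algebra, and `T ⟶ Spec (R ⊕ N)`.
-/

section NilradicalAlgebra

open NilpotentAlgebra

variable {R : Type u} [CommRing R]

/-- The ring of functions of a scheme over `Spec R`. -/
def functionRing (T : Over (Spec (.of R))) : Type u := Γ(T.left, ⊤)

instance (T : Over (Spec (.of R))) : CommRing (functionRing T) :=
  inferInstanceAs (CommRing Γ(T.left, ⊤))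

instance (T : Over (Spec (.of R))) : Algebra R (functionRing T) :=
  ((Scheme.ΓSpecIso (.of R)).inv ≫ T.hom.appTop).hom.toAlgebra

/-- The functoriality of the ring of functions. -/
def functionRingMap {T T' : Over (Spec (.of R))} (h : T' ⟶ T) :
    functionRing T →ₐ[R] functionRing T' where
  __ := h.left.appTop.hom
  commutes' r := by
    have : T.hom.appTop ≫ h.left.appTop = T'.hom.appTop := by
      rw [← Scheme.Hom.comp_appTop, Over.w]
    exact ConcreteCategory.congr_hom
      (congrArg ((Scheme.ΓSpecIso (.of R)).inv ≫ ·) this) r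

/-- The nilradical as an algebra without unit. -/
def nilSubalgebra (T : Over (Spec (.of R))) : NonUnitalSubalgebra R (functionRing T) where
  carrier := nilradical (functionRing T)
  add_mem' := Ideal.add_mem _
  zero_mem' := Ideal.zero_mem _
  mul_mem' _ h := Ideal.mul_mem_left _ _ h
  smul_mem' r x h := by
    rw [Algebra.smul_def]
    exact Ideal.mul_mem_left _ _ h

/-- The homomorphism from `R ⊕ nil(Γ(T, 𝒪_T))` to `Γ(T, 𝒪_T)`. -/
def unitizationHom (T : Over (Spec (.of R))) :
    Unitization R (nilSubalgebra T) →ₐ[R] functionRing T :=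
  Unitization.lift (NonUnitalSubalgebraClass.subtype (nilSubalgebra T))

theorem unitizationHom_inr (T : Over (Spec (.of R))) (x : nilSubalgebra T) :
    unitizationHom T (Unitization.inr x) = x.1 := by
  simp [unitizationHom]

/-- The homomorphism from `R ⊕ N` to the functions on `T` need not be injective, but on the
augmentation ideal it is the inclusion of `N`. -/
theorem eq_zero_of_fst_eq_zero (T : Over (Spec (.of R))) (z : Unitization R (nilSubalgebra T))
    (h₁ : z.fst = 0) (h₂ : unitizationHom T z = 0) : z = 0 := by
  have h : z = Unitization.inr z.snd := by
    conv_lhs => rw [← Unitization.inl_fst_add_inr_snd_eq z, h₁, Unitization.inl_zero, zero_add]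
  rw [h, unitizationHom_inr] at h₂
  rw [h, show z.snd = 0 from Subtype.ext h₂, Unitization.inr_zero]

/-- The homomorphism induced by `T' ⟶ T` on the nilradicals. -/
def nilSubalgebraMap {T T' : Over (Spec (.of R))} (h : T' ⟶ T) :
    nilSubalgebra T →ₙₐ[R] nilSubalgebra T' :=
  NonUnitalAlgHom.codRestrict ((functionRingMap h : functionRing T →ₙₐ[R] functionRing T').comp
    (NonUnitalSubalgebraClass.subtype (nilSubalgebra T))) (nilSubalgebra T') fun x =>
      IsNilpotent.map (show IsNilpotent x.1 from x.2) (functionRingMap h)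

theorem functionRingMap_unitizationHom {T T' : Over (Spec (.of R))} (h : T' ⟶ T) :
    (functionRingMap h).comp (unitizationHom T) = (unitizationHom T').comp
      (Unitization.lift ((Unitization.inrNonUnitalAlgHom R (nilSubalgebra T')).comp
        (nilSubalgebraMap h))) := by
  apply Unitization.algHom_ext''
  intro x
  have hx : Unitization.lift ((Unitization.inrNonUnitalAlgHom R (nilSubalgebra T')).comp
      (nilSubalgebraMap h)) (Unitization.inr x) = Unitization.inr (nilSubalgebraMap h x) := by
    simp
  rw [AlgHom.comp_apply, AlgHom.comp_apply, unitizationHom_inr, hx]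
  exact (unitizationHom_inr T' (nilSubalgebraMap h x)).symm

theorem isNoetherianRing_functionRing (T : Over (Spec (.of R)))
    (hT : affineNoetherianOver _ T) : IsNoetherianRing (functionRing T) := by
  have := hT.1
  have := hT.2
  exact IsLocallyNoetherian.component_noetherian ⟨⊤, isAffineOpen_top T.left⟩

/-- The nilradical of the ring of functions of an affine noetherian scheme. -/
def nilAlgebra (T : Over (Spec (.of R))) (hT : affineNoetherianOver _ T) :
    NilpotentAlgebra R where
  carrier := nilSubalgebra T
  nilpotent := by
    have := isNoetherianRing_functionRing T hT
    obtain ⟨n, hn⟩ := IsNoetherianRing.isNilpotent_nilradical (functionRing T)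
    -- One more factor than the nilpotency exponent `n`, which could be zero: this guarantees a
    -- nonempty product, whose component in `R` then vanishes.
    refine ⟨n + 1, by omega, fun x => eq_zero_of_fst_eq_zero T _ ?_ ?_⟩
    · change Unitization.fstHom R _ _ = 0
      rw [map_prod]
      exact Finset.prod_eq_zero (Finset.mem_univ 0) (Unitization.fst_inr R (x 0))
    · rw [map_prod]
      simp_rw [unitizationHom_inr]
      have h1 : ∏ i, (x i).1 ∈ nilradical (functionRing T) ^ (n + 1) := by
        have := Ideal.prod_mem_prod (s := Finset.univ)
          (I := fun _ : Fin (n + 1) => nilradical (functionRing T)) fun i _ => (x i).2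
        rwa [Finset.prod_const, Finset.card_univ, Fintype.card_fin] at this
      rw [pow_succ, hn, Ideal.zero_eq_bot, Ideal.bot_mul] at h1
      exact h1

variable {T T' : Over (Spec (.of R))} (hT : affineNoetherianOver _ T)

/-- The functoriality of the nilradical. -/
def nilAlgebraMap (hT' : affineNoetherianOver _ T') (h : T' ⟶ T) :
    nilAlgebra T hT ⟶ nilAlgebra T' hT' :=
  nilSubalgebraMap h

/-- The homomorphism from `R ⊕ nil(Γ(T, 𝒪_T))` to `Γ(T, 𝒪_T)`. -/
def nilAlgebraHom : CommRingCat.of (Unitization R (nilAlgebra T hT).carrier) ⟶ Γ(T.left, ⊤) :=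
  CommRingCat.ofHom (S := Γ(T.left, ⊤)) (unitizationHom T).toRingHom

theorem algebraMap_nilAlgebraHom :
    CommRingCat.ofHom (algebraMap R (Unitization R (nilAlgebra T hT).carrier)) ≫
      nilAlgebraHom hT = (Scheme.ΓSpecIso (.of R)).inv ≫ T.hom.appTop :=
  CommRingCat.hom_ext (RingHom.ext fun r => (unitizationHom T).commutes r)

theorem nilAlgebraHom_naturality (hT' : affineNoetherianOver _ T') (h : T' ⟶ T) :
    nilAlgebraHom hT ≫ h.left.appTop =
      CommRingCat.ofHom (unitizationMap (nilAlgebraMap hT hT' h)).toRingHom ≫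
        nilAlgebraHom hT' :=
   CommRingCat.hom_ext (RingHom.ext fun z =>
    DFunLike.congr_fun (functionRingMap_unitizationHom h) z)

/-- The canonical morphism `T ⟶ Spec (R ⊕ nil(Γ(T, 𝒪_T)))`. -/
def toNilSpec : T ⟶ specOver (nilAlgebra T hT) :=
  Over.homMk (V := specOver (nilAlgebra T hT)) (T.left.toSpecΓ ≫ Spec.map (nilAlgebraHom hT)) (by
    simp only [specOver, Over.mk_hom]
    rw [Category.assoc, ← Spec.map_comp, algebraMap_nilAlgebraHom, Spec.map_comp,
      ← Scheme.toSpecΓ_naturality_assoc, toSpecΓ_SpecMap_ΓSpecIso_inv]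
    exact Category.comp_id _)

theorem toNilSpec_appTop :
    (Scheme.ΓSpecIso (.of (Unitization R (nilAlgebra T hT).carrier))).inv ≫
      (toNilSpec hT).left.appTop = nilAlgebraHom hT := by
  have h : (toNilSpec hT).left.appTop = (Spec.map (nilAlgebraHom hT)).appTop ≫
    T.left.toSpecΓ.appTop := Scheme.Hom.comp_appTop _ _
  rw [h, Scheme.toSpecΓ_appTop, ← Scheme.ΓSpecIso_inv_naturality_assoc, Iso.inv_hom_id,
    Category.comp_id]

theorem toNilSpec_naturality (hT' : affineNoetherianOver _ T') (h : T' ⟶ T) :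
    h ≫ toNilSpec hT = toNilSpec hT' ≫ specOverMap (nilAlgebraMap hT hT' h) := by
  ext1
  change h.left ≫ T.left.toSpecΓ ≫ Spec.map (nilAlgebraHom hT) =
    (T'.left.toSpecΓ ≫ Spec.map (nilAlgebraHom hT')) ≫ Spec.map _
  rw [Scheme.toSpecΓ_naturality_assoc, ← Spec.map_comp, nilAlgebraHom_naturality hT hT',
    Category.assoc, ← Spec.map_comp]

end NilradicalAlgebra

theorem restrictHom_eq_zero_of_factor {X Y Z Z' : Scheme.{u}} (E : BigZariskiSheaf X)
    {p : Y ⟶ X} {r : Z ⟶ X} {r' : Z' ⟶ X} (i : Z ⟶ Y) (wi : i ≫ p = r) (i' : Z' ⟶ Y)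
    (wi' : i' ≫ p = r') (k : Z' ⟶ Z) (hk : k ≫ i = i') (U : Y.Opens)
    (s : (smallRestrict E p).obj.obj (op U)) (hs : (restrictHom E i wi).hom.app (op U) s = 0) :
    (restrictHom E i' wi').hom.app (op U) s = 0 := by
  have wk : k ≫ r = r' := by rw [← wi, reassoc_of% hk, wi']
  have hle : i' ⁻¹ᵁ U ≤ k ⁻¹ᵁ (i ⁻¹ᵁ U) := by
    rw [← Scheme.Hom.comp_preimage, hk]
  refine (map_map_apply' E _ _ _
    (opensOverHom_comp i wi k wk i' wi' hk U _ _ le_rfl hle le_rfl) s).symm.trans ?_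
  exact (congrArg (E.obj.map _) hs).trans (map_zero _)

/-! ### The kernels of functions for the two thickenings coincide. -/

section NilpotentKernel

open NilpotentAlgebra

variable {R : Type u} [CommRing R]

theorem zeroSection_appTop_eq_zero_iff (N : NilpotentAlgebra R) (z : Unitization R N.carrier) :
    (zeroSection N).left.appTop ((Scheme.ΓSpecIso (.of (Unitization R N.carrier))).inv z) = 0 ↔
      z.fst = 0 := by
  have hz : (Scheme.ΓSpecIso (.of (Unitization R N.carrier))).inv ≫ (zeroSection N).left.appTop =
      CommRingCat.ofHom (Unitization.fstHom R N.carrier).toRingHom ≫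
        (Scheme.ΓSpecIso (.of R)).inv :=
    (Scheme.ΓSpecIso_inv_naturality _).symm
  have h1 : (zeroSection N).left.appTop ((Scheme.ΓSpecIso (.of (Unitization R N.carrier))).inv z) =
    (Scheme.ΓSpecIso (.of R)).inv z.fst := ConcreteCategory.congr_hom hz z
  have hinj : Function.Injective (Scheme.ΓSpecIso (.of R)).inv :=
    (ConcreteCategory.bijective_of_isIso _).1
  rw [h1]
  exact ⟨fun h => hinj (h.trans (map_zero _).symm),
    fun h => (congrArg (Scheme.ΓSpecIso (.of R)).inv h).trans (map_zero _)⟩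

variable {T : Over (Spec (.of R))} (hT : affineNoetherianOver _ T)

theorem toNilSpec_appTop_apply (z : Unitization R (nilSubalgebra T)) :
    (toNilSpec hT).left.appTop
      ((Scheme.ΓSpecIso (.of (Unitization R (nilAlgebra T hT).carrier))).inv z) =
      unitizationHom T z :=
  ConcreteCategory.congr_hom (toNilSpec_appTop hT) z

/-- Injectivity half of the coincidence: the functions vanishing on the zero section form `N`, on
which pull-back to `T` is the inclusion of the nilradical. -/
theorem toNilSpec_appTop_injOn (a : Γ((specOver (nilAlgebra T hT)).left, ⊤))
    (h₁ : (zeroSection (nilAlgebra T hT)).left.appTop a = 0)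
    (h₂ : (toNilSpec hT).left.appTop a = 0) : a = 0 := by
  have hsurj : Function.Surjective
      (Scheme.ΓSpecIso (.of (Unitization R (nilAlgebra T hT).carrier))).inv :=
    (ConcreteCategory.bijective_of_isIso _).2
  obtain ⟨z, rfl⟩ := hsurj a
  have hz := eq_zero_of_fst_eq_zero T z ((zeroSection_appTop_eq_zero_iff _ z).mp h₁)
    ((toNilSpec_appTop_apply hT z).symm.trans h₂)
  exact (congrArg (Scheme.ΓSpecIso (.of (Unitization R (nilAlgebra T hT).carrier))).inv hz).trans
    (map_zero _)

/-- Surjectivity half: a function vanishing on `T_red` is nilpotent and hence is itself an element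
of `N`. -/
theorem exists_toNilSpec_appTop_eq (b : Γ(T.left, ⊤)) (hb : (reducedι T.left).appTop b = 0) :
    ∃ a, (zeroSection (nilAlgebra T hT)).left.appTop a = 0 ∧
      (toNilSpec hT).left.appTop a = b := by
  have := hT.1
  have hn : IsNilpotent b := isNilpotent_of_app_eq_zero (reducedι T.left)
    (isAffineOpen_top T.left) b hb
  let x : nilSubalgebra T := ⟨b, hn⟩
  refine ⟨(Scheme.ΓSpecIso (.of (Unitization R (nilAlgebra T hT).carrier))).inv
    (Unitization.inr x : Unitization R (nilSubalgebra T)), ?_, ?_⟩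
  · exact (zeroSection_appTop_eq_zero_iff _ _).mpr (Unitization.fst_inr R x)
  · exact (toNilSpec_appTop_apply hT _).trans (unitizationHom_inr T x)

theorem reducedι_toNilSpec : reducedι T.left ≫ (toNilSpec hT).left =
    (reducedι T.left ≫ T.hom) ≫ (zeroSection (nilAlgebra T hT)).left := by
  have := isReduced_reduced T.left
  refine (comp_zeroSection_of_isReduced _ _).symm.trans (congrArg (· ≫ _) ?_)
  exact (Category.assoc _ _ _).trans (congrArg (_ ≫ ·) (Over.w (toNilSpec hT)))

end NilpotentKernel

/-! ### Base changes of `X`, and of `S` itself, attached to affine `S`-schemes. -/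

section BaseChangeOfOver

variable {X S : Scheme.{u}} (f : X ⟶ S)

/-- The base change of `X` to an affine scheme over `S`. -/
def BaseChange.ofOver (T : Over S) (hT : IsAffine T.left) : BaseChange f where
  base := T.left
  total := pullback f T.hom
  hom := T.hom
  fst := pullback.fst f T.hom
  snd := pullback.snd f T.hom
  isPullback := .of_hasPullback ..
  isAffine := hT

/-- The functoriality of the base change. -/
def BaseChange.Hom.ofOver {T T' : Over S} (hT : IsAffine T.left) (hT' : IsAffine T'.left)
    (h : T' ⟶ T) : BaseChange.Hom (BaseChange.ofOver f T' hT') (BaseChange.ofOver f T hT) where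
  map := h.left
  totalMap := prodMap f h.left (Over.w h)
  w := Over.w h
  totalMap_fst := prodMap_fst ..
  totalMap_snd := prodMap_snd ..

/-- An affine scheme over `S` as a base change of `S`. -/
def BaseChange.self (T : Over S) (hT : IsAffine T.left) : BaseChange (𝟙 S) where
  base := T.left
  total := T.left
  hom := T.hom
  fst := T.hom
  snd := 𝟙 _
  isPullback := IsPullback.of_vert_isIso ⟨by simp⟩
  isAffine := hT

/-- The morphism of base changes of `S` given by a morphism over `S`. -/
def BaseChange.Hom.self {T T' : Over S} (hT : IsAffine T.left) (hT' : IsAffine T'.left)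
    (h : T' ⟶ T) : BaseChange.Hom (BaseChange.self T' hT') (BaseChange.self T hT) where
  map := h.left
  totalMap := h.left
  w := Over.w h
  totalMap_fst := Over.w h
  totalMap_snd := (Category.comp_id _).trans (Category.id_comp _).symm

end BaseChangeOfOver

theorem isAffine_reduced (T : Scheme.{u}) [IsAffine T] : IsAffine (reduced T) :=
  isAffine_of_isAffineHom (reducedι T)

theorem isIso_push_map {Y Z : TopCat.{u}} (π : Y ⟶ Z) {F G : AbSheaf Y} (m : F ⟶ G) (h : IsIso m) :
    IsIso ((push π).map m) :=
  inferInstance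

/-! ### Identification of `Ẽ_N` with the direct image of `Ẽ_T` on `X`. -/

section KernelKernel

variable {Y Y' : TopCat.{u}} (h : Y' ⟶ Y) {F G : AbSheaf Y} {F' G' : AbSheaf Y'}
    (φ : F ⟶ G) (φ' : F' ⟶ G') (a : F ⟶ (push h).obj F')
    (w : ∀ (U : Opens Y) (s : F.obj.obj (op U)), φ.hom.app (op U) s = 0 →
      φ'.hom.app (op ((Opens.map h).obj U)) (a.hom.app (op U) s) = 0)

/-- The inclusion of `ker φ ∩ ker a` into `ker a`. -/
def kernelKernelIncl : kernelSheaf (kernelHom h φ φ' a w) ⟶ kernelSheaf a :=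
  ⟨{ app _ := AddCommGrpCat.ofHom
      { toFun s := ⟨s.1.1, congrArg Subtype.val s.2⟩
        map_zero' := rfl
        map_add' _ _ := rfl }
     naturality _ _ _ := rfl }⟩

theorem kernelKernelIncl_val (U : Opens Y)
    (s : (kernelSheaf (kernelHom h φ φ' a w)).obj.obj (op U)) :
    (secHom (kernelKernelIncl h φ φ' a w) U s).1 = s.1.1 := rfl

theorem isIso_kernelKernelIncl
    (hle : ∀ (U : Opens Y) (s : F.obj.obj (op U)), a.hom.app (op U) s = 0 →
      φ.hom.app (op U) s = 0) : IsIso (kernelKernelIncl h φ φ' a w) := by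
  apply isIso_of_bijective_basis
  intro U x hx
  refine ⟨U, le_rfl, hx, ?_, ?_⟩
  · intro s t hst
    exact Subtype.ext (Subtype.ext (congrArg (fun r => r.1) hst))
  · intro s
    exact ⟨⟨⟨s.1, hle U s.1 s.2⟩, Subtype.ext s.2⟩, rfl⟩

end KernelKernel

section NilSheafComparison

open NilpotentAlgebra

variable {R : Type u} [CommRing R] {X : Scheme.{u}} (f : X ⟶ Spec (.of R)) (E : BigZariskiSheaf X)

/-- The sections of `E` over `X_{Spec (R ⊕ N)}` which vanish on `X`. -/
def zeroSectionKernel (N : NilpotentAlgebra R) : AbSheaf ↑(pullback f (specOver N).hom) :=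
  kernelSheaf (restrictHom E (prodMap f (zeroSection N).left (Over.w (zeroSection N)))
    (prodMap_fst ..))

/-- The inclusion of `Ẽ_N` into `E|_{X_{Spec (R ⊕ N)}}`. -/
def nilIncl (N : NilpotentAlgebra R) : nilSheaf f E N ⟶ zeroSectionKernel f E N :=
  kernelKernelIncl _ _ _ _ _

/-- The reduced subscheme of `Spec (R ⊕ N)` maps through the zero section, so a section of `E`
vanishing on `X` automatically lies in `Ẽ`. Thus `Ẽ_N` is the kernel of `E` itself along the zero
section. -/
theorem tilde_of_zeroSectionKernel (N : NilpotentAlgebra R)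
    (U : (pullback f (specOver N).hom).Opens)
    (s : (smallRestrict E (pullback.fst f (specOver N).hom)).obj.obj (op U))
    (hs : (restrictHom E (prodMap f (zeroSection N).left (Over.w (zeroSection N)))
      (prodMap_fst ..)).hom.app (op U) s = 0) :
    (restrictHom E (prodMap f (reducedι (specOver N).left)
      (rfl : reducedι (specOver N).left ≫ (specOver N).hom = _))
      (prodMap_fst ..)).hom.app (op U) s = 0 := by
  have := isReduced_reduced (specOver N).left
  refine restrictHom_eq_zero_of_factor E _ _ _ _
    (prodMap f (g := 𝟙 _) (reducedι (specOver N).left ≫ (specOver N).hom) (Category.comp_id _))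
    ?_ U s hs
  exact prodMap_comp f _ _ _ _ _ _ (comp_zeroSection_of_isReduced N _)

instance (N : NilpotentAlgebra R) : IsIso (nilIncl f E N) :=
  isIso_kernelKernelIncl _ _ _ _ _ (tilde_of_zeroSectionKernel f E N)

variable {T : Over (Spec (.of R))} (hT : affineNoetherianOver _ T)

theorem prodMap_reducedι_toNilSpec :
    prodMap f (reducedι T.left) (rfl : reducedι T.left ≫ T.hom = _) ≫
      prodMap f (toNilSpec hT).left (Over.w (toNilSpec hT)) =
    prodMap f (g := 𝟙 _) (reducedι T.left ≫ T.hom) (Category.comp_id _) ≫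
      prodMap f (zeroSection (nilAlgebra T hT)).left (Over.w (zeroSection (nilAlgebra T hT))) := by
  have hw : (reducedι T.left ≫ (toNilSpec hT).left) ≫ (specOver (nilAlgebra T hT)).hom =
      reducedι T.left ≫ T.hom :=
    (Category.assoc _ _ _).trans (congrArg (_ ≫ ·) (Over.w (toNilSpec hT)))
  exact (prodMap_comp f _ _ _ _ _ hw rfl).trans
    (prodMap_comp f _ _ _ _ _ hw (reducedι_toNilSpec hT).symm).symm

/-- The comparison of the kernels for `Spec R ⟶ Spec (R ⊕ nil(Γ(T, 𝒪_T)))` and `T_red ⟶ T`. -/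
def nilKernelMap :
    (push (pullback.fst f (specOver (nilAlgebra T hT)).hom).base).obj
      (zeroSectionKernel f E (nilAlgebra T hT)) ⟶
    (push (pullback.fst f T.hom).base).obj (tildeSheaf f E T.hom) :=
  kernelMap E _ _ _ _ (prodMap f (toNilSpec hT).left (Over.w (toNilSpec hT))) (prodMap_fst ..) _
    (prodMap_reducedι_toNilSpec f hT)

theorem isIso_nilKernelMap [Flat f] (hE : IsFormalLieGroup E) : IsIso (nilKernelMap f E hT) := by
  have := hT.1
  have := isAffine_reduced T.left
  let h₀ : IsAffine (Over.mk (𝟙 (Spec (.of R)))).left := inferInstanceAs (IsAffine (Spec (.of R)))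
  let h₁ : IsAffine (Over.mk (reducedι T.left ≫ T.hom)).left := isAffine_reduced T.left
  let i := BaseChange.Hom.ofOver f inferInstance h₀ (zeroSection (nilAlgebra T hT))
  let i' : BaseChange.Hom (BaseChange.ofOver f _ h₁) (BaseChange.ofOver f T hT.1) :=
    BaseChange.Hom.ofOver f hT.1 h₁ (Over.homMk (reducedι T.left))
  let h := BaseChange.Hom.ofOver f inferInstance hT.1 (toNilSpec hT)
  let k : BaseChange.Hom (BaseChange.ofOver f _ h₁) (BaseChange.ofOver f _ h₀) :=
    BaseChange.Hom.ofOver f h₀ h₁ (Over.homMk (reducedι T.left ≫ T.hom) (Category.comp_id _))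
  have : Surjective i.map := inferInstanceAs (Surjective (zeroSection (nilAlgebra T hT)).left)
  exact BaseChange.isIso_kernelMap hE i i' h k (reducedι_toNilSpec hT)
    (prodMap_reducedι_toNilSpec f hT) (toNilSpec_appTop_injOn hT) (exists_toNilSpec_appTop_eq hT)

/-- The comparison of `Ẽ_N` for `N = nil(Γ(T, 𝒪_T))` with `Ẽ_T`. -/
def nilComparison :
    (push (pullback.fst f (specOver (nilAlgebra T hT)).hom).base).obj
      (nilSheaf f E (nilAlgebra T hT)) ⟶
    (push (pullback.fst f T.hom).base).obj (tildeSheaf f E T.hom) :=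
  (push (pullback.fst f (specOver (nilAlgebra T hT)).hom).base).map
    (nilIncl f E (nilAlgebra T hT)) ≫ nilKernelMap f E hT

theorem isIso_nilComparison [Flat f] (hE : IsFormalLieGroup E) : IsIso (nilComparison f E hT) := by
  have h₁ := isIso_nilKernelMap f E hT hE
  have h₂ := isIso_push_map (pullback.fst f (specOver (nilAlgebra T hT)).hom).base
    (nilIncl f E (nilAlgebra T hT)) inferInstance
  exact IsIso.comp_isIso' h₂ h₁

theorem nilKernelMap_val (U : X.Opens)
    (s : ((push (pullback.fst f (specOver (nilAlgebra T hT)).hom).base).obj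
      (zeroSectionKernel f E (nilAlgebra T hT))).obj.obj (op U)) :
    (secHom (nilKernelMap f E hT) U s).1 =
      E.obj.map (opensOverHom _ (prodMap_fst ..) _ _
        (fst_preimage_le f (toNilSpec hT).left (Over.w (toNilSpec hT)) U)).op s.1 :=
  kernelMap_val _ _ _ (prodMap_fst ..) (prodMap f (toNilSpec hT).left (Over.w (toNilSpec hT)))
    (prodMap_fst ..) _ (prodMap_reducedι_toNilSpec f hT) U s

theorem nilIncl_val (N : NilpotentAlgebra R) (U : (pullback f (specOver N).hom).Opens)
    (s : (nilSheaf f E N).obj.obj (op U)) : (secHom (nilIncl f E N) U s).1 = s.1.1 :=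
  kernelKernelIncl_val _ _ _ _ _ U s

theorem secHom_push_map {Y Z : TopCat.{u}} (π : Y ⟶ Z) {F G : AbSheaf Y} (m : F ⟶ G) (U : Opens Z)
    (s : ((push π).obj F).obj.obj (op U)) :
    secHom ((push π).map m) U s = secHom m ((Opens.map π).obj U) s :=
  rfl

theorem nilComparison_val (U : X.Opens)
    (s : ((push (pullback.fst f (specOver (nilAlgebra T hT)).hom).base).obj
      (nilSheaf f E (nilAlgebra T hT))).obj.obj (op U)) :
    (secHom (nilComparison f E hT) U s).1 =
      E.obj.map (opensOverHom _ (prodMap_fst ..) _ _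
        (fst_preimage_le f (toNilSpec hT).left (Over.w (toNilSpec hT)) U)).op s.1.1 := by
  unfold nilComparison
  rw [secHom_comp, nilKernelMap_val, secHom_push_map]
  exact congrArg _ (nilIncl_val f E _ _ s)

/-- The projection `X_T ⟶ X` is affine, so small affine open sets of `X` have inverse images in the
basis over which `Ẽ_T` splits; hence the direct image, which is `Ẽ_N`, has the cohomology of `Ẽ_T`.
-/
theorem isIso_cohMap_nilComparison [Flat f] (hE : IsFormalLieGroup E) (q : ℕ) :
    IsIso (cohMap (pullback.fst f T.hom).base (nilComparison f E hT) q) := by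
  have := hT.1
  have h₀ := isIso_nilComparison f E hT hE
  have hp := isPullback_prodMap f (reducedι T.left) (rfl : reducedι T.left ≫ T.hom = _)
  have h₁ : Surjective (prodMap f (reducedι T.left) (rfl : reducedι T.left ≫ T.hom = _)) :=
    MorphismProperty.of_isPullback hp.flip inferInstance
  have h₂ : QuasiCompact (prodMap f (reducedι T.left) (rfl : reducedι T.left ≫ T.hom = _)) :=
    MorphismProperty.of_isPullback hp.flip inferInstance
  have h₃ : IsAffineHom (pullback.fst f T.hom) :=
    (BaseChange.ofOver f T hT.1).isAffineHom_fst
  refine isIso_cohMap (pullback.fst f T.hom).base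
    (B := smallAffineBasis E (pullback.fst f T.hom))
    (splits_kernelSheaf (prodMap f (reducedι T.left) (rfl : reducedι T.left ≫ T.hom = _))
      (prodMap_fst ..)) ?_ (nilComparison f E hT) h₀ q
  intro U x hx
  obtain ⟨W₀, hxW₀, hκ⟩ := hE.exists_coord x
  obtain ⟨W, hWa, hxW, hWle⟩ := Opens.isBasis_iff_nbhd.mp X.isBasis_affineOpens
    (show x ∈ U ⊓ W₀ from ⟨hx, hxW₀⟩)
  refine ⟨W, hWle.trans inf_le_left, hxW, ?_⟩
  exact ⟨IsAffineOpen.preimage hWa (pullback.fst f T.hom), W₀, hκ, fun y hy => (hWle hy).2⟩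

end NilSheafComparison

theorem bijective_secHom {Y : TopCat.{u}} {F G : AbSheaf Y} (φ : F ⟶ G) (h : IsIso φ)
    (U : Opens Y) : Function.Bijective (secHom φ U) := by
  have := isIso_app φ h U
  exact ConcreteCategory.bijective_of_isIso (φ.hom.app (op U))

/-! ### Points of a formal Lie group on reduced schemes and on open subschemes. -/

section Points

variable {S : Scheme.{u}}

theorem opensOverHom_openIncl {T T' : Over S} (h : T' ⟶ T) (U : T.left.Opens)
    (V : T'.left.Opens) (e : V ≤ h.left ⁻¹ᵁ U) :
    opensOverHom h.left (Over.w h) U V e ≫ openIncl T U = openIncl T' V ≫ h := by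
  ext1
  exact Scheme.Hom.resLE_comp_ι _ _

theorem openIncl_top_toTop (T : Over S) : openIncl T ⊤ ≫ toTop T = 𝟙 _ :=
  (openIncl_toTop T ⊤).trans ((opensOver T.hom).map_id ⊤)

theorem map_openIncl_top_injective (G : (Over S)ᵒᵖ ⥤ AddCommGrpCat.{u}) (T : Over S)
    {x y : G.obj (op T)} (h : G.map (openIncl T ⊤).op x = G.map (openIncl T ⊤).op y) : x = y := by
  have := congrArg (G.map (toTop T).op) h
  rwa [map_comp_apply', map_comp_apply', map_id_apply, map_id_apply] at this <;>
    exact toTop_openIncl T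

theorem map_openIncl_toTop (G : (Over S)ᵒᵖ ⥤ AddCommGrpCat.{u}) (T : Over S)
    (s : G.obj (op ((opensOver T.hom).obj ⊤))) :
    G.map (openIncl T ⊤).op (G.map (toTop T).op s) = s :=
  (map_comp_apply' G _ _ _ (openIncl_top_toTop T) s).trans (map_id_apply G s)

/-- Locally the point has coordinates, and on a reduced scheme these vanish, as do those of the
origin. -/
theorem IsFormalLieGroup.eq_zero_of_isReduced {G : BigZariskiSheaf S} (hG : IsFormalLieGroup G)
    (Z : Over S) (hZ : IsReduced Z.left) (s : G.obj.obj (op Z)) : s = 0 := by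
  refine (isZariskiSheaf_bigZariskiSheaf G).eq_of_locally _ _ fun z => ?_
  obtain ⟨W, hzW, ⟨κ⟩⟩ := hG.exists_coord (Z.hom z)
  have hU (x) : ((opensOver Z.hom).obj (Z.hom ⁻¹ᵁ W)).hom x ∈ W :=
    openIncl_mem Z (Z.hom ⁻¹ᵁ W) x
  have hred : IsReduced ((opensOver Z.hom).obj (Z.hom ⁻¹ᵁ W)).left :=
    inferInstanceAs (IsReduced (Z.hom ⁻¹ᵁ W).toScheme)
  refine ⟨_, openIncl Z (Z.hom ⁻¹ᵁ W), inferInstance, openIncl_range Z _ z hzW,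
    κ.injective _ hU ?_⟩
  funext i
  rw [κ.coord_reduced, κ.coord_reduced]

end Points

/-! ### The points of a formal Lie group over `S` on an affine noetherian scheme. -/

section NilPoints

open NilpotentAlgebra

variable {R : Type u} [CommRing R] (G : BigZariskiSheaf (Spec (.of R)))

/-- The map `ker (G(R ⊕ N) ⟶ G(R)) ⟶ G(T)` for `N = nil(Γ(T, 𝒪_T))`. -/
def nilPointsMap {T : Over (Spec (.of R))} (hT : affineNoetherianOver _ T) :
    (nilPoints G).obj (nilAlgebra T hT) ⟶ G.obj.obj (op T) :=
  AddCommGrpCat.ofHom ((G.obj.map (toNilSpec hT).op).hom.comp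
    (G.obj.map (zeroSection (nilAlgebra T hT)).op).hom.ker.subtype)

theorem nilPointsMap_naturality {T T' : Over (Spec (.of R))} (hT : affineNoetherianOver _ T)
    (hT' : affineNoetherianOver _ T') (h : T' ⟶ T) :
    nilPointsMap G hT ≫ G.obj.map h.op =
      (nilPoints G).map (nilAlgebraMap hT hT' h) ≫ nilPointsMap G hT' := by
  ext s
  exact map_map_apply G _ _ _ _ (toNilSpec_naturality hT hT' h) s.1

variable {G} in
-- This is the comparison of kernels for the identity of `Spec R` instead of `f`, read on global
-- sections. The passage between a scheme and its largest open subscheme accounts for `openIncl` and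
-- `toTop`.
theorem bijective_nilPointsMap (hG : IsFormalLieGroup G) {T : Over (Spec (.of R))}
    (hT : affineNoetherianOver _ T) : Function.Bijective (nilPointsMap G hT) := by
  have := hT.1
  let h₀ : IsAffine (Over.mk (𝟙 (Spec (.of R)))).left := inferInstanceAs (IsAffine (Spec (.of R)))
  let h₁ : IsAffine (Over.mk (reducedι T.left ≫ T.hom)).left := isAffine_reduced T.left
  let i := BaseChange.Hom.self inferInstance h₀ (zeroSection (nilAlgebra T hT))
  let i' : BaseChange.Hom (BaseChange.self _ h₁) (BaseChange.self T hT.1) :=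
    BaseChange.Hom.self hT.1 h₁ (Over.homMk (reducedι T.left))
  let h := BaseChange.Hom.self inferInstance hT.1 (toNilSpec hT)
  let k : BaseChange.Hom (BaseChange.self _ h₁) (BaseChange.self _ h₀) :=
    BaseChange.Hom.self h₀ h₁ (Over.homMk (reducedι T.left ≫ T.hom) (Category.comp_id _))
  have : Surjective i.map := inferInstanceAs (Surjective (zeroSection (nilAlgebra T hT)).left)
  let z := zeroSection (nilAlgebra T hT)
  let t := toNilSpec hT
  have hbij := bijective_secHom _ (BaseChange.isIso_kernelMap hG i i' h k (reducedι_toNilSpec hT)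
    (reducedι_toNilSpec hT) (toNilSpec_appTop_injOn hT) (exists_toNilSpec_appTop_eq hT)) ⊤
  have hval := kernelMap_val (E := G) i.totalMap i.totalMap_fst i'.totalMap i'.totalMap_fst
    h.totalMap h.totalMap_fst k.totalMap (reducedι_toNilSpec hT) ⊤
  have hz (x : G.obj.obj (op (specOver (nilAlgebra T hT)))) :
      (restrictHom G z.left (Over.w z)).hom.app (op ⊤) (G.obj.map (openIncl _ ⊤).op x) =
        G.obj.map (openIncl _ ⊤).op (G.obj.map z.op x) :=
    map_map_apply G _ _ _ _ (opensOverHom_openIncl z ⊤ ⊤ le_top) x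
  have ht (x : G.obj.obj (op (specOver (nilAlgebra T hT)))) :
      G.obj.map (opensOverHom t.left (Over.w t) ⊤ ⊤ le_top).op (G.obj.map (openIncl _ ⊤).op x) =
        G.obj.map (openIncl _ ⊤).op (G.obj.map t.op x) :=
    map_map_apply G _ _ _ _ (opensOverHom_openIncl t ⊤ ⊤ le_top) x
  constructor
  · rw [injective_iff_map_eq_zero]
    intro x hx
    have hx0 : (restrictHom G z.left (Over.w z)).hom.app (op ⊤)
        (G.obj.map (openIncl _ ⊤).op x.1) = 0 :=
      (hz x.1).trans ((congrArg _ x.2).trans (map_zero _))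
    have hx1 := (injective_iff_map_eq_zero _).mp hbij.1 ⟨G.obj.map (openIncl _ ⊤).op x.1, hx0⟩
      (Subtype.ext ((hval _).trans ((ht x.1).trans ((congrArg _ hx).trans (map_zero _)))))
    refine Subtype.ext (map_openIncl_top_injective G.obj _ ?_)
    exact (congrArg Subtype.val hx1).trans (map_zero _).symm
  · intro y
    have hred : IsReduced ((opensOver (reducedι T.left ≫ T.hom)).obj
        (reducedι T.left ⁻¹ᵁ ⊤)).left := by
      have := isReduced_reduced T.left
      exact inferInstanceAs (IsReduced (reducedι T.left ⁻¹ᵁ ⊤).toScheme)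
    -- Every point of `G` on `T` lies in the kernel of the restriction to `T_red`, so the kernel is
    -- all of `G(T)`.
    obtain ⟨s, hs⟩ := hbij.2 ⟨G.obj.map (openIncl T ⊤).op y, hG.eq_zero_of_isReduced _ hred _⟩
    have hs' := (hval s).symm.trans (congrArg Subtype.val hs)
    let x := G.obj.map (toTop (specOver (nilAlgebra T hT))).op s.1
    have hx : G.obj.map (openIncl _ ⊤).op x = s.1 := map_openIncl_toTop G.obj _ _
    refine ⟨⟨x, ?_⟩, ?_⟩
    · refine map_openIncl_top_injective G.obj _ ((hz x).symm.trans ?_)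
      exact (congrArg _ hx).trans (Eq.trans s.2 (map_zero _).symm)
    · refine map_openIncl_top_injective G.obj _ ((ht x).symm.trans ?_)
      exact (congrArg _ hx).trans hs'

end NilPoints

theorem secHom_toPushId {Y : TopCat.{u}} (F : AbSheaf Y) (U : Opens Y) (s : F.obj.obj (op U)) :
    secHom ((toPushId Y).app F) U s = s :=
  ConcreteCategory.congr_hom (F.obj.map_id (op U)) s

/-- A criterion for the commutativity of a square of morphisms to direct images. -/
theorem comp_pushCongr_eq {X Y Y' : TopCat.{u}} {π : Y ⟶ X} {ρ : Y' ⟶ Y} {σ : Y' ⟶ X}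
    (e : ρ ≫ π = σ ≫ 𝟙 X) {F G : AbSheaf X} {F₁ : AbSheaf Y} {F' : AbSheaf Y'}
    (φ : F ⟶ (push π).obj F₁) (m : F₁ ⟶ (push ρ).obj F') (n : F ⟶ G) (φ' : G ⟶ (push σ).obj F')
    (he : ∀ U : Opens X, (Opens.map σ).obj U ≤ (Opens.map ρ).obj ((Opens.map π).obj U))
    (h : ∀ (U : Opens X) (s : F.obj.obj (op U)),
      resHom F' (he U) (secHom m ((Opens.map π).obj U) (secHom φ U s)) =
        secHom φ' U (secHom n U s)) :
    (φ ≫ (push π).map m) ≫ pushCongr e F' = (n ≫ (toPushId X).app G) ≫ (push (𝟙 X)).map φ' := by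
  apply Sheaf.hom_ext
  ext U s
  refine (h U.unop s).trans ?_
  exact (congrArg (secHom φ' U.unop) (secHom_toPushId G U.unop (secHom n U.unop s))).symm

/-! ### Naturality of the comparison in `T`. -/

section Comparison

open NilpotentAlgebra

theorem resHom_tildeSheaf_val {X S T : Scheme.{u}} (f : X ⟶ S) (E : BigZariskiSheaf X) (g : T ⟶ S)
    {U V : (pullback f g).Opens} (h : V ≤ U) (s : (tildeSheaf f E g).obj.obj (op U)) :
    (resHom (tildeSheaf f E g) h s).1 =
      E.obj.map (opensOverHom (𝟙 _) (Category.id_comp _) U V h).op s.1 :=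
  congrArg (fun k => E.obj.map (Quiver.Hom.op k) s.1)
    (opensOverHom_id (homOfLE h) (𝟙 _) rfl (Category.id_comp _) h).symm

theorem tildeHom_val {X S T T' : Scheme.{u}} (f : X ⟶ S) (E : BigZariskiSheaf X) {g : T ⟶ S}
    {g' : T' ⟶ S} (h : T' ⟶ T) (w : h ≫ g = g') (U : (pullback f g).Opens)
    (s : (tildeSheaf f E g).obj.obj (op U)) :
    (secHom (tildeHom f E h w) U s).1 =
      E.obj.map (opensOverHom (prodMap f h w) (prodMap_fst ..) U _ le_rfl).op s.1 :=
  rfl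

variable {R : Type u} [CommRing R] {X : Scheme.{u}} (f : X ⟶ Spec (.of R)) (E : BigZariskiSheaf X)
  {T T' : Over (Spec (.of R))} (hT : affineNoetherianOver _ T) (hT' : affineNoetherianOver _ T')
  (h : T' ⟶ T)

theorem prodMap_base_fst_id : (prodMap f h.left (Over.w h)).base ≫ (pullback.fst f T.hom).base =
    (pullback.fst f T'.hom).base ≫ 𝟙 _ :=
  (congrArg (fun k : _ ⟶ X => k.base) (prodMap_fst f h.left (Over.w h))).trans
    (Category.comp_id _).symm

/-- On sections of `E` both composites are pull-back along one and the same morphism `X_{T'} ⟶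
X_{Spec (R ⊕ N)}`, by the naturality of `toNilSpec`. -/
theorem nilComparison_naturality :
    (nilComparison f E hT ≫ (push (pullback.fst f T.hom).base).map
      (tildeHom f E h.left (Over.w h))) ≫
        pushCongr (prodMap_base_fst_id f h) (tildeSheaf f E T'.hom) =
    (nilSheafMap f E (nilAlgebraMap hT hT' h) ≫ (toPushId _).app _) ≫
      (push (𝟙 _)).map (nilComparison f E hT') := by
  refine comp_pushCongr_eq (prodMap_base_fst_id f h) _ _ _ _
    (fun U => fst_preimage_le f h.left (Over.w h) U) fun U s => ?_
  have hp : prodMap f h.left (Over.w h) ≫ prodMap f (toNilSpec hT).left (Over.w (toNilSpec hT)) =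
      prodMap f (toNilSpec hT').left (Over.w (toNilSpec hT')) ≫
        prodMap f (specOverMap (nilAlgebraMap hT hT' h)).left (Over.w _) :=
    (prodMap_comp f _ _ _ _ _ (Over.w (h ≫ toNilSpec hT)) rfl).trans
      (prodMap_comp f _ _ _ _ _ _
        (congrArg (fun k => k.left) (toNilSpec_naturality hT hT' h)).symm).symm
  apply Subtype.ext
  have hl := (resHom_tildeSheaf_val f E T'.hom (fst_preimage_le f h.left (Over.w h) U) _).trans
    (congrArg (E.obj.map _) ((tildeHom_val f E h.left (Over.w h) _ _).trans
      (congrArg (E.obj.map _) (nilComparison_val f E hT U s))))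
  have hr := (nilComparison_val f E hT' U _).trans (congrArg (E.obj.map _)
    (nilSheafMap_val f E (nilAlgebraMap hT hT' h) U s
      (fst_preimage_le f (specOverMap (nilAlgebraMap hT hT' h)).left (Over.w _) U)))
  refine hl.trans (Eq.trans ?_ hr.symm)
  refine (map_map_apply' E _ _ _ (opensOverHom_comp _ _ _ _ (prodMap f h.left (Over.w h))
    (prodMap_fst ..) (Category.id_comp _) _ _ _ _ _ (fst_preimage_le f h.left (Over.w h) U))
    _).trans ?_
  refine map_map_apply E _ _ _ _ ?_ s.1.1
  have hle := preimage_le_preimage (p := pullback.fst f (specOver (nilAlgebra T hT)).hom)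
    (p' := pullback.fst f T'.hom)
    (prodMap f h.left (Over.w h) ≫ prodMap f (toNilSpec hT).left (Over.w (toNilSpec hT)))
    (by rw [Category.assoc, prodMap_fst, prodMap_fst]) U
  exact (opensOverHom_comp _ _ _ _ _ (by rw [Category.assoc, prodMap_fst, prodMap_fst]) rfl
    _ _ _ _ _ hle).trans (opensOverHom_comp _ _ _ _ _ _ hp.symm _ _ _ _ _ _).symm

theorem cohMap_nilComparison_naturality (q : ℕ) :
    cohMap (pullback.fst f T.hom).base (nilComparison f E hT) q ≫ (tildeCoh f E q).map h.op =
      cohMap (𝟙 _) (nilSheafMap f E (nilAlgebraMap hT hT' h) ≫ (toPushId _).app _) q ≫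
        cohMap (pullback.fst f T'.hom).base (nilComparison f E hT') q := by
  refine (cohMap_comp _ _ _ _ q).trans ?_
  refine Eq.trans ?_ (cohMap_comp _ _ _ _ q).symm
  exact cohMap_congr (prodMap_base_fst_id f h) _ _ (nilComparison_naturality f E hT hT' h) q

end Comparison

/-! ### The groups `H^q(X, Ẽ_N)` and their two comparisons. -/

section NilCohomology

variable {R : Type u} [CommRing R] {X : Scheme.{u}} (f : X ⟶ Spec (.of R)) (E : BigZariskiSheaf X)
  (q : ℕ)

/-- The cohomology group `H^q(X, Ẽ_N)`, computed by an injective resolution. -/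
def nilCoh (N : NilpotentAlgebra R) : AddCommGrpCat.{u} :=
  coh ((push (pullback.fst f (NilpotentAlgebra.specOver N).hom).base).obj (nilSheaf f E N)) q

/-- The functoriality of `H^q(X, Ẽ_N)`. -/
def nilCohMap {M N : NilpotentAlgebra R} (a : M ⟶ N) : nilCoh f E q M ⟶ nilCoh f E q N :=
  cohMap (𝟙 _) (nilSheafMap f E a ≫ (toPushId _).app _) q

/-- The identification of `H^q(X, Ẽ_N)` with `Ψ^q(N)`. -/
def nilCohToPsi (N : NilpotentAlgebra R) : nilCoh f E q N ⟶ (Psi f E q).obj N :=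
  cohToH ((push (pullback.fst f (NilpotentAlgebra.specOver N).hom).base).obj (nilSheaf f E N)) q

theorem bijective_nilCohToPsi (N : NilpotentAlgebra R) :
    Function.Bijective (nilCohToPsi f E q N) :=
  bijective_cohToH _ q

theorem nilCohToPsi_naturality {M N : NilpotentAlgebra R} (a : M ⟶ N) :
    nilCohMap f E q a ≫ nilCohToPsi f E q N = nilCohToPsi f E q M ≫ (Psi f E q).map a :=
  cohMap_cohToH (nilSheafMap f E a) q

variable {T T' : Over (Spec (.of R))} (hT : affineNoetherianOver _ T)

/-- The comparison `H^q(X, Ẽ_N) ⟶ H^q(X_T, Ẽ_T)` for `N = nil(Γ(T, 𝒪_T))`. -/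
def nilCohComparison : nilCoh f E q (nilAlgebra T hT) ⟶ (tildeCoh f E q).obj (op T) :=
  cohMap (pullback.fst f T.hom).base (nilComparison f E hT) q

theorem isIso_nilCohComparison [Flat f] (hE : IsFormalLieGroup E) :
    IsIso (nilCohComparison f E q hT) :=
  isIso_cohMap_nilComparison f E hT hE q

theorem nilCohComparison_naturality (hT' : affineNoetherianOver _ T') (h : T' ⟶ T) :
    nilCohComparison f E q hT ≫ (tildeCoh f E q).map h.op =
      nilCohMap f E q (nilAlgebraMap hT hT' h) ≫ nilCohComparison f E q hT' :=
  cohMap_nilComparison_naturality f E hT hT' h q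

end NilCohomology

/-! ### Assembling the isomorphism `H^q(X_T, Ẽ_T) ≅ G(T)`. -/

section ProRepresentability

variable {R : Type u} [CommRing R] {X : Scheme.{u}} {f : X ⟶ Spec (.of R)} [Flat f]
  {E : BigZariskiSheaf X} (hE : IsFormalLieGroup E) {q : ℕ} {G : BigZariskiSheaf (Spec (.of R))}
  (ε : Psi f E q ≅ nilPoints G)

variable (f q) in
/-- The isomorphism `H^q(X, Ẽ_N) ≅ H^q(X_T, Ẽ_T)` for `N = nil(Γ(T, 𝒪_T))`. -/
def nilCohIso {T : Over (Spec (.of R))} (hT : affineNoetherianOver _ T) :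
    nilCoh f E q (nilAlgebra T hT) ≅ (tildeCoh f E q).obj (op T) :=
  let _ := isIso_nilCohComparison f E q hT hE
  asIso (nilCohComparison f E q hT)

/-- The map `H^q(X, Ẽ_N) ⟶ G(T)` for `N = nil(Γ(T, 𝒪_T))`. -/
def nilCohToPoints {T : Over (Spec (.of R))} (hT : affineNoetherianOver _ T) :
    nilCoh f E q (nilAlgebra T hT) ⟶ G.obj.obj (op T) :=
  nilCohToPsi f E q _ ≫ ε.hom.app (nilAlgebra T hT) ≫ nilPointsMap G hT

omit [Flat f] in
theorem nilCohToPoints_naturality {T T' : Over (Spec (.of R))} (hT : affineNoetherianOver _ T)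
    (hT' : affineNoetherianOver _ T') (h : T' ⟶ T) :
    nilCohToPoints ε hT ≫ G.obj.map h.op =
      nilCohMap f E q (nilAlgebraMap hT hT' h) ≫ nilCohToPoints ε hT' := by
  simp only [nilCohToPoints, Category.assoc]
  rw [nilPointsMap_naturality G hT hT' h, ← ε.hom.naturality_assoc,
    reassoc_of% nilCohToPsi_naturality]

theorem nilCohIso_naturality {T T' : Over (Spec (.of R))} (hT : affineNoetherianOver _ T)
    (hT' : affineNoetherianOver _ T') (h : T' ⟶ T) :
    (nilCohIso f hE q hT).hom ≫ (tildeCoh f E q).map h.op =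
      nilCohMap f E q (nilAlgebraMap hT hT' h) ≫ (nilCohIso f hE q hT').hom :=
  nilCohComparison_naturality f E q hT hT' h

/-- The map `H^q(X_T, Ẽ_T) ⟶ G(T)` for affine noetherian `T`. -/
def tildeCohToPoints : AffineHom (tildeCoh f E q) G.obj where
  app _ hT := ((nilCohIso f hE q hT).inv ≫ nilCohToPoints ε hT).hom
  naturality {T T'} hT hT' h c := by
    have key : (tildeCoh f E q).map h.op ≫ (nilCohIso f hE q hT').inv ≫ nilCohToPoints ε hT' =
        ((nilCohIso f hE q hT).inv ≫ nilCohToPoints ε hT) ≫ G.obj.map h.op := by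
      refine Eq.trans ?_ (Category.assoc _ _ _).symm
      rw [nilCohToPoints_naturality ε hT hT' h, Iso.eq_inv_comp, ← Category.assoc,
        nilCohIso_naturality hE hT hT' h, Category.assoc, Iso.hom_inv_id_assoc]
    exact ConcreteCategory.congr_hom key c

theorem bijective_tildeCohToPoints (hG : IsFormalLieGroup G) (T : Over (Spec (.of R)))
    (hT : affineNoetherianOver _ T) : Function.Bijective ((tildeCohToPoints hE ε).app T hT) := by
  have h₁ : Function.Bijective (nilCohIso f hE q hT).inv := ConcreteCategory.bijective_of_isIso _
  have h₂ : Function.Bijective (ε.hom.app (nilAlgebra T hT)) :=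
    ConcreteCategory.bijective_of_isIso _
  exact (((bijective_nilPointsMap hG hT).comp h₂).comp (bijective_nilCohToPsi f E q _)).comp h₁

end ProRepresentability

end

end DeformationCohomology

theorem proposition2p2p4 {R : Type u} [CommRing R] [IsNoetherianRing R] {X : Scheme.{u}}
    [AlgebraicGeometry.IsNoetherian X] (f : X ⟶ Spec (.of R)) [Flat f] (E : BigZariskiSheaf X)
    (hE : IsFormalLieGroup E) (q : ℕ) (𝔛 : BigZariskiSheaf (Spec (.of R)))
    (h𝔛 : IsFormalLieGroup 𝔛) (hΨ : Nonempty (Psi f E q ≅ nilPoints 𝔛)) :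
    Nonempty (restrictNoetherian (Phi f E q) ≅ restrictNoetherian 𝔛.obj) := by
  obtain ⟨ε⟩ := hΨ
  exact nonempty_phi_iso f E q 𝔛 (tildeCohToPoints hE ε) (bijective_tildeCohToPoints hE ε h𝔛)
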